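/- Let $G$ be a second-countable locally compact group, let $A$ be a separable and $B$ a $\sigma$-unital C$^*$-algebra, and let $\alpha: G\curvearrowright A$ and $\beta: G\curvearrowright B$ be point-norm continuous actions by $*$-automorphisms. Write $\beta$ also for the induced action on the multiplier algebra $\mathcal M(B)$, and $\mathcal M(B)^\beta$ for its fixed points. Let $\mathcal K$ be the compact operators on $\ell^2(\mathbb N)$. Suppose that $\beta$ is strongly stable, i.e. $(B,\beta)$ is conjugate to $(B\otimes\mathcal K,\beta\otimes\mathrm{id}_{\mathcal K})$. A cocycle representation $(\varphi,u):(A,\alpha)\to(\mathcal M(B),\beta)$ consists of a $*$-homomorphism $\varphi:A\to\mathcal M(B)$ and a strictly continuous map $u:G\to\mathcal U(\mathcal M(B))$ with $u_{gh}=u_g\beta_g(u_h)$ and $u_g\beta_g(\varphi(a))u_g^*=\varphi(\alpha_g(a))$ for all $g,h\in G$, $a\in A$. *Weak containment.* $(\psi,v)\preccurlyeq(\varphi,u)$ means: for all compact sets $K\subseteq G$ and $F\subset A$, every $\varepsilon>0$ and every contraction $b\in B$ there are finitely many $c_1,\dots,c_N\in B$ with $$\max_{g\in K}\Big\|b^*v_g\beta_g(b)-\sum_{k=1}^N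 c_k^*u_g\beta_g(c_k)\Big\|\le\varepsilon,\qquad \max_{a\in F}\Big\|b^*\psi(a)b-\sum_{k=1}^N c_k^*\varphi(a)c_k\Big\|\le\varepsilon .$$ *Asymptotic equivalence.* $(\varphi,u)\sim_{\mathrm{asymp}}(\psi,v)$ means: there is a norm-continuous path $w:[1,\infty)\to\mathcal U(\mathcal M(B))$ such that $\psi(a)=\lim_{t\to\infty}w_t\varphi(a)w_t^*$ in norm for all $a\in A$, $\lim_{t\to\infty}\sup_{g\in K}\|v_g-w_tu_g\beta_g(w_t)^*\|=0$ for all compact $K\subseteq G$, and $\psi(a)-w_t\varphi(a)w_t^*\in B$ and $v_g-w_tu_g\beta_g(w_t)^*\in B$ for all $a\in A$, $g\in G$, $t\ge1$. *Sums.* Given isometries $r_1,r_2\in\mathcal M(B)^\beta$ with $r_1r_1^*+r_2r_2^*=1$, the Cuntz sum is $(\varphi,u)\oplus(\psi,v)=\big(r_1\varphi(\cdot)r_1^*+r_2\psi(\cdot)r_2^*,\ r_1u_\bullet r_1^*+r_2v_\bullet r_2^*\big)$. Given isometries $t_n\in\mathcal M(B)^\beta$ $(n\in\mathbb N)$ with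 $\sum_n t_nt_n^*=1$ strictly, the infinite repeat is $(\varphi^\infty,u^\infty)=\big(\sum_n t_n\varphi(\cdot)t_n^*,\ \sum_n t_nu_\bullet t_n^*\big)$, with strictly convergent sums. Then such pairs $(r_1,r_2)$ and sequences $(t_n)$ exist, and for all cocycle representations $(\varphi,u),(\psi,v):(A,\alpha)\to(\mathcal M(B),\beta)$, whatever choices of isometries are used (independently) to form the sum and each of the infinite repeats, $$(\psi,v)\preccurlyeq(\varphi,u)\iff(\varphi^\infty,u^\infty)\sim_{\mathrm{asymp}}(\psi^\infty,v^\infty)\oplus(\varphi^\infty,u^\infty).$$ -/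

import Mathlib

open Filter Topology
open scoped MultiplierAlgebra TensorProduct

noncomputable section

/-! ### Compact operators on the separable infinite-dimensional Hilbert space `ℓ²(ℕ)` -/

/-- The Hilbert space `ℓ²(ℕ)`. -/
abbrev EllTwo : Type := lp (fun _ : ℕ => ℂ) 2

/-- On a Hilbert space the adjoint of a compact operator is compact. -/
theorem isCompactOperator_star {H : Type*} [NormedAddCommGroup H] [InnerProductSpace ℂ H]
    [CompleteSpace H] {T : H →L[ℂ] H} (hT : IsCompactOperator T) :
    IsCompactOperator (star T : H →L[ℂ] H) := by
  rw [ContinuousLinearMap.star_eq_adjoint]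
  set S := ContinuousLinearMap.adjoint T with hS
  have hTS : IsCompactOperator (T ∘L S) := hT.comp_clm S
  have key : ∀ z : H, ‖S z‖ ^ 2 ≤ ‖(T ∘L S) z‖ * ‖z‖ := by
    intro z
    have h1 : ‖S z‖ ^ 2 = ‖inner ℂ (S z) (S z)‖ := by
      rw [inner_self_eq_norm_sq_to_K]; simp
    rw [h1]
    nth_rewrite 2 [hS]
    rw [ContinuousLinearMap.adjoint_inner_right]
    exact norm_inner_le_norm _ _
  refine (isCompactOperator_iff_isCompact_closure_image_closedBall
    (S : H →ₗ[ℂ] H) one_pos).2 ?_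
  refine TotallyBounded.isCompact_of_isClosed (TotallyBounded.closure ?_) isClosed_closure
  have hc := (isCompactOperator_iff_isCompact_closure_image_closedBall
    ((T ∘L S : H →L[ℂ] H) : H →ₗ[ℂ] H) one_pos).1 hTS
  have htb : TotallyBounded ((T ∘L S) '' Metric.closedBall (0 : H) 1) :=
    hc.totallyBounded.subset subset_closure
  rw [Metric.totallyBounded_iff]
  intro ε hε
  obtain ⟨t, hts, htf, ht⟩ := Metric.finite_approx_of_totallyBounded htb (ε ^ 2 / 4)
    (by positivity)
  have hts' : ∀ y ∈ t, ∃ x ∈ Metric.closedBall (0 : H) 1, (T ∘L S) x = y := fun y hy => hts hy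
  choose! p hp hpy using hts'
  refine ⟨(fun y => S (p y)) '' t, htf.image _, ?_⟩
  rintro _ ⟨x, hx, rfl⟩
  obtain ⟨y, hy, hxy⟩ := Set.mem_iUnion₂.1 (ht ⟨x, hx, rfl⟩)
  refine Set.mem_iUnion₂.2 ⟨S (p y), ⟨y, hy, rfl⟩, ?_⟩
  rw [Metric.mem_ball, dist_eq_norm] at hxy ⊢
  rw [mem_closedBall_zero_iff] at hx
  have hpy1 := mem_closedBall_zero_iff.1 (hp y hy)
  have h2 : ‖x - p y‖ ≤ 2 := (norm_sub_le _ _).trans (by linarith)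
  have h3 := key (x - p y)
  rw [map_sub, map_sub, hpy y hy] at h3
  change ‖S x - S (p y)‖ < ε
  have h4 : ‖S x - S (p y)‖ ^ 2 < ε ^ 2 := by
    nlinarith [norm_nonneg (x - p y), norm_nonneg ((T ∘L S) x - y)]
  exact lt_of_pow_lt_pow_left₀ 2 hε.le h4

/-- The C⋆-algebra `𝒦` of compact operators on `ℓ²(ℕ)`. -/
def CompactOps : NonUnitalStarSubalgebra ℂ (EllTwo →L[ℂ] EllTwo) where
  carrier := {T | IsCompactOperator T}
  zero_mem' := isCompactOperator_zero
  add_mem' := fun hS hT => hS.add hT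
  mul_mem' := fun {_ T} hS _ => hS.comp_clm T
  smul_mem' := fun c _ hT => hT.smul c
  star_mem' := fun hT => isCompactOperator_star hT

/-! ### C⋆-algebras, multipliers and the strict topology -/

/-- A C⋆-algebra is σ-unital if it has a sequential approximate unit of positive contractions. -/
def IsSigmaUnital (B : Type*) [NonUnitalCStarAlgebra B] : Prop :=
  ∃ e : ℕ → B, (∀ n, ∃ c : B, e n = star c * c) ∧ (∀ n, ‖e n‖ ≤ 1) ∧
    ∀ b : B, Tendsto (fun n => e n * b) atTop (𝓝 b) ∧ Tendsto (fun n => b * e n) atTop (𝓝 b)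

section Multipliers

variable {B : Type*} [NonUnitalCStarAlgebra B]

/-- Convergence in the strict topology of the multiplier algebra; here `m.fst b` and `m.snd b` are
the products `m b` and `b m` in `B`. -/
def StrictTendsto {ι : Type*} (f : ι → 𝓜(ℂ, B)) (l : Filter ι) (m : 𝓜(ℂ, B)) : Prop :=
  ∀ b : B, Tendsto (fun i => (f i).fst b) l (𝓝 (m.fst b)) ∧
    Tendsto (fun i => (f i).snd b) l (𝓝 (m.snd b))

/-- Continuity with respect to the strict topology of the multiplier algebra. -/
def StrictContinuous {X : Type*} [TopologicalSpace X] (f : X → 𝓜(ℂ, B)) : Prop :=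
  ∀ x : X, StrictTendsto f (𝓝 x) (f x)

/-- A multiplier that lies in (the canonical image of) `B`. -/
def MemBase (m : 𝓜(ℂ, B)) : Prop := ∃ b : B, (b : 𝓜(ℂ, B)) = m

theorem multiplier_ext {m m' : 𝓜(ℂ, B)} (h₁ : ∀ b, m.fst b = m'.fst b)
    (h₂ : ∀ b, m.snd b = m'.snd b) : m = m' :=
  DoubleCentralizer.ext ℂ B m m'
    (Prod.ext (ContinuousLinearMap.ext h₁) (ContinuousLinearMap.ext h₂))

theorem StrictTendsto.unique {ι : Type*} {f : ι → 𝓜(ℂ, B)} {l : Filter ι} [l.NeBot]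
    {m m' : 𝓜(ℂ, B)} (h : StrictTendsto f l m) (h' : StrictTendsto f l m') : m = m' :=
  multiplier_ext (fun b => tendsto_nhds_unique (h b).1 (h' b).1)
    (fun b => tendsto_nhds_unique (h b).2 (h' b).2)

/-- The canonical extension of an automorphism of `B` to the multiplier algebra. -/
def multiplierExt (e : B ≃⋆ₐ[ℂ] B) : 𝓜(ℂ, B) →⋆ₐ[ℂ] 𝓜(ℂ, B) :=
  let E : B →L[ℂ] B := ⟨⟨⟨e, map_add e⟩, map_smul e⟩, (StarAlgEquiv.isometry e).continuous⟩
  let E' : B →L[ℂ] B :=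
    ⟨⟨⟨e.symm, map_add e.symm⟩, map_smul e.symm⟩, (StarAlgEquiv.isometry e.symm).continuous⟩
  { toFun := fun m =>
      { toProd := (E ∘L m.fst ∘L E', E ∘L m.snd ∘L E')
        central := fun x y => by
          have h := congrArg e (m.central (e.symm x) (e.symm y))
          simpa [E, E'] using h }
    map_one' := multiplier_ext (fun b => by simp [E, E']) (fun b => by simp [E, E'])
    map_mul' := fun m n =>
      multiplier_ext (fun b => by simp [E, E']) (fun b => by simp [E, E'])
    map_zero' := multiplier_ext (fun b => by simp [E, E']) (fun b => by simp [E, E'])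
    map_add' := fun m n =>
      multiplier_ext (fun b => by simp [E, E']) (fun b => by simp [E, E'])
    commutes' := fun c =>
      multiplier_ext (fun b => by simp [E, E', Algebra.algebraMap_eq_smul_one])
        (fun b => by simp [E, E', Algebra.algebraMap_eq_smul_one])
    map_star' := fun m =>
      multiplier_ext (fun b => by simp [E, E', map_star])
        (fun b => by simp [E, E', map_star]) }

theorem multiplierExt_fst (e : B ≃⋆ₐ[ℂ] B) (m : 𝓜(ℂ, B)) (b : B) :
    (multiplierExt e m).fst b = e (m.fst (e.symm b)) := rfl

theorem multiplierExt_snd (e : B ≃⋆ₐ[ℂ] B) (m : 𝓜(ℂ, B)) (b : B) :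
    (multiplierExt e m).snd b = e (m.snd (e.symm b)) := rfl

theorem norm_unitary_le (u : unitary 𝓜(ℂ, B)) : ‖(u : 𝓜(ℂ, B))‖ ≤ 1 := by
  rcases subsingleton_or_nontrivial 𝓜(ℂ, B) with h | h
  · rw [Subsingleton.elim (u : 𝓜(ℂ, B)) 0, norm_zero]; exact zero_le_one
  · exact (CStarRing.norm_coe_unitary u).le

theorem star_fst_mul (m : 𝓜(ℂ, B)) (x y : B) :
    star (m.fst x) * y = star x * (star m).fst y := by
  have h := (star m).central (star x) y
  simpa using h

/-- A strictly Cauchy sequence of multipliers converges strictly. -/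
theorem exists_strictTendsto {y : ℕ → 𝓜(ℂ, B)} (h₁ : ∀ b, CauchySeq fun n => (y n).fst b)
    (h₂ : ∀ b, CauchySeq fun n => (y n).snd b) : ∃ m, StrictTendsto y atTop m := by
  choose L hL using fun b => cauchySeq_tendsto_of_complete (h₁ b)
  choose R hR using fun b => cauchySeq_tendsto_of_complete (h₂ b)
  refine ⟨{ toProd := (continuousLinearMapOfTendsto (fun n => (y n).fst) (f := L) (l := atTop)
              (tendsto_pi_nhds.2 hL),
            continuousLinearMapOfTendsto (fun n => (y n).snd) (f := R) (l := atTop)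
              (tendsto_pi_nhds.2 hR))
            central := fun a b => ?_ }, fun b => ⟨hL b, hR b⟩⟩
  refine tendsto_nhds_unique ((hR a).mul_const b) ?_
  simp only [(y _).central]
  exact (hL b).const_mul a

end Multipliers

/-! ### Actions, strong stability and invariant isometries -/

/-- A continuous (that is, point-norm continuous) action of `G` on the C⋆-algebra `B` by
⋆-automorphisms. -/
structure CStarAction (G B : Type*) [Group G] [TopologicalSpace G] [NonUnitalCStarAlgebra B] where
  /-- the automorphism by which a group element acts -/
  aut : G →* (B ≃⋆ₐ[ℂ] B)
  continuous_aut : ∀ b : B, Continuous fun g => aut g b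

section Actions

variable {G A B : Type*} [Group G] [TopologicalSpace G]
  [NonUnitalCStarAlgebra A] [NonUnitalCStarAlgebra B]

/-- The induced automorphism of the multiplier algebra. -/
def CStarAction.mul (β : CStarAction G B) (g : G) : 𝓜(ℂ, B) →⋆ₐ[ℂ] 𝓜(ℂ, B) :=
  multiplierExt (β.aut g)

/-- The dynamical system `(D, γ)` is (conjugate to) the stabilization `(B ⊗ 𝒦, β ⊗ id)`:
`D` is a C⋆-completion of the algebraic tensor product `B ⊙ 𝒦`, and `γ` restricts to `β ⊙ id`.
As `𝒦` is nuclear, `B ⊙ 𝒦` has exactly one C⋆-norm, so that `B ⊗ 𝒦` is its only completion. -/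
def IsStabilization {D : Type*} [NonUnitalCStarAlgebra D] (β : CStarAction G B)
    (γ : CStarAction G D) : Prop :=
  ∃ j : (B ⊗[ℂ] CompactOps) →⋆ₙₐ[ℂ] D, Function.Injective j ∧ DenseRange j ∧
    ∀ (g : G) (b : B) (k : CompactOps), γ.aut g (j (b ⊗ₜ[ℂ] k)) = j (β.aut g b ⊗ₜ[ℂ] k)

/-- `β` is strongly stable if `(B, β)` is conjugate to `(B ⊗ 𝒦, β ⊗ id)`. -/
def CStarAction.StronglyStable (β : CStarAction G B) : Prop := IsStabilization β β

/-- A pair of isometries `r₁, r₂` in the fixed point algebra `𝓜(B)^β` with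
`r₁ r₁⋆ + r₂ r₂⋆ = 1`. -/
structure CuntzIsometries (β : CStarAction G B) where
  /-- the first isometry -/
  r₁ : 𝓜(ℂ, B)
  /-- the second isometry -/
  r₂ : 𝓜(ℂ, B)
  isometry₁ : star r₁ * r₁ = 1
  isometry₂ : star r₂ * r₂ = 1
  fixed₁ : ∀ g, β.mul g r₁ = r₁
  fixed₂ : ∀ g, β.mul g r₂ = r₂
  sum_eq_one : r₁ * star r₁ + r₂ * star r₂ = 1

/-- A sequence of isometries `tₙ` in the fixed point algebra `𝓜(B)^β` with `∑ tₙ tₙ⋆ = 1` in the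
strict topology. -/
structure IsometrySequence (β : CStarAction G B) where
  /-- the isometries -/
  t : ℕ → 𝓜(ℂ, B)
  isometry : ∀ n, star (t n) * t n = 1
  fixed : ∀ n g, β.mul g (t n) = t n
  sum_eq_one : StrictTendsto (fun N => ∑ n ∈ Finset.range N, t n * star (t n)) atTop 1

namespace CuntzIsometries

variable {β : CStarAction G B} (r : CuntzIsometries β)

theorem orth : star r.r₁ * r.r₂ = 0 := by
  have h : star r.r₁ * (r.r₁ * star r.r₁ + r.r₂ * star r.r₂) * r.r₂ = star r.r₁ * r.r₂ := by
    rw [r.sum_eq_one, mul_one]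
  have h' : star r.r₁ * (r.r₁ * star r.r₁ + r.r₂ * star r.r₂) * r.r₂
      = (star r.r₁ * r.r₁) * (star r.r₁ * r.r₂) + (star r.r₁ * r.r₂) * (star r.r₂ * r.r₂) := by
    noncomm_ring
  rw [h', r.isometry₁, r.isometry₂, one_mul, mul_one] at h
  simpa using h

theorem orth' : star r.r₂ * r.r₁ = 0 := by
  have h := congrArg star r.orth
  simpa using h

/-- The Cuntz sum `b₁ ⊕ b₂ = r₁ b₁ r₁⋆ + r₂ b₂ r₂⋆` of two multipliers. -/
def sum (b₁ b₂ : 𝓜(ℂ, B)) : 𝓜(ℂ, B) := r.r₁ * b₁ * star r.r₁ + r.r₂ * b₂ * star r.r₂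

theorem sum_mul (a₁ a₂ b₁ b₂ : 𝓜(ℂ, B)) :
    r.sum (a₁ * b₁) (a₂ * b₂) = r.sum a₁ a₂ * r.sum b₁ b₂ := by
  have h : r.sum a₁ a₂ * r.sum b₁ b₂ =
      r.r₁ * a₁ * (star r.r₁ * r.r₁) * b₁ * star r.r₁
      + r.r₁ * a₁ * (star r.r₁ * r.r₂) * b₂ * star r.r₂
      + r.r₂ * a₂ * (star r.r₂ * r.r₁) * b₁ * star r.r₁
      + r.r₂ * a₂ * (star r.r₂ * r.r₂) * b₂ * star r.r₂ := by
    unfold sum; noncomm_ring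
  rw [h, r.isometry₁, r.isometry₂, r.orth, r.orth']
  simp [sum, mul_assoc]

theorem sum_star (b₁ b₂ : 𝓜(ℂ, B)) : r.sum (star b₁) (star b₂) = star (r.sum b₁ b₂) := by
  simp [sum, mul_assoc]

theorem sum_one : r.sum 1 1 = 1 := by
  simp [sum, r.sum_eq_one]

theorem map_sum (g : G) (b₁ b₂ : 𝓜(ℂ, B)) :
    β.mul g (r.sum b₁ b₂) = r.sum (β.mul g b₁) (β.mul g b₂) := by
  simp [sum, map_add, map_mul, map_star, r.fixed₁, r.fixed₂]

end CuntzIsometries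

namespace IsometrySequence

variable {β : CStarAction G B} (T : IsometrySequence β)

/-- The ranges of the isometries are pairwise orthogonal. -/
theorem orth {i j : ℕ} (hij : i ≠ j) : star (T.t i) * T.t j = 0 := by
  let _ : PartialOrder B := CStarAlgebra.spectralOrder B
  have _ : StarOrderedRing B := CStarAlgebra.spectralOrderedRing B
  suffices h : ∀ b, (star (T.t i) * T.t j).fst b = 0 by
    rw [← norm_eq_zero, ← DoubleCentralizer.norm_fst, norm_eq_zero]
    exact ContinuousLinearMap.ext h
  intro b
  set c := (T.t j).fst b with hc
  set q : ℕ → B := fun n => star ((star (T.t n)).fst c) * (star (T.t n)).fst c with hq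
  have hq0 : ∀ n, 0 ≤ q n := fun n => star_mul_self_nonneg _
  have hqj : q j = star c * c := by
    have h1 : (star (T.t j)).fst c = b := by
      have := congrArg (fun m : 𝓜(ℂ, B) => m.fst b) (T.isometry j)
      simpa using this
    have h2 : star c * c = star b * (star (T.t j)).fst c := by
      rw [hc, star_fst_mul]
    simp only [hq]
    rw [h2, h1]
  have hlim : Tendsto (fun N => ∑ n ∈ Finset.range N, q n) atTop (𝓝 (star c * c)) := by
    have h := ((T.sum_eq_one c).1).const_mul (star c)
    simp only [DoubleCentralizer.one_fst, one_apply_eq_self] at h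
    refine h.congr fun N => ?_
    have h3 : ∀ n, q n = star c * (T.t n * star (T.t n)).fst c := by
      intro n
      simp only [hq]
      rw [star_fst_mul, star_star]
      rfl
    simp only [h3, ← Finset.mul_sum]
    congr 1
    have : ∀ s : Finset ℕ, (∑ n ∈ s, T.t n * star (T.t n)).fst c
        = ∑ n ∈ s, (T.t n * star (T.t n)).fst c := by
      intro s
      induction s using Finset.induction_on with
      | empty => simp
      | insert a s ha ih => rw [Finset.sum_insert ha, Finset.sum_insert ha, ← ih]; rfl
    exact this _
  have hle : q i + q j ≤ star c * c := by
    refine ge_of_tendsto hlim ?_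
    filter_upwards [eventually_gt_atTop (max i j)] with N hN
    rw [← Finset.sum_pair hij]
    refine Finset.sum_le_sum_of_subset_of_nonneg ?_ fun n _ _ => hq0 n
    intro n hn
    simp only [Finset.mem_insert, Finset.mem_singleton] at hn
    rcases hn with rfl | rfl
    · exact Finset.mem_range.2 (lt_of_le_of_lt (le_max_left _ _) hN)
    · exact Finset.mem_range.2 (lt_of_le_of_lt (le_max_right _ _) hN)
  rw [hqj] at hle
  have hqi : q i = 0 := le_antisymm (by simpa using hle) (hq0 i)
  exact CStarRing.star_mul_self_eq_zero_iff _ |>.1 hqi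

/-- The partial sums `x ↦ ∑_{n ∈ F} tₙ x tₙ⋆` are ⋆-homomorphisms. -/
def partialSum (F : Finset ℕ) : 𝓜(ℂ, B) →⋆ₙₐ[ℂ] 𝓜(ℂ, B) where
  toFun x := ∑ n ∈ F, T.t n * x * star (T.t n)
  map_smul' c x := by simp [Finset.smul_sum]
  map_zero' := by simp
  map_add' x y := by simp [mul_add, add_mul, Finset.sum_add_distrib]
  map_mul' x y := by
    rw [Finset.sum_mul_sum]
    refine Finset.sum_congr rfl fun i hi => ?_
    rw [Finset.sum_eq_single i]
    · have h : T.t i * x * star (T.t i) * (T.t i * y * star (T.t i))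
          = T.t i * x * (star (T.t i) * T.t i) * y * star (T.t i) := by noncomm_ring
      rw [h, T.isometry]
      noncomm_ring
    · intro j _ hj
      have h : T.t i * x * star (T.t i) * (T.t j * y * star (T.t j))
          = T.t i * x * (star (T.t i) * T.t j) * y * star (T.t j) := by noncomm_ring
      rw [h, T.orth hj.symm]
      simp
    · intro h; exact absurd hi h
  map_star' x := by simp [star_sum, mul_assoc]

theorem partialSum_apply (F : Finset ℕ) (x : 𝓜(ℂ, B)) :
    T.partialSum F x = ∑ n ∈ F, T.t n * x * star (T.t n) := rfl

theorem norm_partialSum_fst_le (F : Finset ℕ) (x : 𝓜(ℂ, B)) (b : B) :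
    ‖(T.partialSum F x).fst b‖ ≤ ‖x‖ * ‖(T.partialSum F 1).fst b‖ := by
  have h : (T.partialSum F x).fst b = (T.partialSum F x).fst ((T.partialSum F 1).fst b) := by
    conv_lhs => rw [← mul_one x, map_mul]
    rfl
  rw [h]
  refine (ContinuousLinearMap.le_opNorm _ _).trans ?_
  rw [DoubleCentralizer.norm_fst]
  gcongr
  exact NonUnitalStarAlgHom.norm_apply_le _ _

theorem norm_partialSum_snd_le (F : Finset ℕ) (x : 𝓜(ℂ, B)) (b : B) :
    ‖(T.partialSum F x).snd b‖ ≤ ‖x‖ * ‖(T.partialSum F 1).snd b‖ := by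
  have h : (T.partialSum F x).snd b = (T.partialSum F x).snd ((T.partialSum F 1).snd b) := by
    conv_lhs => rw [← one_mul x, map_mul]
    rfl
  rw [h]
  refine (ContinuousLinearMap.le_opNorm _ _).trans ?_
  rw [DoubleCentralizer.norm_snd]
  gcongr
  exact NonUnitalStarAlgHom.norm_apply_le _ _

theorem partialSum_sub {M N : ℕ} (h : M ≤ N) (x : 𝓜(ℂ, B)) :
    T.partialSum (Finset.range N) x - T.partialSum (Finset.range M) x
      = T.partialSum (Finset.Ico M N) x := by
  rw [partialSum_apply, partialSum_apply, partialSum_apply, Finset.sum_Ico_eq_sub _ h]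

theorem strictTendsto_partialSum_one :
    StrictTendsto (fun N => T.partialSum (Finset.range N) 1) atTop 1 := by
  simpa [partialSum_apply] using T.sum_eq_one

theorem exists_infiniteSum (x : 𝓜(ℂ, B)) :
    ∃ m, StrictTendsto (fun N => T.partialSum (Finset.range N) x) atTop m := by
  have key : ∀ (u v : ℕ → B), (∀ M N, M ≤ N → ‖u N - u M‖ ≤ ‖x‖ * ‖v N - v M‖) →
      CauchySeq v → CauchySeq u := by
    intro u v huv hv
    rw [Metric.cauchySeq_iff'] at hv ⊢
    intro ε hε
    obtain ⟨N, hN⟩ := hv (ε / (‖x‖ + 1)) (by positivity)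
    refine ⟨N, fun n hn => ?_⟩
    have h1 := huv N n hn
    have h2 := hN n hn
    rw [dist_eq_norm] at h2 ⊢
    rw [lt_div_iff₀ (by positivity)] at h2
    nlinarith [norm_nonneg x, norm_nonneg (v n - v N)]
  refine exists_strictTendsto (fun b => ?_) (fun b => ?_)
  · refine key _ _ (fun M N hMN => ?_) ((T.strictTendsto_partialSum_one b).1.cauchySeq)
    have h := T.norm_partialSum_fst_le (Finset.Ico M N) x b
    rw [← T.partialSum_sub hMN, ← T.partialSum_sub hMN] at h
    exact h
  · refine key _ _ (fun M N hMN => ?_) ((T.strictTendsto_partialSum_one b).2.cauchySeq)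
    have h := T.norm_partialSum_snd_le (Finset.Ico M N) x b
    rw [← T.partialSum_sub hMN, ← T.partialSum_sub hMN] at h
    exact h

/-- The strictly convergent sum `∑ tₙ x tₙ⋆`. -/
def infiniteSum (x : 𝓜(ℂ, B)) : 𝓜(ℂ, B) := (T.exists_infiniteSum x).choose

theorem infiniteSum_spec (x : 𝓜(ℂ, B)) :
    StrictTendsto (fun N => ∑ n ∈ Finset.range N, T.t n * x * star (T.t n)) atTop
      (T.infiniteSum x) :=
  (T.exists_infiniteSum x).choose_spec

theorem norm_infiniteSum_fst_sub_le (N : ℕ) (x : 𝓜(ℂ, B)) (b : B) :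
    ‖(T.infiniteSum x).fst b - (T.partialSum (Finset.range N) x).fst b‖
      ≤ ‖x‖ * ‖b - (T.partialSum (Finset.range N) 1).fst b‖ := by
  have h1 := (((T.infiniteSum_spec x) b).1.sub_const
    ((T.partialSum (Finset.range N) x).fst b)).norm
  have h2 := ((((T.strictTendsto_partialSum_one) b).1.sub_const
    ((T.partialSum (Finset.range N) 1).fst b)).norm).const_mul ‖x‖
  refine le_of_tendsto_of_tendsto h1 h2 ?_
  filter_upwards [eventually_ge_atTop N] with M hM
  have h := T.norm_partialSum_fst_le (Finset.Ico N M) x b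
  rw [← T.partialSum_sub hM, ← T.partialSum_sub hM] at h
  exact h

theorem norm_infiniteSum_snd_sub_le (N : ℕ) (x : 𝓜(ℂ, B)) (b : B) :
    ‖(T.infiniteSum x).snd b - (T.partialSum (Finset.range N) x).snd b‖
      ≤ ‖x‖ * ‖b - (T.partialSum (Finset.range N) 1).snd b‖ := by
  have h1 := (((T.infiniteSum_spec x) b).2.sub_const
    ((T.partialSum (Finset.range N) x).snd b)).norm
  have h2 := ((((T.strictTendsto_partialSum_one) b).2.sub_const
    ((T.partialSum (Finset.range N) 1).snd b)).norm).const_mul ‖x‖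
  refine le_of_tendsto_of_tendsto h1 h2 ?_
  filter_upwards [eventually_ge_atTop N] with M hM
  have h := T.norm_partialSum_snd_le (Finset.Ico N M) x b
  rw [← T.partialSum_sub hM, ← T.partialSum_sub hM] at h
  exact h

theorem tendsto_partialSum (x : 𝓜(ℂ, B)) :
    StrictTendsto (fun N => T.partialSum (Finset.range N) x) atTop (T.infiniteSum x) :=
  T.infiniteSum_spec x

theorem infiniteSum_unique {x m : 𝓜(ℂ, B)}
    (h : StrictTendsto (fun N => T.partialSum (Finset.range N) x) atTop m) :
    T.infiniteSum x = m :=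
  (T.tendsto_partialSum x).unique h

theorem infiniteSum_one : T.infiniteSum 1 = 1 :=
  T.infiniteSum_unique T.strictTendsto_partialSum_one

theorem infiniteSum_add (x y : 𝓜(ℂ, B)) :
    T.infiniteSum (x + y) = T.infiniteSum x + T.infiniteSum y := by
  refine T.infiniteSum_unique fun b => ?_
  simp only [map_add]
  exact ⟨((T.tendsto_partialSum x) b).1.add ((T.tendsto_partialSum y) b).1,
    ((T.tendsto_partialSum x) b).2.add ((T.tendsto_partialSum y) b).2⟩

theorem infiniteSum_smul (c : ℂ) (x : 𝓜(ℂ, B)) :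
    T.infiniteSum (c • x) = c • T.infiniteSum x := by
  refine T.infiniteSum_unique fun b => ?_
  simp only [map_smul]
  exact ⟨((T.tendsto_partialSum x) b).1.const_smul c,
    ((T.tendsto_partialSum x) b).2.const_smul c⟩

theorem infiniteSum_star (x : 𝓜(ℂ, B)) :
    T.infiniteSum (star x) = star (T.infiniteSum x) := by
  refine T.infiniteSum_unique fun b => ?_
  simp only [map_star, DoubleCentralizer.star_fst, DoubleCentralizer.star_snd]
  exact ⟨((T.tendsto_partialSum x) (star b)).2.star, ((T.tendsto_partialSum x) (star b)).1.star⟩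

theorem infiniteSum_mul (x y : 𝓜(ℂ, B)) :
    T.infiniteSum (x * y) = T.infiniteSum x * T.infiniteSum y := by
  have key : ∀ (C : ℝ) (f : ℕ → B →L[ℂ] B) (F : B → B) (z : ℕ → B) (w : B),
      (∀ n, ‖f n‖ ≤ C) → Tendsto (fun n => f n w) atTop (𝓝 (F w)) →
      Tendsto z atTop (𝓝 w) → Tendsto (fun n => f n (z n)) atTop (𝓝 (F w)) := by
    intro C f F z w hf hF hz
    have h0 : Tendsto (fun n => f n (z n - w)) atTop (𝓝 0) := by
      refine squeeze_zero_norm (a := fun n => C * ‖z n - w‖) (fun n => ?_) ?_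
      · exact ((f n).le_opNorm _).trans (by gcongr; exact hf n)
      · have := ((hz.sub_const w).norm).const_mul C
        simpa using this
    have h1 := h0.add hF
    simpa using h1
  have hn : ∀ (z : 𝓜(ℂ, B)) (n : ℕ), ‖T.partialSum (Finset.range n) z‖ ≤ ‖z‖ :=
    fun z n => NonUnitalStarAlgHom.norm_apply_le _ _
  refine T.infiniteSum_unique fun b => ?_
  simp only [map_mul, DoubleCentralizer.mul_fst, DoubleCentralizer.mul_snd]
  constructor
  · exact key ‖x‖ (fun n => (T.partialSum (Finset.range n) x).fst) (T.infiniteSum x).fst _ _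
      (fun n => by simpa only [DoubleCentralizer.norm_fst] using hn x n)
      ((T.tendsto_partialSum x) _).1 ((T.tendsto_partialSum y) b).1
  · exact key ‖y‖ (fun n => (T.partialSum (Finset.range n) y).snd) (T.infiniteSum y).snd _ _
      (fun n => by simpa only [DoubleCentralizer.norm_snd] using hn y n)
      ((T.tendsto_partialSum y) _).2 ((T.tendsto_partialSum x) b).2

theorem map_infiniteSum (g : G) (x : 𝓜(ℂ, B)) :
    β.mul g (T.infiniteSum x) = T.infiniteSum (β.mul g x) := by
  symm
  refine T.infiniteSum_unique fun b => ?_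
  have h : ∀ N, T.partialSum (Finset.range N) (β.mul g x)
      = β.mul g (T.partialSum (Finset.range N) x) := by
    intro N
    simp [partialSum_apply, map_sum, map_mul, map_star, T.fixed]
  have hc : Continuous (β.aut g) := (StarAlgEquiv.isometry _).continuous
  simp only [h]
  exact ⟨(hc.tendsto _).comp ((T.tendsto_partialSum x) _).1,
    (hc.tendsto _).comp ((T.tendsto_partialSum x) _).2⟩

/-- The map `x ↦ ∑ tₙ x tₙ⋆` is a unital ⋆-homomorphism. -/
def infiniteSumHom : 𝓜(ℂ, B) →⋆ₐ[ℂ] 𝓜(ℂ, B) where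
  toFun := T.infiniteSum
  map_one' := T.infiniteSum_one
  map_mul' := T.infiniteSum_mul
  map_zero' := by simpa using T.infiniteSum_smul 0 0
  map_add' := T.infiniteSum_add
  commutes' c := by
    rw [Algebra.algebraMap_eq_smul_one, T.infiniteSum_smul, T.infiniteSum_one]
  map_star' := T.infiniteSum_star

theorem infiniteSum_strictContinuous {X : Type*} [TopologicalSpace X] {f : X → 𝓜(ℂ, B)}
    (hf : StrictContinuous f) {C : ℝ} (hC : ∀ x, ‖f x‖ ≤ C) :
    StrictContinuous fun x => T.infiniteSum (f x) := by
  have hsum : ∀ (F : Finset ℕ) (y : 𝓜(ℂ, B)) (b : B),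
      (T.partialSum F y).fst b = ∑ n ∈ F, (T.t n).fst (y.fst ((star (T.t n)).fst b)) := by
    intro F y b
    rw [partialSum_apply]
    induction F using Finset.induction_on with
    | empty => simp
    | insert a s ha ih => rw [Finset.sum_insert ha, Finset.sum_insert ha, ← ih]; rfl
  have hsum' : ∀ (F : Finset ℕ) (y : 𝓜(ℂ, B)) (b : B),
      (T.partialSum F y).snd b = ∑ n ∈ F, (star (T.t n)).snd (y.snd ((T.t n).snd b)) := by
    intro F y b
    rw [partialSum_apply]
    induction F using Finset.induction_on with
    | empty => simp
    | insert a s ha ih => rw [Finset.sum_insert ha, Finset.sum_insert ha, ← ih]; rfl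
  have hf1 : ∀ b, Continuous fun x => (f x).fst b :=
    fun b => continuous_iff_continuousAt.2 fun x => (hf x b).1
  have hf2 : ∀ b, Continuous fun x => (f x).snd b :=
    fun b => continuous_iff_continuousAt.2 fun x => (hf x b).2
  have key : ∀ (F : X → B) (P : ℕ → X → B) (q : ℕ → B) (b : B), (∀ N, Continuous (P N)) →
      Tendsto q atTop (𝓝 b) → (∀ N x, ‖F x - P N x‖ ≤ ‖f x‖ * ‖b - q N‖) → Continuous F := by
    intro F P q b hP hq h
    refine TendstoUniformly.continuous (F := P) (p := atTop) ?_
      (Frequently.of_forall hP)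
    rw [Metric.tendstoUniformly_iff]
    intro ε hε
    have h0 : Tendsto (fun N => C * ‖b - q N‖) atTop (𝓝 0) := by
      simpa using ((hq.const_sub b).norm).const_mul C
    filter_upwards [h0.eventually_lt_const hε] with N hN x
    rw [dist_eq_norm]
    refine ((h N x).trans ?_).trans_lt hN
    gcongr
    exact hC x
  intro x b
  constructor
  · refine (key (fun x => (T.infiniteSum (f x)).fst b)
      (fun N x => (T.partialSum (Finset.range N) (f x)).fst b) _ b (fun N => ?_)
      ((T.strictTendsto_partialSum_one) b).1
      (fun N x => T.norm_infiniteSum_fst_sub_le N (f x) b)).tendsto x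
    simp only [hsum]
    exact continuous_finsetSum _ fun n _ => (T.t n).fst.continuous.comp (hf1 _)
  · refine (key (fun x => (T.infiniteSum (f x)).snd b)
      (fun N x => (T.partialSum (Finset.range N) (f x)).snd b) _ b (fun N => ?_)
      ((T.strictTendsto_partialSum_one) b).2
      (fun N x => T.norm_infiniteSum_snd_sub_le N (f x) b)).tendsto x
    simp only [hsum']
    exact continuous_finsetSum _ fun n _ => (star (T.t n)).snd.continuous.comp (hf2 _)

end IsometrySequence

/-! ### Cocycle representations -/

/-- A cocycle representation `(φ, u) : (A, α) → (𝓜(B), β)`. -/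
structure CocycleRep (α : CStarAction G A) (β : CStarAction G B) where
  /-- the ⋆-homomorphism `φ` -/
  hom : A →⋆ₙₐ[ℂ] 𝓜(ℂ, B)
  /-- the unitary cocycle `u` -/
  coc : G → unitary 𝓜(ℂ, B)
  continuous_coc : StrictContinuous fun g => (coc g : 𝓜(ℂ, B))
  coc_mul : ∀ g h, (coc (g * h) : 𝓜(ℂ, B)) = coc g * β.mul g (coc h)
  covariant : ∀ g a, (coc g : 𝓜(ℂ, B)) * β.mul g (hom a) * star (coc g : 𝓜(ℂ, B))
    = hom (α.aut g a)

namespace CocycleRep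

variable {α : CStarAction G A} {β : CStarAction G B}

/-- The Cuntz sum `(φ, u) ⊕ (ψ, v)`, formed pointwise with a pair of invariant isometries. -/
def cuntzSum (r : CuntzIsometries β) (ρ σ : CocycleRep α β) : CocycleRep α β where
  hom :=
    { toFun := fun a => r.sum (ρ.hom a) (σ.hom a)
      map_smul' := fun c a => by simp [CuntzIsometries.sum]
      map_zero' := by simp [CuntzIsometries.sum]
      map_add' := fun a b => by simp [CuntzIsometries.sum, mul_add, add_mul]; abel
      map_mul' := fun a b => by rw [map_mul, map_mul, r.sum_mul]
      map_star' := fun a => by rw [map_star, map_star, r.sum_star] }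
  coc := fun g => ⟨r.sum (ρ.coc g) (σ.coc g), by
    rw [Unitary.mem_iff]
    constructor
    · rw [← r.sum_star, ← r.sum_mul]; simp [r.sum_one]
    · rw [← r.sum_star, ← r.sum_mul]; simp [r.sum_one]⟩
  continuous_coc := fun g b =>
    ⟨((r.r₁.fst.continuous.tendsto _).comp (ρ.continuous_coc g ((star r.r₁).fst b)).1).add
      ((r.r₂.fst.continuous.tendsto _).comp (σ.continuous_coc g ((star r.r₂).fst b)).1),
     (((star r.r₁).snd.continuous.tendsto _).comp (ρ.continuous_coc g (r.r₁.snd b)).2).add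
      (((star r.r₂).snd.continuous.tendsto _).comp (σ.continuous_coc g (r.r₂.snd b)).2)⟩
  coc_mul := fun g h => by
    change r.sum _ _ = r.sum _ _ * β.mul g (r.sum _ _)
    rw [r.map_sum, ← r.sum_mul, ρ.coc_mul, σ.coc_mul]
  covariant := fun g a => by
    change r.sum _ _ * β.mul g (r.sum _ _) * star (r.sum _ _) = r.sum _ _
    rw [r.map_sum, ← r.sum_star, ← r.sum_mul, ← r.sum_mul, ρ.covariant, σ.covariant]

/-- The infinite repeat `(φ^∞, u^∞)`, formed pointwise with a sequence of invariant isometries. -/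
def infiniteRepeat (T : IsometrySequence β) (ρ : CocycleRep α β) : CocycleRep α β where
  hom := (T.infiniteSumHom : 𝓜(ℂ, B) →⋆ₙₐ[ℂ] 𝓜(ℂ, B)).comp ρ.hom
  coc := fun g => ⟨T.infiniteSum (ρ.coc g), by
    rw [Unitary.mem_iff]
    constructor
    · rw [← T.infiniteSum_star, ← T.infiniteSum_mul]; simp [T.infiniteSum_one]
    · rw [← T.infiniteSum_star, ← T.infiniteSum_mul]; simp [T.infiniteSum_one]⟩
  continuous_coc := T.infiniteSum_strictContinuous ρ.continuous_coc (C := 1) fun g =>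
    norm_unitary_le (ρ.coc g)
  coc_mul := fun g h => by
    change T.infiniteSum _ = T.infiniteSum _ * β.mul g (T.infiniteSum _)
    rw [T.map_infiniteSum, ← T.infiniteSum_mul, ρ.coc_mul]
  covariant := fun g a => by
    change T.infiniteSum _ * β.mul g (T.infiniteSum _) * star (T.infiniteSum _)
      = T.infiniteSum (ρ.hom (α.aut g a))
    rw [← ρ.covariant, T.map_infiniteSum, ← T.infiniteSum_star, ← T.infiniteSum_mul, ← T.infiniteSum_mul]
    rfl

/-- The relation `(φ, u) ∼_asymp (ψ, v)`, for `ρ = (φ, u)` and `σ = (ψ, v)`: there is a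
norm-continuous path of unitaries `w : [1, ∞) → 𝒰(𝓜(B))` (extended arbitrarily to `ℝ`)
conjugating `ρ` to `σ` asymptotically, with all differences in `B`. -/
def AsympEquiv (ρ σ : CocycleRep α β) : Prop :=
  ∃ w : ℝ → unitary 𝓜(ℂ, B), ContinuousOn w (Set.Ici 1) ∧
    (∀ a : A, Tendsto (fun t => (w t : 𝓜(ℂ, B)) * ρ.hom a * star (w t : 𝓜(ℂ, B))) atTop
      (𝓝 (σ.hom a))) ∧
    (∀ a : A, ∀ t : ℝ, 1 ≤ t →
      MemBase (σ.hom a - (w t : 𝓜(ℂ, B)) * ρ.hom a * star (w t : 𝓜(ℂ, B)))) ∧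
    (∀ K : Set G, IsCompact K → ∀ ε : ℝ, 0 < ε → ∀ᶠ t in atTop, ∀ g ∈ K,
      ‖(σ.coc g : 𝓜(ℂ, B)) - (w t : 𝓜(ℂ, B)) * (ρ.coc g : 𝓜(ℂ, B)) * star (β.mul g (w t))‖ ≤ ε) ∧
    (∀ t : ℝ, 1 ≤ t → ∀ g : G,
      MemBase ((σ.coc g : 𝓜(ℂ, B)) - (w t : 𝓜(ℂ, B)) * (ρ.coc g : 𝓜(ℂ, B)) * star (β.mul g (w t))))

/-- Weak containment of a cocycle representation `σ = (ψ, v)` in a family of cocycle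
representations. Note that `star b * m.fst c` is the element `b⋆ m c` of `B`. -/
def WeaklyContainedIn (σ : CocycleRep α β) (𝒞 : Set (CocycleRep α β)) : Prop :=
  ∀ (K : Set G) (F : Set A) (ε : ℝ) (b : B), IsCompact K → IsCompact F → 0 < ε → ‖b‖ ≤ 1 →
    ∃ (l N : ℕ) (ρ : Fin l → CocycleRep α β) (c : Fin l → Fin N → B), (∀ j, ρ j ∈ 𝒞) ∧
      (∀ g ∈ K, ‖star b * (σ.coc g : 𝓜(ℂ, B)).fst (β.aut g b)
        - ∑ j, ∑ k, star (c j k) * ((ρ j).coc g : 𝓜(ℂ, B)).fst (β.aut g (c j k))‖ ≤ ε) ∧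
      (∀ a ∈ F, ‖star b * (σ.hom a).fst b
        - ∑ j, ∑ k, star (c j k) * ((ρ j).hom a).fst (c j k)‖ ≤ ε)

/-- Weak containment `(ψ, v) ≼ (φ, u)`, for `σ = (ψ, v)` and `ρ = (φ, u)`. -/
def WeaklyContained (σ ρ : CocycleRep α β) : Prop := WeaklyContainedIn σ {ρ}

end CocycleRep

end Actions

end

/-! Absorption comes from isometries. Suppose S is an isometry in 𝓜(B) with φ^∞(a) S ≈ S ψ^∞(a) and
u^∞_g β_g(S) ≈ S v^∞_g, all errors lying in B. Its range carries a copy of ψ^∞. Since ψ^∞ is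
equivalent to ψ^∞ ⊕ ψ^∞, one half of this copy can be moved out while the other half refills the
range of S, as in Hilbert's hotel. `absorbingUnitary` is the resulting unitary, and
`absorbingUnitary_intertwine` writes its defect as a combination of the defects of S. A
norm-continuous path of such isometries with vanishing defect therefore gives the asymptotic
equivalence (`IsIntertwiningPath.asympEquiv`).

To build S, let p run through the values ψ(a), v_g, and q through φ(a), u_g. Quasi-central
approximate units give b_n in B with ∑ b_n² = 1 strictly and with summably small twisted commutators
with p (`exists_quasiCentral_partition`). Weak containment approximates each b_n p β_g(b_n) by a
finite sum ∑ c⋆ q β_g(c). Placing the elements c in disjoint blocks of the isometries t_n gives a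
multiplier X for which X⋆ q^∞ β_g(X) - p is a norm convergent series in B with small sum
(`exists_compression`). At the group unit this says that X⋆X - 1 is small and in B, so X can be
corrected to an isometry S by polar decomposition (`exists_isometric_compression`). Finally (xS -
Sy)⋆(xS - Sy) is expressed through compressions only, and an ideal contains d as soon as it contains
d⋆d, so approximate compression is already approximate intertwining
(`FinitelyContained.exists_isIntertwiner`).

All this applies to ψ^∞ in place of ψ, because φ also contains ψ^∞
(`FinitelyContained.infiniteRepeat`). A sequence of isometries becomes a path after its members are
moved alternately into two orthogonal ranges that commute with φ^∞: neighbours are then orthogonal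
and can be interpolated.

Conversely, compressing ψ^∞ ⊕ φ^∞ by the invariant isometry r₁ t₀ recovers ψ. Pulled back along w_t
this exhibits ψ as a near-compression of φ^∞, and truncating the infinite repeat leaves finite sums
of compressions of φ (`AsympEquiv.weaklyContained`). The invariant isometries come from isometries
on ℓ²(ℕ) acting as 1 ⊗ s on B ⊗ 𝒦. -/

noncomputable section

/-! ### The base algebra as an ideal of its multiplier algebra -/

section Base

variable {B : Type*} [NonUnitalCStarAlgebra B]

/-- The canonical embedding of a C⋆-algebra into its multiplier algebra. -/
def emb : B →⋆ₙₐ[ℂ] 𝓜(ℂ, B) := DoubleCentralizer.coeHom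

theorem emb_fst (b c : B) : (emb b).fst c = b * c := rfl

theorem emb_snd (b c : B) : (emb b).snd c = c * b := rfl

theorem norm_emb (b : B) : ‖(emb b : 𝓜(ℂ, B))‖ = ‖b‖ := by
  rw [← DoubleCentralizer.norm_fst]
  exact ContinuousLinearMap.opNorm_mul_apply ℂ B b

theorem emb_injective : Function.Injective (emb : B → 𝓜(ℂ, B)) := by
  intro a b h
  rw [← sub_eq_zero, ← norm_eq_zero, ← norm_emb, map_sub, h, sub_self, norm_zero]

theorem isometry_emb : Isometry (emb : B → 𝓜(ℂ, B)) :=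
  AddMonoidHomClass.isometry_of_norm emb norm_emb

theorem mul_emb (m : 𝓜(ℂ, B)) (b : B) : m * emb b = emb (m.fst b) := by
  refine multiplier_ext (fun c => ?_) (fun c => ?_)
  · change m.fst (b * c) = m.fst b * c
    have h := m.central
    -- Centrality shows that the difference d satisfies x * d = 0 for every x in B; take x = d⋆.
    refine sub_eq_zero.1 ((CStarRing.star_mul_self_eq_zero_iff _).1 ?_)
    rw [mul_sub, ← m.central, ← mul_assoc _ (m.fst b), ← m.central, mul_assoc, sub_self]
  · change m.snd c * b = c * m.fst b
    exact m.central c b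

theorem emb_mul (m : 𝓜(ℂ, B)) (b : B) : emb b * m = emb (m.snd b) := by
  have h := congrArg star (mul_emb (star m) (star b))
  simpa [map_star] using h

theorem memBase_iff {m : 𝓜(ℂ, B)} : MemBase m ↔ ∃ b : B, emb b = m := Iff.rfl

theorem memBase_emb (b : B) : MemBase (emb b) := ⟨b, rfl⟩

theorem memBase_zero : MemBase (0 : 𝓜(ℂ, B)) := ⟨0, map_zero emb⟩

theorem MemBase.add {m n : 𝓜(ℂ, B)} (hm : MemBase m) (hn : MemBase n) : MemBase (m + n) := by
  obtain ⟨a, rfl⟩ := hm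
  obtain ⟨b, rfl⟩ := hn
  exact ⟨a + b, map_add emb a b⟩

theorem MemBase.neg {m : 𝓜(ℂ, B)} (hm : MemBase m) : MemBase (-m) := by
  obtain ⟨a, rfl⟩ := hm
  exact ⟨-a, map_neg emb a⟩

theorem MemBase.sub {m n : 𝓜(ℂ, B)} (hm : MemBase m) (hn : MemBase n) : MemBase (m - n) := by
  rw [sub_eq_add_neg]
  exact hm.add hn.neg

theorem MemBase.smul {m : 𝓜(ℂ, B)} (c : ℂ) (hm : MemBase m) : MemBase (c • m) := by
  obtain ⟨a, rfl⟩ := hm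
  exact ⟨c • a, map_smul emb c a⟩

theorem MemBase.star {m : 𝓜(ℂ, B)} (hm : MemBase m) : MemBase (star m) := by
  obtain ⟨a, rfl⟩ := hm
  exact ⟨Star.star a, map_star emb a⟩

theorem MemBase.mul_left {m : 𝓜(ℂ, B)} (n : 𝓜(ℂ, B)) (hm : MemBase m) : MemBase (n * m) := by
  obtain ⟨a, rfl⟩ := hm
  exact ⟨n.fst a, (mul_emb n a).symm⟩

theorem MemBase.mul_right {m : 𝓜(ℂ, B)} (n : 𝓜(ℂ, B)) (hm : MemBase m) : MemBase (m * n) := by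
  obtain ⟨a, rfl⟩ := hm
  exact ⟨n.snd a, (emb_mul n a).symm⟩

theorem memBase_sum {ι : Type*} (s : Finset ι) {f : ι → 𝓜(ℂ, B)} (h : ∀ i ∈ s, MemBase (f i)) :
    MemBase (∑ i ∈ s, f i) := by
  classical
  induction s using Finset.induction_on with
  | empty => simpa using memBase_zero
  | insert a s ha ih =>
    rw [Finset.sum_insert ha]
    exact (h a (Finset.mem_insert_self a s)).add
      (ih fun i hi => h i (Finset.mem_insert_of_mem hi))

theorem isClosed_memBase : IsClosed {m : 𝓜(ℂ, B) | MemBase m} :=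
  (isometry_emb (B := B)).isClosedEmbedding.isClosed_range

theorem MemBase.of_tendsto {ι : Type*} {l : Filter ι} [l.NeBot] {f : ι → 𝓜(ℂ, B)} {m : 𝓜(ℂ, B)}
    (h : Tendsto f l (𝓝 m)) (hf : ∀ᶠ i in l, MemBase (f i)) : MemBase m :=
  isClosed_memBase.mem_of_tendsto h hf

/-- If `d⋆ d` lies in the ideal `B` of `𝓜(B)`, so does `d`. -/
theorem memBase_of_star_mul_self {d : 𝓜(ℂ, B)} (h : MemBase (star d * d)) : MemBase d := by
  let _ : PartialOrder B := CStarAlgebra.spectralOrder B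
  have _ : StarOrderedRing B := CStarAlgebra.spectralOrderedRing B
  obtain ⟨c, hc⟩ := memBase_iff.1 h
  have happ := CStarAlgebra.increasingApproximateUnit B
  have hlim : Tendsto (fun e : B => d * emb e) (CStarAlgebra.approximateUnit B) (𝓝 d) := by
    rw [tendsto_iff_norm_sub_tendsto_zero]
    have h1 : Tendsto (fun e : B => √(2 * ‖c * e - c‖)) (CStarAlgebra.approximateUnit B) (𝓝 0) := by
      have h2 := ((happ.tendsto_mul_left c).sub_const c).norm.const_mul 2
      have h3 := (Real.continuous_sqrt.tendsto _).comp h2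
      rwa [sub_self, norm_zero, mul_zero, Real.sqrt_zero] at h3
    refine squeeze_zero' (Eventually.of_forall fun _ => norm_nonneg _) ?_ h1
    filter_upwards [happ.eventually_norm, happ.eventually_star_eq] with e he hes
    refine Real.le_sqrt_of_sq_le ?_
    -- With c = d⋆d in B this is (e - 1) c (e - 1), which tends to 0. Hence d is a norm limit of the
    -- elements d e of B.
    have h4 : star (d * emb e - d) * (d * emb e - d) = emb (e * (c * e - c) - (c * e - c)) := by
      rw [map_sub, map_mul, map_sub, map_mul, hc]
      simp only [star_sub, star_mul, ← map_star, hes]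
      noncomm_ring
    rw [sq, ← CStarRing.norm_star_mul_self, h4, norm_emb]
    calc ‖e * (c * e - c) - (c * e - c)‖ ≤ ‖e * (c * e - c)‖ + ‖c * e - c‖ := norm_sub_le _ _
      _ ≤ ‖e‖ * ‖c * e - c‖ + ‖c * e - c‖ := by gcongr; exact norm_mul_le _ _
      _ ≤ 1 * ‖c * e - c‖ + ‖c * e - c‖ := by gcongr
      _ = 2 * ‖c * e - c‖ := by ring
  exact MemBase.of_tendsto hlim (Eventually.of_forall fun e => (memBase_emb e).mul_left d)

/-! ### The strict topology -/

theorem strictTendsto_iff {ι : Type*} {f : ι → 𝓜(ℂ, B)} {l : Filter ι} {m : 𝓜(ℂ, B)} :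
    StrictTendsto f l m ↔ ∀ b : B, Tendsto (fun i => f i * emb b) l (𝓝 (m * emb b)) ∧
      Tendsto (fun i => emb b * f i) l (𝓝 (emb b * m)) := by
  simp only [mul_emb, emb_mul]
  refine forall_congr' fun b => and_congr ?_ ?_
  · exact (isometry_emb (B := B)).isEmbedding.tendsto_nhds_iff
  · exact (isometry_emb (B := B)).isEmbedding.tendsto_nhds_iff

namespace StrictTendsto

variable {ι : Type*} {f g : ι → 𝓜(ℂ, B)} {l : Filter ι} {m n : 𝓜(ℂ, B)}

theorem of_tendsto (h : Tendsto f l (𝓝 m)) : StrictTendsto f l m :=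
  strictTendsto_iff.2 fun _ => ⟨h.mul_const _, h.const_mul _⟩

theorem congr (hf : StrictTendsto f l m) (h : ∀ i, f i = g i) : StrictTendsto g l m := by
  rwa [← funext h]

theorem sub (hf : StrictTendsto f l m) (hg : StrictTendsto g l n) :
    StrictTendsto (fun i => f i - g i) l (m - n) :=
  fun b => ⟨(hf b).1.sub (hg b).1, (hf b).2.sub (hg b).2⟩

theorem star (hf : StrictTendsto f l m) : StrictTendsto (fun i => star (f i)) l (star m) :=
  fun b => ⟨(hf (Star.star b)).2.star, (hf (Star.star b)).1.star⟩

/-- The error is f i (g i b - n b) + (f i - m) (n b): the first term uses the uniform bound, the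
second that n b lies in B. This allows strict limits of bounded partial sums to be multiplied. -/
theorem mul (hf : StrictTendsto f l m) (hg : StrictTendsto g l n) {C : ℝ}
    (hfC : ∀ i, ‖f i‖ ≤ C) (hgC : ∀ i, ‖g i‖ ≤ C) :
    StrictTendsto (fun i => f i * g i) l (m * n) := by
  rw [strictTendsto_iff] at hf hg ⊢
  intro b
  constructor
  · have h1 : Tendsto (fun i => f i * (g i * emb b - n * emb b)) l (𝓝 0) := by
      refine squeeze_zero_norm (a := fun i => C * ‖g i * emb b - n * emb b‖) (fun i => ?_) ?_
      · exact (norm_mul_le _ _).trans (by gcongr; exact hfC i)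
      · simpa using! (((hg b).1.sub_const (n * emb b)).norm).const_mul C
    have h2 := h1.add (hf (n.fst b)).1
    refine (h2.congr fun i => ?_).trans_eq ?_
    · rw [← mul_emb]; noncomm_ring
    · rw [← mul_emb, zero_add, mul_assoc]
  · have h1 : Tendsto (fun i => (emb b * f i - emb b * m) * g i) l (𝓝 0) := by
      refine squeeze_zero_norm (a := fun i => ‖emb b * f i - emb b * m‖ * C) (fun i => ?_) ?_
      · exact (norm_mul_le _ _).trans (by gcongr; exact hgC i)
      · simpa using! (((hf b).2.sub_const (emb b * m)).norm).mul_const C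
    have h2 := h1.add (hg (m.snd b)).2
    refine (h2.congr fun i => ?_).trans_eq ?_
    · rw [← emb_mul]; noncomm_ring
    · rw [← emb_mul, zero_add, mul_assoc]

theorem const_mul (c : 𝓜(ℂ, B)) (hf : StrictTendsto f l m) :
    StrictTendsto (fun i => c * f i) l (c * m) :=
  fun b => ⟨(c.fst.continuous.tendsto _).comp (hf b).1, (hf (c.snd b)).2⟩

theorem mul_const (c : 𝓜(ℂ, B)) (hf : StrictTendsto f l m) :
    StrictTendsto (fun i => f i * c) l (m * c) :=
  fun b => ⟨(hf (c.fst b)).1, (c.snd.continuous.tendsto _).comp (hf b).2⟩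

theorem multiplierExt (θ : B ≃⋆ₐ[ℂ] B) (hf : StrictTendsto f l m) :
    StrictTendsto (fun i => multiplierExt θ (f i)) l (multiplierExt θ m) :=
  fun b => ⟨((StarAlgEquiv.isometry θ).continuous.tendsto _).comp (hf (θ.symm b)).1,
    ((StarAlgEquiv.isometry θ).continuous.tendsto _).comp (hf (θ.symm b)).2⟩

end StrictTendsto

/-! ### Extended automorphisms -/

theorem multiplierExt_emb (θ : B ≃⋆ₐ[ℂ] B) (b : B) : multiplierExt θ (emb b) = emb (θ b) := by
  refine multiplier_ext (fun c => ?_) (fun c => ?_)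
  · rw [multiplierExt_fst, emb_fst, emb_fst, map_mul, StarAlgEquiv.apply_symm_apply]
  · rw [multiplierExt_snd, emb_snd, emb_snd, map_mul, StarAlgEquiv.apply_symm_apply]

theorem norm_multiplierExt_le (θ : B ≃⋆ₐ[ℂ] B) (m : 𝓜(ℂ, B)) : ‖multiplierExt θ m‖ ≤ ‖m‖ :=
  NonUnitalStarAlgHom.norm_apply_le (multiplierExt θ : 𝓜(ℂ, B) →⋆ₙₐ[ℂ] 𝓜(ℂ, B)) m

theorem MemBase.multiplierExt {m : 𝓜(ℂ, B)} (hm : MemBase m) (θ : B ≃⋆ₐ[ℂ] B) :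
    MemBase (multiplierExt θ m) := by
  obtain ⟨b, rfl⟩ := hm
  exact ⟨θ b, (multiplierExt_emb θ b).symm⟩

end Base

end

noncomputable section

/-! ### Quasi-central approximate units -/

/-- A sum of almost orthogonal elements of a C⋆-algebra has small norm. -/
theorem norm_sum_sq_le_of_almost_orthogonal {M : Type*} [NonUnitalCStarAlgebra M] {d : ℕ → M}
    {R δ : ℝ} (hδ : 0 ≤ δ) (hd : ∀ k, ‖d k‖ ≤ R) (h : ∀ k l, k < l → ‖star (d k) * d l‖ ≤ δ)
    (N : ℕ) : ‖∑ k ∈ Finset.range N, d k‖ ^ 2 ≤ N * R ^ 2 + N ^ 2 * δ := by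
  have hkl : ∀ k l, ‖star (d k) * d l‖ ≤ (if k = l then R ^ 2 else 0) + δ := by
    intro k l
    rcases lt_trichotomy k l with hlt | rfl | hlt
    · rw [if_neg hlt.ne, zero_add]
      exact h k l hlt
    · rw [if_pos rfl, CStarRing.norm_star_mul_self, ← sq]
      have := pow_le_pow_left₀ (norm_nonneg _) (hd k) 2
      linarith
    · rw [if_neg hlt.ne', zero_add, ← norm_star, star_mul, star_star]
      exact h l k hlt
  rw [sq, ← CStarRing.norm_star_mul_self, star_sum, Finset.sum_mul_sum]
  calc ‖∑ k ∈ Finset.range N, ∑ l ∈ Finset.range N, star (d k) * d l‖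
      ≤ ∑ k ∈ Finset.range N, ∑ l ∈ Finset.range N, ‖star (d k) * d l‖ :=
        (norm_sum_le _ _).trans (Finset.sum_le_sum fun k _ => norm_sum_le _ _)
    _ ≤ ∑ k ∈ Finset.range N, ∑ l ∈ Finset.range N, ((if k = l then R ^ 2 else 0) + δ) :=
        Finset.sum_le_sum fun k _ => Finset.sum_le_sum fun l _ => hkl k l
    _ = N * R ^ 2 + N ^ 2 * δ := by
        simp only [Finset.sum_add_distrib, Finset.sum_ite_eq, Finset.sum_const, Finset.card_range,
          nsmul_eq_mul]
        rw [Finset.sum_ite_of_true (fun i hi => hi)]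
        simp only [Finset.sum_const, Finset.card_range, nsmul_eq_mul]
        ring

section QuasiCentral

variable {B : Type*} [NonUnitalCStarAlgebra B]

/-- The commutator of `p` and `e`, twisted by an automorphism. -/
def twistedComm (θ : B ≃⋆ₐ[ℂ] B) (p e : 𝓜(ℂ, B)) : 𝓜(ℂ, B) := p * multiplierExt θ e - e * p

theorem norm_twistedComm_le (θ : B ≃⋆ₐ[ℂ] B) {p e : 𝓜(ℂ, B)} {C : ℝ} (hp : ‖p‖ ≤ C)
    (he : ‖e‖ ≤ 1) : ‖twistedComm θ p e‖ ≤ 2 * C := by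
  have hC : 0 ≤ C := (norm_nonneg p).trans hp
  calc ‖twistedComm θ p e‖ ≤ ‖p * multiplierExt θ e‖ + ‖e * p‖ := norm_sub_le _ _
    _ ≤ ‖p‖ * ‖multiplierExt θ e‖ + ‖e‖ * ‖p‖ := add_le_add (norm_mul_le _ _) (norm_mul_le _ _)
    _ ≤ C * 1 + 1 * C := by
        gcongr
        exact (norm_multiplierExt_le θ e).trans he
    _ = 2 * C := by ring

theorem twistedComm_sub (θ : B ≃⋆ₐ[ℂ] B) (p e f : 𝓜(ℂ, B)) :
    twistedComm θ p (e - f) = twistedComm θ p e - twistedComm θ p f := by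
  simp only [twistedComm, map_sub]
  noncomm_ring

theorem twistedComm_smul (θ : B ≃⋆ₐ[ℂ] B) (p e : 𝓜(ℂ, B)) (c : ℂ) :
    twistedComm θ p (c • e) = c • twistedComm θ p e := by
  simp only [twistedComm, map_smul, mul_smul_comm, smul_mul_assoc, smul_sub]

theorem twistedComm_sum (θ : B ≃⋆ₐ[ℂ] B) (p : 𝓜(ℂ, B)) {ι : Type*} (s : Finset ι)
    (e : ι → 𝓜(ℂ, B)) :
    twistedComm θ p (∑ k ∈ s, e k) = ∑ k ∈ s, twistedComm θ p (e k) := by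
  simp only [twistedComm, map_sum, Finset.mul_sum, Finset.sum_mul, Finset.sum_sub_distrib]

theorem twistedComm_zero (θ : B ≃⋆ₐ[ℂ] B) (p : 𝓜(ℂ, B)) : twistedComm θ p 0 = 0 := by
  simp [twistedComm]

/-- Twisted commutators with two elements, the second of which is almost a unit for the first,
are almost orthogonal. -/
theorem norm_star_twistedComm_mul_le (θ : B ≃⋆ₐ[ℂ] B) {p : 𝓜(ℂ, B)} {C δ : ℝ} (hp : ‖p‖ ≤ C)
    {e f : B} (he : star e = e)
    (h₀ : ‖e * f - e‖ ≤ δ)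
    (h₁ : ‖(star p).snd (θ e) * f - (star p).snd (θ e)‖ ≤ δ)
    (h₂ : ‖θ.symm (p.snd ((star p).snd (θ e))) * f - θ.symm (p.snd ((star p).snd (θ e)))‖ ≤ δ)
    (h₃ : ‖θ.symm (p.snd ((star p).fst e)) * f - θ.symm (p.snd ((star p).fst e))‖ ≤ δ) :
    ‖star (twistedComm θ p (emb e)) * twistedComm θ p (emb f)‖ ≤ (1 + C) ^ 2 * δ + δ := by
  have hC : 0 ≤ C := (norm_nonneg p).trans hp
  have hδ : 0 ≤ δ := (norm_nonneg _).trans h₀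
  set y₁ := (star p).snd (θ e) with hy₁
  set y₂ := θ.symm (p.snd y₁) with hy₂
  set y₃ := θ.symm (p.snd ((star p).fst e)) with hy₃
  have e₁ : emb (θ e) * star p = emb y₁ := emb_mul _ _
  have e₂ : emb y₁ * p = emb (θ y₂) := by rw [emb_mul, hy₂, StarAlgEquiv.apply_symm_apply]
  have e₃ : star p * emb e * p = emb (θ y₃) := by
    rw [mul_emb, emb_mul, hy₃, StarAlgEquiv.apply_symm_apply]
  -- Replacing f by 1 in the four terms of the product makes them cancel. Each term contains f to
  -- the right of e, y₁, θ(y₂) or θ(y₃) up to the automorphism, so it suffices that f is almost a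
  -- right unit for e and these yᵢ.
  have key : star (twistedComm θ p (emb e)) * twistedComm θ p (emb f)
      = emb (θ (y₂ * f - y₂)) - emb (y₁ * f - y₁) * p - emb (θ (y₃ * f - y₃))
        + star p * emb (e * f - e) * p := by
    simp only [twistedComm, multiplierExt_emb, star_sub, star_mul, ← map_star, he]
    calc _ = emb (θ e) * star p * p * emb (θ f) - emb (θ e) * star p * emb f * p
          - star p * emb e * p * emb (θ f) + star p * (emb e * emb f) * p := by noncomm_ring
      _ = emb y₁ * p * emb (θ f) - emb y₁ * emb f * p
          - emb (θ y₃) * emb (θ f) + star p * (emb e * emb f) * p := by rw [e₁, e₃]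
      _ = emb (θ y₂) * emb (θ f) - emb y₁ * emb f * p
          - emb (θ y₃) * emb (θ f) + star p * (emb e * emb f) * p := by rw [e₂]
      _ = (emb (θ y₂) * emb (θ f) - emb (θ y₂)) - (emb y₁ * emb f - emb y₁) * p
          - (emb (θ y₃) * emb (θ f) - emb (θ y₃)) + star p * (emb e * emb f - emb e) * p := by
            rw [← e₂, ← e₃]; noncomm_ring
      _ = _ := by simp only [map_sub, map_mul]
  have hθ : ∀ b : B, ‖θ b‖ = ‖b‖ := fun b => by
    simpa using (StarAlgEquiv.isometry θ).norm_map_of_map_zero (map_zero θ) b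
  rw [key]
  calc _ ≤ ‖emb (θ (y₂ * f - y₂))‖ + ‖emb (y₁ * f - y₁) * p‖ + ‖emb (θ (y₃ * f - y₃))‖
        + ‖star p * emb (e * f - e) * p‖ :=
        (norm_add_le _ _).trans (add_le_add_left ((norm_sub_le _ _).trans
          (add_le_add_left (norm_sub_le _ _) _)) _)
    _ ≤ δ + δ * C + δ + C * δ * C := by
        have n₁ : ‖emb (y₁ * f - y₁) * p‖ ≤ δ * C :=
          (norm_mul_le _ _).trans (by rw [norm_emb]; gcongr)
        have n₂ : ‖star p * emb (e * f - e) * p‖ ≤ C * δ * C := by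
          refine (norm_mul_le _ _).trans ?_
          gcongr
          refine (norm_mul_le _ _).trans ?_
          rw [norm_emb, norm_star]
          gcongr
        rw [norm_emb, norm_emb, hθ, hθ]
        gcongr
    _ ≤ (1 + C) ^ 2 * δ + δ := by nlinarith [mul_nonneg hC hδ]

/-- The compactness conditions on a family `(θ i, p i)`, `i ∈ J`, under which there are
approximate units quasi-central for the family. -/
structure QuasiCompact {I : Type*} (θ : I → (B ≃⋆ₐ[ℂ] B)) (p : I → 𝓜(ℂ, B)) (J : Set I) :
    Prop where
  bdd : ∃ C : ℝ, ∀ i ∈ J, ‖p i‖ ≤ C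
  tb₁ : ∀ e : B, TotallyBounded ((fun i => (star (p i)).snd (θ i e)) '' J)
  tb₂ : ∀ e : B, TotallyBounded
    ((fun i => (θ i).symm ((p i).snd ((star (p i)).snd (θ i e)))) '' J)
  tb₃ : ∀ e : B, TotallyBounded ((fun i => (θ i).symm ((p i).snd ((star (p i)).fst e))) '' J)

variable [PartialOrder B] [StarOrderedRing B]

/-- A finite ε/3-net of W reduces uniformity to finitely many elements. The conclusion covers every
contraction above z, so that later terms of an increasing sequence, and averages of them, inherit
the estimate. -/
theorem exists_forall_norm_mul_sub_le {W : Set B} (hW : TotallyBounded W) {ε : ℝ} (hε : 0 < ε) :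
    ∃ z : B, (0 ≤ z ∧ ‖z‖ < 1) ∧ ∀ e, z ≤ e → ‖e‖ ≤ 1 → ∀ y ∈ W, ‖y * e - y‖ ≤ ε := by
  obtain ⟨t, htf, ht⟩ := Metric.totallyBounded_iff.1 hW (ε / 3) (by positivity)
  have hev : ∀ᶠ e in CStarAlgebra.approximateUnit B, ∀ y ∈ t, ‖y * e - y‖ < ε / 3 := by
    refine (htf.eventually_all).2 fun y _ => ?_
    have h := ((CStarAlgebra.increasingApproximateUnit B).tendsto_mul_left y)
    rw [tendsto_iff_norm_sub_tendsto_zero] at h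
    exact h.eventually_lt_const (by positivity)
  obtain ⟨z, hz, hz'⟩ := (CStarAlgebra.hasBasis_approximateUnit B).eventually_iff.1 hev
  refine ⟨z, hz, fun e hze he y hy => ?_⟩
  obtain ⟨y', hy't, hyy'⟩ := Set.mem_iUnion₂.1 (ht hy)
  rw [Metric.mem_ball, dist_eq_norm] at hyy'
  have h1 := hz' ⟨hze, mem_closedBall_zero_iff.2 he⟩ y' hy't
  have h2 : y * e - y = (y - y') * e + (y' * e - y') - (y - y') := by noncomm_ring
  rw [h2]
  calc _ ≤ ‖(y - y') * e‖ + ‖y' * e - y'‖ + ‖y - y'‖ :=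
        (norm_sub_le _ _).trans (add_le_add_left (norm_add_le _ _) _)
    _ ≤ ‖y - y'‖ * 1 + ‖y' * e - y'‖ + ‖y - y'‖ := by
        gcongr
        exact (norm_mul_le _ _).trans (by gcongr)
    _ ≤ ε := by linarith

theorem exists_nonneg_ball_ge (x y : B) (hx : 0 ≤ x ∧ ‖x‖ < 1) (hy : 0 ≤ y ∧ ‖y‖ < 1) :
    ∃ z : B, (0 ≤ z ∧ ‖z‖ < 1) ∧ x ≤ z ∧ y ≤ z := by
  obtain ⟨z, hz, hz'⟩ := CStarAlgebra.directedOn_nonneg_ball (A := B) x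
    ⟨hx.1, by simpa using hx.2⟩ y ⟨hy.1, by simpa using hy.2⟩
  exact ⟨z, ⟨hz.1, by simpa using hz.2⟩, hz'⟩

/-- Existence of quasi-central elements in the canonical approximate unit: averages of rapidly
increasing sequences have small twisted commutators with a compact family of multipliers. -/
theorem exists_quasiCentral {I : Type*} {θ : I → (B ≃⋆ₐ[ℂ] B)} {p : I → 𝓜(ℂ, B)} {J : Set I}
    (hJ : QuasiCompact θ p J) {x : B} (hx : 0 ≤ x ∧ ‖x‖ < 1) {W : Set B}
    (hW : TotallyBounded W) {ε : ℝ} (hε : 0 < ε) :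
    ∃ e : B, (0 ≤ e ∧ ‖e‖ < 1) ∧ x ≤ e ∧ (∀ y ∈ W, ‖y * e - y‖ ≤ ε) ∧
      ∀ i ∈ J, ‖twistedComm (θ i) (p i) (emb e)‖ ≤ ε := by
  obtain ⟨C', hC'⟩ := hJ.bdd
  set C := max C' 0 with hCdef
  have hC0 : 0 ≤ C := le_max_right _ _
  have hC : ∀ i ∈ J, ‖p i‖ ≤ C := fun i hi => (hC' i hi).trans (le_max_left _ _)
  set δ : ℝ := ε ^ 2 / 2 / ((1 + C) ^ 2 + 1) with hδdef
  have hδ : 0 < δ := by positivity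
  have hδ' : (1 + C) ^ 2 * δ + δ = ε ^ 2 / 2 := by
    rw [hδdef]; field_simp
  -- The three totally bounded families in `QuasiCompact` are those needed to make twisted
  -- commutators with e and with any f above z almost orthogonal, uniformly over J.
  have hz : ∀ e : B, ∃ z : B, (0 ≤ z ∧ ‖z‖ < 1) ∧ ∀ f, z ≤ f → ‖f‖ ≤ 1 →
      ‖e * f - e‖ ≤ δ ∧ ∀ i ∈ J,
      ‖(star (p i)).snd (θ i e) * f - (star (p i)).snd (θ i e)‖ ≤ δ ∧
      ‖(θ i).symm ((p i).snd ((star (p i)).snd (θ i e))) * f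
        - (θ i).symm ((p i).snd ((star (p i)).snd (θ i e)))‖ ≤ δ ∧
      ‖(θ i).symm ((p i).snd ((star (p i)).fst e)) * f
        - (θ i).symm ((p i).snd ((star (p i)).fst e))‖ ≤ δ := by
    intro e
    obtain ⟨z, hz, hz'⟩ := exists_forall_norm_mul_sub_le
      ((((Set.finite_singleton e).totallyBounded.union (hJ.tb₁ e)).union (hJ.tb₂ e)).union
        (hJ.tb₃ e)) hδ
    refine ⟨z, hz, fun f hzf hf => ⟨hz' f hzf hf e (by simp), fun i hi => ⟨?_, ?_, ?_⟩⟩⟩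
    · exact hz' f hzf hf _ (Or.inl (Or.inl (Or.inr ⟨i, hi, rfl⟩)))
    · exact hz' f hzf hf _ (Or.inl (Or.inr ⟨i, hi, rfl⟩))
    · exact hz' f hzf hf _ (Or.inr ⟨i, hi, rfl⟩)
  choose z hz0 hz using hz
  obtain ⟨w, hw, hwW⟩ := exists_forall_norm_mul_sub_le hW hε
  -- Starting above x and w puts the final average above both.
  obtain ⟨x₀, hx₀, hxx₀, hwx₀⟩ := exists_nonneg_ball_ge x w hx hw
  let Λ : Type _ := {y : B // 0 ≤ y ∧ ‖y‖ < 1}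
  have hstep : ∀ y : Λ, ∃ y' : Λ, y.1 ≤ y'.1 ∧ z y.1 ≤ y'.1 := by
    intro y
    obtain ⟨y', h1, h2, h3⟩ := exists_nonneg_ball_ge y.1 (z y.1) y.2 (hz0 y.1)
    exact ⟨⟨y', h1⟩, h2, h3⟩
  choose next hnext hnextz using hstep
  let s : ℕ → Λ := fun n => Nat.rec ⟨x₀, hx₀⟩ (fun _ y => next y) n
  have hs : ∀ n, s (n + 1) = next (s n) := fun _ => rfl
  have hmono : Monotone fun n => (s n).1 :=
    monotone_nat_of_le_succ fun n => by rw [hs]; exact hnext _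
  have hsz : ∀ k l, k < l → z (s k).1 ≤ (s l).1 := fun k l hkl =>
    (hnextz (s k)).trans (hmono (Nat.succ_le_of_lt hkl))
  -- The square of the norm of a sum of n commutators is at most n (2C)² + n² ε²/2. This is below
  -- (nε)² once n ≥ (2C)² / (ε²/2), and then the average is at most ε.
  obtain ⟨N, hN⟩ := exists_nat_gt ((2 * C) ^ 2 / (ε ^ 2 / 2))
  rw [div_lt_iff₀ (by positivity)] at hN
  set n : ℕ := N + 1 with hn
  have hn0 : (0 : ℝ) < n := by positivity
  have hn1 : (2 * C) ^ 2 ≤ n * (ε ^ 2 / 2) := by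
    rw [hn]; push_cast; nlinarith [sq_nonneg ε]
  set tot : B := ∑ k ∈ Finset.range n, (s k).1 with htot
  have hsum_le : ∀ v : B, (∀ k, v ≤ (s k).1) → (n : ℝ) • v ≤ tot := by
    intro v hv
    rw [htot, Nat.cast_smul_eq_nsmul]
    simpa using Finset.card_nsmul_le_sum (Finset.range n) (fun k => (s k).1) v (fun k _ => hv k)
  have hs0 : ∀ k, x₀ ≤ (s k).1 := fun k => hmono (Nat.zero_le k)
  set e : B := (n : ℝ)⁻¹ • tot with he
  have hle : ∀ v : B, (∀ k, v ≤ (s k).1) → v ≤ e := by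
    intro v hv
    have h := smul_le_smul_of_nonneg_left (hsum_le v hv) (inv_nonneg.2 hn0.le)
    rwa [smul_smul, inv_mul_cancel₀ hn0.ne', one_smul] at h
  have he1 : ‖e‖ < 1 := by
    rw [he, norm_smul, norm_inv, Real.norm_of_nonneg hn0.le, inv_mul_lt_iff₀ hn0, mul_one]
    refine (norm_sum_le _ _).trans_lt ?_
    calc _ < ∑ k ∈ Finset.range n, (1 : ℝ) :=
          Finset.sum_lt_sum_of_nonempty ⟨0, by simp [hn]⟩ fun k _ => (s k).2.2
      _ = n := by simp
  have hx₀e : x₀ ≤ e := hle x₀ hs0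
  refine ⟨e, ⟨hx₀.1.trans hx₀e, he1⟩, hxx₀.trans hx₀e,
    fun y hy => hwW e (hwx₀.trans hx₀e) he1.le y hy, fun i hi => ?_⟩
  have hD : twistedComm (θ i) (p i) (emb e)
      = ((n : ℂ)⁻¹) • ∑ k ∈ Finset.range n, twistedComm (θ i) (p i) (emb (s k).1) := by
    rw [← twistedComm_sum, ← twistedComm_smul, ← map_sum, ← map_smul, he, htot]
    congr 2
    rw [← Complex.coe_smul]
    push_cast
    rfl
  have hsq := norm_sum_sq_le_of_almost_orthogonal (d := fun k => twistedComm (θ i) (p i)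
    (emb (s k).1)) (R := 2 * C) (δ := (1 + C) ^ 2 * δ + δ) (by positivity)
    (fun k => norm_twistedComm_le _ (hC i hi) (by rw [norm_emb]; exact (s k).2.2.le))
    (fun k l hkl => by
      have h := hz (s k).1 (s l).1 (hsz k l hkl) (s l).2.2.le
      exact norm_star_twistedComm_mul_le (θ i) (hC i hi)
        (IsSelfAdjoint.of_nonneg (s k).2.1).star_eq h.1 (h.2 i hi).1 (h.2 i hi).2.1
        (h.2 i hi).2.2) n
  rw [hδ'] at hsq
  rw [hD, norm_smul, norm_inv, Complex.norm_natCast, inv_mul_le_iff₀ hn0]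
  refine le_of_sq_le_sq ?_ (by positivity)
  calc _ ≤ _ := hsq
    _ ≤ n * (n * (ε ^ 2 / 2)) + n ^ 2 * (ε ^ 2 / 2) := by gcongr
    _ = (n * ε) ^ 2 := by ring

end QuasiCentral

end

noncomputable section

/-! ### Twisted commutators of square roots -/

section SquareRoot

variable {B : Type*} [NonUnitalCStarAlgebra B]

/-- The twisted commutator obeys the Leibniz rule D(d^(k+1)) = D(d^k) θ(d) + d^k D(d), and d is a
contraction. -/
theorem norm_twistedComm_pow_le (θ : B ≃⋆ₐ[ℂ] B) (p : 𝓜(ℂ, B)) {d : 𝓜(ℂ, B)} (hd : ‖d‖ ≤ 1)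
    (k : ℕ) : ‖twistedComm θ p (d ^ k)‖ ≤ k * ‖twistedComm θ p d‖ := by
  have hpow : ∀ (k : ℕ) (x : 𝓜(ℂ, B)), ‖d ^ k * x‖ ≤ ‖x‖ := by
    intro k
    induction k with
    | zero => simp
    | succ k ih =>
      intro x
      rw [pow_succ, mul_assoc]
      refine (ih _).trans ((norm_mul_le _ _).trans ?_)
      exact mul_le_of_le_one_left (norm_nonneg _) hd
  induction k with
  | zero => simp [twistedComm]
  | succ k ih =>
    have h : twistedComm θ p (d ^ (k + 1))
        = twistedComm θ p (d ^ k) * multiplierExt θ d + d ^ k * twistedComm θ p d := by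
      simp only [twistedComm, pow_succ, map_mul]
      noncomm_ring
    rw [h]
    calc _ ≤ ‖twistedComm θ p (d ^ k) * multiplierExt θ d‖ + ‖d ^ k * twistedComm θ p d‖ :=
          norm_add_le _ _
      _ ≤ ‖twistedComm θ p (d ^ k)‖ * 1 + ‖twistedComm θ p d‖ := by
          gcongr
          · refine (norm_mul_le _ _).trans ?_
            gcongr
            exact (norm_multiplierExt_le θ d).trans hd
          · exact hpow _ _
      _ ≤ k * ‖twistedComm θ p d‖ * 1 + ‖twistedComm θ p d‖ := by gcongr
      _ = _ := by push_cast; ring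

/-- The point is that K depends on the polynomial alone, not on θ, p or d. -/
theorem exists_norm_twistedComm_aeval_le (q : Polynomial ℝ) :
    ∃ K : ℝ, 0 ≤ K ∧ ∀ (θ : B ≃⋆ₐ[ℂ] B) (p d : 𝓜(ℂ, B)), ‖d‖ ≤ 1 →
      ‖twistedComm θ p (Polynomial.aeval d q)‖ ≤ K * ‖twistedComm θ p d‖ := by
  refine ⟨∑ k ∈ Finset.range (q.natDegree + 1), |q.coeff k| * k,
    Finset.sum_nonneg fun k _ => by positivity, fun θ p d hd => ?_⟩
  rw [Polynomial.aeval_eq_sum_range, twistedComm_sum, Finset.sum_mul]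
  refine (norm_sum_le _ _).trans (Finset.sum_le_sum fun k _ => ?_)
  rw [← Complex.coe_smul, twistedComm_smul, norm_smul, Complex.norm_real, Real.norm_eq_abs,
    mul_assoc]
  gcongr
  exact norm_twistedComm_pow_le θ p hd k

/-- A modulus of continuity for passing from twisted commutators with `s²` to those with `s`. -/
theorem exists_sqrt_modulus (C : ℝ) {ε : ℝ} (hε : 0 < ε) :
    ∃ δ : ℝ, 0 < δ ∧ ∀ (θ : B ≃⋆ₐ[ℂ] B) (p s : 𝓜(ℂ, B)), ‖p‖ ≤ C → IsSelfAdjoint s →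
      spectrum ℝ s ⊆ Set.Icc 0 1 → ‖twistedComm θ p (s * s)‖ ≤ δ → ‖twistedComm θ p s‖ ≤ ε := by
  set η : ℝ := min 1 (ε / (4 * (|C| + 1))) with hη
  have hη0 : 0 < η := by positivity
  -- By Weierstrass the square root is uniformly close to a polynomial q on [0,1], so s is within η
  -- of q(s²). The commutator of q(s²) is controlled by that of s², and the remainder contributes at
  -- most 2Cη.
  obtain ⟨q, hq⟩ := exists_polynomial_near_of_continuousOn 0 1 Real.sqrt
    Real.continuous_sqrt.continuousOn η hη0
  obtain ⟨K, hK0, hK⟩ := exists_norm_twistedComm_aeval_le (B := B) q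
  refine ⟨ε / (2 * (K + 1)), by positivity, fun θ p s hp hs hspec hδ => ?_⟩
  have hC : 0 ≤ C := (norm_nonneg p).trans hp
  have hs1 : ‖s‖ ≤ 1 := by
    conv_lhs => rw [← cfc_id' ℝ s]
    refine norm_cfc_le zero_le_one fun x hx => ?_
    rw [Real.norm_of_nonneg (hspec hx).1]
    exact (hspec hx).2
  have hss : ‖s * s‖ ≤ 1 := (norm_mul_le _ _).trans (mul_le_one₀ hs1 (norm_nonneg _) hs1)
  have hae : Polynomial.aeval (s * s) q = cfc (fun x : ℝ => q.eval (x * x)) s := by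
    have h1 : cfc (fun x : ℝ => (q.comp (Polynomial.X * Polynomial.X)).eval x) s
        = Polynomial.aeval s (q.comp (Polynomial.X * Polynomial.X)) := cfc_polynomial _ s
    rw [Polynomial.aeval_comp] at h1
    simpa using h1.symm
  have hdiff : ‖s - Polynomial.aeval (s * s) q‖ ≤ η := by
    have h1 : s - Polynomial.aeval (s * s) q = cfc (fun x : ℝ => x - q.eval (x * x)) s := by
      rw [cfc_sub (R := ℝ) (fun x => x) (fun x => q.eval (x * x)) s (by fun_prop) (by fun_prop),
        cfc_id' ℝ s, hae]
    rw [h1]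
    refine norm_cfc_le hη0.le fun x hx => ?_
    obtain ⟨h0, h1⟩ := hspec hx
    have h2 := hq (x * x) ⟨mul_nonneg h0 h0, mul_le_one₀ h1 h0 h1⟩
    rw [Real.sqrt_mul_self h0, abs_sub_comm] at h2
    exact h2.le
  have hsplit : twistedComm θ p s = twistedComm θ p (Polynomial.aeval (s * s) q)
      + (p * multiplierExt θ (s - Polynomial.aeval (s * s) q)
        - (s - Polynomial.aeval (s * s) q) * p) := by
    have := twistedComm_sub θ p s (Polynomial.aeval (s * s) q)
    rw [eq_sub_iff_add_eq, add_comm] at this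
    exact this.symm
  have hb1 : K * ‖twistedComm θ p (s * s)‖ ≤ ε / 2 := by
    calc _ ≤ (K + 1) * (ε / (2 * (K + 1))) := by gcongr; linarith
      _ = ε / 2 := by field_simp
  have hb2 : C * η ≤ ε / 4 := by
    calc C * η ≤ (|C| + 1) * (ε / (4 * (|C| + 1))) := by
          gcongr
          · linarith [le_abs_self C]
          · exact min_le_right _ _
      _ = ε / 4 := by field_simp
  rw [hsplit]
  calc _ ≤ ‖twistedComm θ p (Polynomial.aeval (s * s) q)‖
        + (‖p * multiplierExt θ (s - Polynomial.aeval (s * s) q)‖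
          + ‖(s - Polynomial.aeval (s * s) q) * p‖) :=
        (norm_add_le _ _).trans (add_le_add_right (norm_sub_le _ _) _)
    _ ≤ K * ‖twistedComm θ p (s * s)‖ + (C * η + η * C) := by
        gcongr
        · exact hK θ p _ hss
        · refine (norm_mul_le _ _).trans ?_
          gcongr
          exact (norm_multiplierExt_le _ _).trans hdiff
        · refine (norm_mul_le _ _).trans ?_
          gcongr
    _ ≤ ε := by linarith

variable [PartialOrder B] [StarOrderedRing B]

theorem spectrum_emb_nonneg {b : B} (hb : 0 ≤ b) : ∀ x ∈ spectrum ℝ (emb b : 𝓜(ℂ, B)), 0 ≤ x := by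
  obtain ⟨c, rfl⟩ := CStarAlgebra.nonneg_iff_eq_star_mul_self.1 hb
  rw [map_mul, map_star]
  exact spectrum_star_mul_self_nonneg

theorem spectrum_emb_subset {b : B} (hb : 0 ≤ b) (hb1 : ‖b‖ ≤ 1) :
    spectrum ℝ (emb b : 𝓜(ℂ, B)) ⊆ Set.Icc 0 1 := by
  intro x hx
  refine ⟨spectrum_emb_nonneg hb x hx, ?_⟩
  have h : Nontrivial 𝓜(ℂ, B) := by
    by_contra h
    rw [not_nontrivial_iff_subsingleton] at h
    simp at hx
  have := spectrum.norm_le_norm_of_mem hx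
  rw [norm_emb] at this
  exact (le_abs_self x).trans (this.trans hb1)

/-- A strictly convergent partition of unity in `B` consisting of squares of positive elements
with small twisted commutators. -/
theorem exists_quasiCentral_partition (hB : IsSigmaUnital B) {I : Type*}
    {θ : I → (B ≃⋆ₐ[ℂ] B)} {p : I → 𝓜(ℂ, B)} {J : ℕ → Set I} (hJ : ∀ n, QuasiCompact θ p (J n))
    (hJmono : Monotone J) {ε : ℕ → ℝ} (hε : ∀ n, 0 < ε n) :
    ∃ b : ℕ → B, (∀ n, star (b n) = b n) ∧ (∀ n, ‖b n‖ ≤ 1) ∧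
      (∀ n, ∀ i ∈ J n, ‖twistedComm (θ i) (p i) (emb (b n))‖ ≤ ε n) ∧
      StrictTendsto (fun n => ∑ k ∈ Finset.range n, emb (b k * b k)) atTop 1 ∧
      ∀ M N, M ≤ N → ‖∑ k ∈ Finset.Ico M N, b k * b k‖ ≤ 1 := by
  obtain ⟨h, -, hh1, hh⟩ := hB
  choose C hC using fun n => (hJ n).bdd
  choose δ hδ0 hδ using fun n => exists_sqrt_modulus (B := B) (C n) (hε n)
  -- The increment d n involves the tolerances τ n and τ (n+1), and both must be at most δ n / 2;
  -- hence the minimum with δ (n-1). At n = 0 truncated subtraction repeats δ 0. The term 1/(n+1)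
  -- makes E an approximate unit.
  let τ : ℕ → ℝ := fun n => min (1 / (n + 1 : ℝ)) (min (δ n) (δ (n - 1)) / 2)
  have hτ : ∀ n, 0 < τ n := fun n =>
    lt_min (by positivity) (half_pos (lt_min (hδ0 _) (hδ0 _)))
  let Λ : Type _ := {y : B // 0 ≤ y ∧ ‖y‖ < 1}
  have hstep : ∀ (n : ℕ) (x : Λ), ∃ e : Λ, x.1 ≤ e.1 ∧
      (∀ k ≤ n, ‖h k * e.1 - h k‖ ≤ τ (n + 1)) ∧
      ∀ i ∈ J (n + 1), ‖twistedComm (θ i) (p i) (emb e.1)‖ ≤ τ (n + 1) := by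
    intro n x
    obtain ⟨e, he, hxe, heW, heJ⟩ := exists_quasiCentral (hJ (n + 1)) x.2
      ((Set.finite_Iic n).image h).totallyBounded (hτ (n + 1))
    exact ⟨⟨e, he⟩, hxe, fun k hk => heW _ ⟨k, hk, rfl⟩, heJ⟩
  choose next hn1 hn2 hn3 using hstep
  let E : ℕ → Λ := fun n => Nat.rec ⟨0, le_rfl, by simp⟩ (fun n y => next n y) n
  have hE : ∀ n, E (n + 1) = next n (E n) := fun _ => rfl
  have hEmono : Monotone fun n => (E n).1 :=
    monotone_nat_of_le_succ fun n => by rw [hE]; exact hn1 _ _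
  have hEJ : ∀ n, ∀ i ∈ J n, ‖twistedComm (θ i) (p i) (emb (E n).1)‖ ≤ τ n := by
    intro n i hi
    cases n with
    | zero =>
      change ‖twistedComm (θ i) (p i) (emb (0 : B))‖ ≤ _
      rw [map_zero, twistedComm_zero, norm_zero]
      exact (hτ 0).le
    | succ n => exact hn3 n (E n) i hi
  -- The b n are the square roots of the increments of an increasing quasi-central approximate unit,
  -- so the sums of squares telescope.
  set d : ℕ → B := fun n => (E (n + 1)).1 - (E n).1 with hd
  have hd0 : ∀ n, 0 ≤ d n := fun n => sub_nonneg.2 (hEmono (Nat.le_succ n))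
  have hdle : ∀ n, d n ≤ (E (n + 1)).1 := fun n => sub_le_self _ (E n).2.1
  have hd1 : ∀ n, ‖d n‖ ≤ 1 := fun n =>
    (CStarAlgebra.norm_le_norm_of_nonneg_of_le (hd0 n) (hdle n)).trans (E (n + 1)).2.2.le
  have hbb : ∀ n, CFC.sqrt (d n) * CFC.sqrt (d n) = d n :=
    fun n => CFC.sqrt_mul_sqrt_self _ (hd0 n)
  have hb0 : ∀ n, 0 ≤ CFC.sqrt (d n) := fun n => CFC.sqrt_nonneg _
  have hbs : ∀ n, star (CFC.sqrt (d n)) = CFC.sqrt (d n) :=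
    fun n => (IsSelfAdjoint.of_nonneg (hb0 n)).star_eq
  have hb1 : ∀ n, ‖CFC.sqrt (d n)‖ ≤ 1 := by
    intro n
    have h1 := (IsSelfAdjoint.of_nonneg (hb0 n)).norm_mul_self
    rw [hbb] at h1
    exact (sq_le_one_iff₀ (norm_nonneg _)).1 (h1 ▸ hd1 n)
  have hsum : ∀ N, ∑ k ∈ Finset.range N, d k = (E N).1 := by
    intro N
    rw [hd, Finset.sum_range_sub (fun n => (E n).1)]
    exact sub_zero _
  refine ⟨fun n => CFC.sqrt (d n), hbs, hb1, fun n i hi => ?_, ?_, fun M N hMN => ?_⟩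
  · refine hδ n (θ i) (p i) _ (hC n i hi) ?_ (spectrum_emb_subset (hb0 n) (hb1 n)) ?_
    · rw [isSelfAdjoint_iff, ← map_star, hbs]
    · rw [← map_mul, hbb, hd, map_sub, twistedComm_sub]
      have h1 : τ (n + 1) ≤ δ n / 2 := (min_le_right _ _).trans
        (div_le_div_of_nonneg_right (min_le_right _ _) zero_le_two)
      have h2 : τ n ≤ δ n / 2 := (min_le_right _ _).trans
        (div_le_div_of_nonneg_right (min_le_left _ _) zero_le_two)
      have h3 := hEJ (n + 1) i (hJmono (Nat.le_succ n) hi)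
      have h4 := hEJ n i hi
      exact (norm_sub_le _ _).trans (by linarith)
  · have hEn : ∀ n, ‖(E n).1‖ ≤ 1 := fun n => (E n).2.2.le
    have hright : ∀ b : B, Tendsto (fun n => b * (E n).1) atTop (𝓝 b) := by
      have hk : ∀ k, Tendsto (fun n => h k * (E n).1) atTop (𝓝 (h k)) := by
        intro k
        rw [tendsto_iff_norm_sub_tendsto_zero, ← tendsto_add_atTop_iff_nat 1]
        refine squeeze_zero' (Eventually.of_forall fun _ => norm_nonneg _) ?_
          (tendsto_one_div_add_atTop_nhds_zero_nat)
        filter_upwards [eventually_ge_atTop k] with n hn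
        refine (hn2 n (E n) k hn).trans ((min_le_left _ _).trans ?_)
        push_cast
        exact one_div_le_one_div_of_le (by positivity) (by linarith)
      intro b
      rw [Metric.tendsto_atTop]
      intro η hη
      obtain ⟨k, hk'⟩ := (((hh b).2.sub_const b).norm.eventually_lt_const
        (show ‖b - b‖ < η / 4 by rw [sub_self, norm_zero]; positivity)).exists
      have h1 : Tendsto (fun n => b * h k * (E n).1) atTop (𝓝 (b * h k)) := by
        simpa only [mul_assoc] using (hk k).const_mul b
      obtain ⟨N, hN⟩ := Metric.tendsto_atTop.1 h1 (η / 4) (by positivity)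
      refine ⟨N, fun n hn => ?_⟩
      have h2 := hN n hn
      rw [dist_eq_norm] at h2 ⊢
      have h3 : b * (E n).1 - b = (b * h k * (E n).1 - b * h k) - (b * h k - b) * (E n).1
          + (b * h k - b) := by noncomm_ring
      rw [h3]
      calc _ ≤ ‖b * h k * (E n).1 - b * h k‖ + ‖(b * h k - b) * (E n).1‖ + ‖b * h k - b‖ :=
            (norm_add_le _ _).trans (add_le_add_left (norm_sub_le _ _) _)
        _ ≤ ‖b * h k * (E n).1 - b * h k‖ + ‖b * h k - b‖ * 1 + ‖b * h k - b‖ := by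
            gcongr
            exact (norm_mul_le _ _).trans (by gcongr; exact hEn n)
        _ < η := by linarith
    have hfun : (fun n => ∑ k ∈ Finset.range n, (emb (CFC.sqrt (d k) * CFC.sqrt (d k)) : 𝓜(ℂ, B)))
        = fun n => emb (E n).1 := by
      funext n
      simp only [hbb, ← map_sum, hsum]
    rw [hfun]
    intro b
    constructor
    · have h1 := (hright (star b)).star
      simp only [star_mul, star_star, (IsSelfAdjoint.of_nonneg (E _).2.1).star_eq] at h1
      exact h1
    · exact hright b
  · simp only [hbb]
    rw [Finset.sum_Ico_eq_sub _ hMN, hsum, hsum]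
    exact (CStarAlgebra.norm_le_norm_of_nonneg_of_le (sub_nonneg.2 (hEmono hMN))
      (sub_le_self _ (E M).2.1)).trans (E N).2.2.le

end SquareRoot

end

noncomputable section

/-! ### Approximate compressions of infinite repeats -/

namespace IsometrySequence

variable {G B : Type*} [Group G] [TopologicalSpace G] [NonUnitalCStarAlgebra B]
  {β : CStarAction G B} (T : IsometrySequence β)

theorem star_mul_eq_ite (i j : ℕ) : star (T.t i) * T.t j = if i = j then 1 else 0 := by
  split_ifs with h
  · rw [h, T.isometry]
  · exact T.orth h

/-- After multiplication by t n the partial sums are constant as soon as N > n, by orthogonality of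
the ranges. -/
theorem infiniteSum_mul_t (x : 𝓜(ℂ, B)) (n : ℕ) : T.infiniteSum x * T.t n = T.t n * x := by
  refine ((T.infiniteSum_spec x).mul_const (T.t n)).unique ?_
  refine StrictTendsto.of_tendsto (tendsto_const_nhds.congr' ?_)
  filter_upwards [eventually_gt_atTop n] with N hN
  rw [Finset.sum_mul]
  simp only [mul_assoc, T.star_mul_eq_ite, mul_ite, mul_one, mul_zero]
  rw [Finset.sum_ite_eq', if_pos (Finset.mem_range.2 hN)]

theorem star_t_mul_infiniteSum (x : 𝓜(ℂ, B)) (n : ℕ) :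
    star (T.t n) * T.infiniteSum x = x * star (T.t n) := by
  have h := congrArg star (T.infiniteSum_mul_t (star x) n)
  simpa [T.infiniteSum_star] using h

theorem star_t_mul_infiniteSum_mul_t (x : 𝓜(ℂ, B)) (m n : ℕ) :
    star (T.t m) * T.infiniteSum x * T.t n = if m = n then x else 0 := by
  rw [T.star_t_mul_infiniteSum, mul_assoc, T.star_mul_eq_ite]
  simp

end IsometrySequence

/-- Strict convergence of a series of multipliers is checked through the C⋆-identity, which controls
squares of norms. Here v is a sequence known to converge and σ collects a summable error. -/
theorem cauchySeq_of_sq_norm_sub_le {E F : Type*} [SeminormedAddCommGroup E]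
    [SeminormedAddCommGroup F] {u : ℕ → E} {v : ℕ → F} {σ : ℕ → ℝ} {C : ℝ}
    (h : ∀ M N, M ≤ N → ‖u N - u M‖ ^ 2 ≤ C * (‖v N - v M‖ + (σ N - σ M)))
    (hv : CauchySeq v) (hσ : CauchySeq σ) : CauchySeq u := by
  rw [Metric.cauchySeq_iff'] at hv hσ ⊢
  intro ε hε
  obtain ⟨N₁, hN₁⟩ := Metric.cauchySeq_iff.1 (Metric.cauchySeq_iff'.2 hv)
    (ε ^ 2 / (2 * (|C| + 1))) (by positivity)
  obtain ⟨N₂, hN₂⟩ := Metric.cauchySeq_iff.1 (Metric.cauchySeq_iff'.2 hσ)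
    (ε ^ 2 / (2 * (|C| + 1))) (by positivity)
  refine ⟨max N₁ N₂, fun n hn => ?_⟩
  have h1 := hN₁ n ((le_max_left _ _).trans hn) (max N₁ N₂) (le_max_left _ _)
  have h2 := hN₂ n ((le_max_right _ _).trans hn) (max N₁ N₂) (le_max_right _ _)
  rw [dist_eq_norm] at h1 ⊢
  rw [Real.dist_eq] at h2
  refine lt_of_pow_lt_pow_left₀ 2 hε.le ((h _ n hn).trans_lt ?_)
  set a := ‖v n - v (max N₁ N₂)‖
  set b := σ n - σ (max N₁ N₂)
  have h3 : a + |b| < ε ^ 2 / (|C| + 1) := by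
    have : ε ^ 2 / (|C| + 1) = ε ^ 2 / (2 * (|C| + 1)) + ε ^ 2 / (2 * (|C| + 1)) := by
      field_simp; norm_num
    linarith
  rw [lt_div_iff₀ (by positivity)] at h3
  have h4 : C * (a + b) ≤ |C| * (a + |b|) := by
    calc C * (a + b) ≤ |C * (a + b)| := le_abs_self _
      _ = |C| * |a + b| := abs_mul _ _
      _ ≤ |C| * (|a| + |b|) := by gcongr; exact abs_add_le _ _
      _ = |C| * (a + |b|) := by rw [abs_of_nonneg (norm_nonneg _)]
  have h5 : 0 ≤ a + |b| := add_nonneg (norm_nonneg _) (abs_nonneg _)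
  nlinarith

section Compression

variable {G B : Type*} [Group G] [TopologicalSpace G] [NonUnitalCStarAlgebra B]

/-- If `p` is weakly contained in `q` in the sense of finite sums of compressions, then there is an
almost isometric `S` such that `S⋆ q^∞ S - p` is small and has values in the base algebra. -/
theorem exists_compression (hB : IsSigmaUnital B) {β : CStarAction G B} (T : IsometrySequence β)
    {I : Type*} {θ : I → (B ≃⋆ₐ[ℂ] B)} {p q : I → 𝓜(ℂ, B)}
    (hT : ∀ i n, multiplierExt (θ i) (T.t n) = T.t n) {J : ℕ → Set I}
    (hJ : ∀ n, QuasiCompact θ p (J n)) (hJmono : Monotone J)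
    (hwc : ∀ n (b : B) (ε : ℝ), 0 < ε → ‖b‖ ≤ 1 → ∃ (N : ℕ) (c : ℕ → B), ∀ i ∈ J n,
      ‖star (emb b) * p i * multiplierExt (θ i) (emb b) - ∑ k ∈ Finset.range N,
        star (emb (c k)) * q i * multiplierExt (θ i) (emb (c k))‖ ≤ ε)
    {i₀ : I} (hi₀ : i₀ ∈ J 0) (hθ₀ : ∀ m, multiplierExt (θ i₀) m = m) (hp₀ : p i₀ = 1)
    (hq₀ : q i₀ = 1) {ε : ℝ} (hε : 0 < ε) (hε1 : ε ≤ 1) :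
    ∃ S : 𝓜(ℂ, B),
      (∀ i ∈ J 0, ‖star S * T.infiniteSum (q i) * multiplierExt (θ i) S - p i‖ ≤ ε) ∧
      ∀ n, ∀ i ∈ J n, MemBase (star S * T.infiniteSum (q i) * multiplierExt (θ i) S - p i) := by
  let _ : PartialOrder B := CStarAlgebra.spectralOrder B
  have _ : StarOrderedRing B := CStarAlgebra.spectralOrderedRing B
  -- The sum is ε/2. Block k has error at most 2 η k, one half from the commutator with b k and one
  -- half from weak containment, so the total is ε.
  set η : ℕ → ℝ := fun k => ε / 4 * (1 / 2) ^ k with hη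
  have hη0 : ∀ k, 0 < η k := fun k => by positivity
  have hηsum : HasSum η (ε / 2) := by
    rw [show ε / 2 = ε / 4 * 2 by ring]
    exact hasSum_geometric_two.mul_left (ε / 4)
  obtain ⟨b, hbs, hb1, hbJ, hbsum, hbIco⟩ := exists_quasiCentral_partition hB hJ hJmono hη0
  choose N c hc using fun k => hwc k (b k) (η k) (hη0 k) (hb1 k)
  -- Block k uses the isometries with indices m k + l, l < N k. The extra 1 keeps m strictly
  -- increasing even when N k = 0.
  let m : ℕ → ℕ := fun k => ∑ j ∈ Finset.range k, (N j + 1)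
  have hm : ∀ k, m (k + 1) = m k + (N k + 1) := fun k => Finset.sum_range_succ _ _
  have hmono : StrictMono m := strictMono_nat_of_lt_succ fun k => by rw [hm]; omega
  set x : ℕ → 𝓜(ℂ, B) := fun k => ∑ l ∈ Finset.range (N k), T.t (m k + l) * emb (c k l) with hx
  have hne : ∀ k k' l l', k < k' → l < N k → m k + l ≠ m k' + l' := by
    intro k k' l l' hk hl
    have h1 := hmono.monotone (Nat.succ_le_of_lt hk)
    rw [Nat.succ_eq_add_one, hm] at h1
    omega
  -- Distinct blocks use distinct isometries, so compressing q^∞ by the x k has no cross terms.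
  have hxx : ∀ i k k', star (x k) * T.infiniteSum (q i) * multiplierExt (θ i) (x k')
      = if k = k' then ∑ l ∈ Finset.range (N k),
        star (emb (c k l)) * q i * multiplierExt (θ i) (emb (c k l)) else 0 := by
    intro i k k'
    have h1 : star (x k) * T.infiniteSum (q i) * multiplierExt (θ i) (x k')
        = ∑ l ∈ Finset.range (N k), ∑ l' ∈ Finset.range (N k'),
          star (emb (c k l)) * (star (T.t (m k + l)) * T.infiniteSum (q i) * T.t (m k' + l'))
            * multiplierExt (θ i) (emb (c k' l')) := by
      simp only [hx, star_sum, map_sum, Finset.sum_mul, Finset.mul_sum, star_mul, map_mul, hT,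
        mul_assoc]
      exact Finset.sum_comm
    rw [h1]
    simp only [T.star_t_mul_infiniteSum_mul_t]
    split_ifs with hk
    · subst hk
      refine Finset.sum_congr rfl fun l hl => ?_
      rw [Finset.sum_eq_single l]
      · simp
      · intro l' _ hl'
        rw [if_neg (by omega)]
        simp
      · exact fun h => absurd hl h
    · refine Finset.sum_eq_zero fun l hl => Finset.sum_eq_zero fun l' hl' => ?_
      rw [if_neg]
      · simp
      · rw [Finset.mem_range] at hl hl'
        rcases lt_or_gt_of_ne hk with hlt | hlt
        · exact hne _ _ _ _ hlt hl
        · exact (hne _ _ _ _ hlt hl').symm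
  have hYY : ∀ i (s : Finset ℕ),
      star (∑ k ∈ s, x k) * T.infiniteSum (q i) * multiplierExt (θ i) (∑ k ∈ s, x k)
        = ∑ k ∈ s, star (x k) * T.infiniteSum (q i) * multiplierExt (θ i) (x k) := by
    intro i s
    rw [star_sum, map_sum, Finset.sum_mul, Finset.sum_mul]
    refine Finset.sum_congr rfl fun k hk => ?_
    rw [Finset.mul_sum, Finset.sum_eq_single k]
    · intro k' _ hk'
      rw [hxx, if_neg hk'.symm]
    · exact fun h => absurd hk h
  -- The defect of block k relative to its share b k² p i. The shares add up to p i, so ∑ z i k is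
  -- the defect of the full compression.
  set z : I → ℕ → 𝓜(ℂ, B) := fun i k =>
    star (x k) * T.infiniteSum (q i) * multiplierExt (θ i) (x k) - emb (b k * b k) * p i with hz
  have hzn : ∀ n k, n ≤ k → ∀ i ∈ J n, ‖z i k‖ ≤ 2 * η k := by
    intro n k hnk i hi
    have hi' := hJmono hnk hi
    have h1 : z i k = emb (b k) * twistedComm (θ i) (p i) (emb (b k))
        - (star (emb (b k)) * p i * multiplierExt (θ i) (emb (b k))
          - ∑ l ∈ Finset.range (N k),
            star (emb (c k l)) * q i * multiplierExt (θ i) (emb (c k l))) := by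
      have h2 : star (emb (b k) : 𝓜(ℂ, B)) = emb (b k) := by rw [← map_star, hbs]
      rw [hz]
      simp only [twistedComm, hxx, if_true, h2, map_mul]
      noncomm_ring
    rw [h1]
    refine (norm_sub_le _ _).trans ?_
    have h3 : ‖emb (b k) * twistedComm (θ i) (p i) (emb (b k))‖ ≤ η k := by
      refine (norm_mul_le _ _).trans ?_
      rw [norm_emb]
      exact (mul_le_of_le_one_left (norm_nonneg _) (hb1 k)).trans (hbJ k i hi')
    have h4 := hc k i hi'
    linarith
  have hzB : ∀ i k, MemBase (z i k) := by
    intro i k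
    refine MemBase.sub ?_ ((memBase_emb _).mul_right _)
    rw [hxx, if_pos rfl]
    refine memBase_sum _ fun l _ => ?_
    rw [← map_star]
    exact ((memBase_emb _).mul_right _).mul_right _
  -- At i₀ both families equal 1, so the compression estimate becomes an estimate of x⋆x. It yields
  -- the bound 2 for block sums and the convergence of the series.
  have hz₀ : ∀ s : Finset ℕ, star (∑ k ∈ s, x k) * (∑ k ∈ s, x k)
      = ∑ k ∈ s, emb (b k * b k) + ∑ k ∈ s, z i₀ k := by
    intro s
    have h1 := hYY i₀ s
    rw [hq₀, T.infiniteSum_one, mul_one, hθ₀] at h1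
    rw [h1, ← Finset.sum_add_distrib]
    refine Finset.sum_congr rfl fun k _ => ?_
    simp only [hz, hq₀, T.infiniteSum_one, mul_one, hθ₀, hp₀]
    abel
  have hηle : ∀ s : Finset ℕ, ∑ k ∈ s, 2 * η k ≤ 1 := by
    intro s
    rw [← Finset.mul_sum]
    have := sum_le_hasSum s (fun k _ => (hη0 k).le) hηsum
    linarith
  have hzsum : ∀ s : Finset ℕ, ‖∑ k ∈ s, z i₀ k‖ ≤ ∑ k ∈ s, 2 * η k := fun s =>
    (norm_sum_le _ _).trans (Finset.sum_le_sum fun k _ => hzn 0 k (Nat.zero_le k) i₀ hi₀)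
  have hYIco : ∀ M N, M ≤ N → ‖∑ k ∈ Finset.Ico M N, x k‖ ≤ 2 := by
    intro M N hMN
    refine le_of_sq_le_sq ?_ zero_le_two
    rw [sq, ← CStarRing.norm_star_mul_self, hz₀, ← map_sum]
    refine (norm_add_le _ _).trans ?_
    rw [norm_emb]
    have h1 := hbIco M N hMN
    have h2 := (hzsum (Finset.Ico M N)).trans (hηle _)
    linarith
  set Y : ℕ → 𝓜(ℂ, B) := fun n => ∑ k ∈ Finset.range n, x k with hY
  have hYsub : ∀ M N, M ≤ N → Y N - Y M = ∑ k ∈ Finset.Ico M N, x k := fun M N hMN =>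
    (Finset.sum_Ico_eq_sub _ hMN).symm
  have hY2 : ∀ n, ‖Y n‖ ≤ 2 := by
    intro n
    have := hYIco 0 n (Nat.zero_le n)
    rwa [← Finset.range_eq_Ico] at this
  have hσ : CauchySeq fun n => ∑ k ∈ Finset.range n, 2 * η k :=
    (hηsum.mul_left 2).tendsto_sum_nat.cauchySeq
  obtain ⟨S, hS⟩ : ∃ S, StrictTendsto Y atTop S := by
    refine exists_strictTendsto (fun a => ?_) (fun a => ?_)
    -- On the left, ‖(Y N - Y M) a‖² is the norm of the compression by a of ∑ b k² + ∑ z i₀ k over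
    -- the block; the first sum converges strictly and the second is summable in norm.
    · refine cauchySeq_of_sq_norm_sub_le (C := ‖a‖ + ‖a‖ ^ 2)
        (v := fun n => (∑ k ∈ Finset.range n, (emb (b k * b k) : 𝓜(ℂ, B))) * emb a)
        (σ := fun n => ∑ k ∈ Finset.range n, 2 * η k) (fun M N hMN => ?_) ?_ hσ
      · rw [← sub_apply, ← DoubleCentralizer.sub_fst, ← norm_emb, ← mul_emb,
          hYsub M N hMN, ← sub_mul, ← Finset.sum_Ico_eq_sub _ hMN, ← Finset.sum_Ico_eq_sub _ hMN,
          sq, ← CStarRing.norm_star_mul_self]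
        have h1 : star ((∑ k ∈ Finset.Ico M N, x k) * emb a) * ((∑ k ∈ Finset.Ico M N, x k) * emb a)
            = emb (star a) * ((∑ k ∈ Finset.Ico M N, emb (b k * b k)) * emb a)
              + emb (star a) * (∑ k ∈ Finset.Ico M N, z i₀ k) * emb a := by
          rw [star_mul, mul_assoc, ← mul_assoc _ _ (emb a), hz₀, map_star]
          noncomm_ring
        rw [h1]
        set V := (∑ k ∈ Finset.Ico M N, (emb (b k * b k) : 𝓜(ℂ, B))) * emb a
        have h2 : ‖emb (star a) * V‖ ≤ ‖a‖ * ‖V‖ := by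
          refine (norm_mul_le _ _).trans ?_
          rw [norm_emb, norm_star]
        have h3 : ‖emb (star a) * (∑ k ∈ Finset.Ico M N, z i₀ k) * emb a‖
            ≤ ‖a‖ ^ 2 * ∑ k ∈ Finset.Ico M N, 2 * η k := by
          refine (norm_mul_le _ _).trans ?_
          rw [norm_emb]
          calc _ ≤ (‖a‖ * ∑ k ∈ Finset.Ico M N, 2 * η k) * ‖a‖ := by
                gcongr
                refine (norm_mul_le _ _).trans ?_
                rw [norm_emb, norm_star]
                gcongr
                exact hzsum _
            _ = _ := by ring
        have h4 : 0 ≤ ∑ k ∈ Finset.Ico M N, 2 * η k :=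
          Finset.sum_nonneg fun k _ => by have := hη0 k; positivity
        refine (norm_add_le _ _).trans ?_
        nlinarith [norm_nonneg V, norm_nonneg a, mul_nonneg (norm_nonneg a) h4,
          mul_nonneg (sq_nonneg ‖a‖) (norm_nonneg V)]
      · exact ((strictTendsto_iff.1 hbsum a).1).cauchySeq
    -- On the right, Y N - Y M is fixed by the projection Q onto the ranges of t n, m M ≤ n < m N,
    -- so a Q controls the product with a.
    · refine cauchySeq_of_sq_norm_sub_le (C := 4 * ‖a‖)
        (v := fun n => emb a * T.partialSum (Finset.range (m n)) 1)
        (σ := fun _ => 0) (fun M N hMN => ?_) ?_ (tendsto_const_nhds.cauchySeq)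
      · rw [← sub_apply, ← DoubleCentralizer.sub_snd, ← norm_emb, ← emb_mul,
          hYsub M N hMN, ← mul_sub, T.partialSum_sub (hmono.monotone hMN), sub_self, add_zero]
        set Q := T.partialSum (Finset.Ico (m M) (m N)) 1 with hQ
        have h1 : ∑ k ∈ Finset.Ico M N, x k = Q * ∑ k ∈ Finset.Ico M N, x k := by
          rw [Finset.mul_sum]
          refine Finset.sum_congr rfl fun k hk => ?_
          rw [Finset.mem_Ico] at hk
          rw [hx, Finset.mul_sum]
          refine Finset.sum_congr rfl fun l hl => ?_
          rw [Finset.mem_range] at hl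
          have h2 : m k + l ∈ Finset.Ico (m M) (m N) := by
            have h3 := hmono.monotone hk.1
            have h4 := hmono.monotone (Nat.succ_le_of_lt hk.2)
            rw [Nat.succ_eq_add_one, hm] at h4
            rw [Finset.mem_Ico]
            omega
          rw [hQ, T.partialSum_apply, Finset.sum_mul, Finset.sum_eq_single (m k + l)]
          · rw [mul_one, mul_assoc, ← mul_assoc (star _), T.isometry, one_mul]
          · intro j _ hj
            rw [mul_one, mul_assoc, ← mul_assoc (star _), T.orth hj, zero_mul, mul_zero]
          · exact fun h => absurd h2 h
        have hQ1 : ‖Q‖ ≤ 1 :=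
          (NonUnitalStarAlgHom.norm_apply_le (T.partialSum _) 1).trans (norm_unitary_le 1)
        have h5 : ‖emb a * ∑ k ∈ Finset.Ico M N, x k‖ ≤ 2 * ‖emb a * Q‖ := by
          rw [h1, ← mul_assoc, mul_comm 2]
          refine (norm_mul_le _ _).trans ?_
          gcongr
          exact hYIco M N hMN
        have h6 : ‖emb a * Q‖ ≤ ‖a‖ := by
          refine (norm_mul_le _ _).trans ?_
          rw [norm_emb]
          exact mul_le_of_le_one_right (norm_nonneg _) hQ1
        nlinarith [norm_nonneg (emb a * Q), norm_nonneg (emb a * ∑ k ∈ Finset.Ico M N, x k)]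
      · have h1 := ((strictTendsto_iff.1 T.strictTendsto_partialSum_one a).2).cauchySeq
        exact h1.comp_tendsto hmono.tendsto_atTop
  have hlim : ∀ i, StrictTendsto (fun n => ∑ k ∈ Finset.range n, z i k) atTop
      (star S * T.infiniteSum (q i) * multiplierExt (θ i) S - p i) := by
    intro i
    have h1 := ((hS.star.mul_const (T.infiniteSum (q i))).mul (hS.multiplierExt (θ i))
      (C := max (2 * ‖T.infiniteSum (q i)‖) 2) (fun n => ?_) (fun n => ?_)).sub
      (hbsum.mul_const (p i))
    · rw [one_mul] at h1
      refine h1.congr fun n => ?_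
      rw [hYY, Finset.sum_mul, ← Finset.sum_sub_distrib]
    · refine (norm_mul_le _ _).trans (le_max_of_le_left ?_)
      rw [norm_star]
      gcongr
      exact hY2 n
    · exact (norm_multiplierExt_le _ _).trans (le_max_of_le_right (hY2 n))
  -- The terms are norm summable from index n on, so the strict limit is a norm limit. Membership in
  -- B and the bound ε pass to the limit.
  have hsummable : ∀ n, ∀ i ∈ J n, HasSum (z i)
      (star S * T.infiniteSum (q i) * multiplierExt (θ i) S - p i) := by
    intro n i hi
    have h1 : Summable (z i) := by
      refine Summable.of_norm_bounded_eventually_nat (hηsum.mul_left 2).summable ?_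
      filter_upwards [eventually_ge_atTop n] with k hk using hzn n k hk i hi
    have h2 := StrictTendsto.of_tendsto h1.hasSum.tendsto_sum_nat
    rw [(hlim i).unique h2]
    exact h1.hasSum
  refine ⟨S, fun i hi => ?_, fun n i hi => ?_⟩
  · refine (hsummable 0 i hi).norm_le_of_bounded ?_ fun k => hzn 0 k (Nat.zero_le k) i hi
    rw [show ε = 2 * (ε / 2) by ring]
    exact hηsum.mul_left 2
  · exact MemBase.of_tendsto (hsummable n i hi).tendsto_sum_nat
      (Eventually.of_forall fun N => memBase_sum _ fun k _ => hzB i k)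

end Compression

end

noncomputable section

/-! ### Isometric compressions -/

section Polar

variable {B : Type*} [NonUnitalCStarAlgebra B]

/-- The polar decomposition of a multiplier `X` with `X⋆ X - 1` small and in the base algebra. -/
theorem exists_isometry_near {X : 𝓜(ℂ, B)} {ε : ℝ} (hX : MemBase (star X * X - 1))
    (hXε : ‖star X * X - 1‖ ≤ ε) (hε : ε ≤ 1 / 2) :
    ∃ S : 𝓜(ℂ, B), star S * S = 1 ∧ ‖X‖ ≤ 2 ∧ ‖S - X‖ ≤ 4 * ε ∧ MemBase (S - X) := by
  set c := star X * X - 1 with hc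
  have hε0 : 0 ≤ ε := (norm_nonneg _).trans hXε
  have hcs : IsSelfAdjoint c := by
    rw [isSelfAdjoint_iff, hc]; simp
  have hXX : star X * X = 1 + c := by rw [hc]; abel
  have hX2 : ‖X‖ ≤ 2 := by
    refine le_of_sq_le_sq ?_ zero_le_two
    rw [sq, ← CStarRing.norm_star_mul_self, hXX]
    have h1 := norm_add_le (1 : 𝓜(ℂ, B)) c
    have h2 : ‖(1 : 𝓜(ℂ, B))‖ ≤ 1 := norm_unitary_le 1
    linarith
  have hspec : ∀ x ∈ spectrum ℝ c, 1 / 2 ≤ 1 + x := by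
    intro x hx
    have h : Nontrivial 𝓜(ℂ, B) := by
      by_contra h
      rw [not_nontrivial_iff_subsingleton] at h
      simp at hx
    have h1 := (spectrum.norm_le_norm_of_mem hx).trans hXε
    have h2 := (abs_le.1 h1).1
    linarith
  have hs : ∀ x ∈ spectrum ℝ c, 1 / 2 ≤ √(1 + x) := by
    intro x hx
    refine Real.le_sqrt_of_sq_le ?_
    have := hspec x hx
    linarith
  have hcf : ContinuousOn (fun x : ℝ => (√(1 + x))⁻¹) (spectrum ℝ c) :=
    ContinuousOn.inv₀ (by fun_prop) fun x hx => by have := hs x hx; positivity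
  -- The functions satisfy (1+x)^(-1/2) - 1 = x k(x) with k bounded on the spectrum. Factoring out c
  -- keeps X h - X in B and makes it of order ε.
  have hck : ContinuousOn (fun x : ℝ => -(√(1 + x) * (1 + √(1 + x)))⁻¹) (spectrum ℝ c) :=
    (ContinuousOn.inv₀ (by fun_prop) fun x hx => by have := hs x hx; positivity).neg
  set h := cfc (fun x : ℝ => (√(1 + x))⁻¹) c with hh
  set k := cfc (fun x : ℝ => -(√(1 + x) * (1 + √(1 + x)))⁻¹) c with hk
  have hhs : star h = h := (cfc_predicate (R := ℝ) _ c : IsSelfAdjoint h)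
  have h1c : (1 : 𝓜(ℂ, B)) + c = cfc (fun x : ℝ => 1 + x) c := by
    rw [cfc_add c (fun _ => 1) (fun x => x) (by fun_prop) (by fun_prop), cfc_const_one ℝ c,
      cfc_id' ℝ c]
  have hhh : h * (1 + c) * h = 1 := by
    rw [h1c, hh, ← cfc_mul (fun x : ℝ => (√(1 + x))⁻¹) (fun x => 1 + x) c hcf (by fun_prop),
      ← cfc_mul (fun x : ℝ => (√(1 + x))⁻¹ * (1 + x)) (fun x : ℝ => (√(1 + x))⁻¹) c
        (hcf.mul (by fun_prop)) hcf,
      ← cfc_const_one ℝ c]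
    refine cfc_congr fun x hx => ?_
    have h1 := hs x hx
    have h2 : √(1 + x) * √(1 + x) = 1 + x :=
      Real.mul_self_sqrt (by have := hspec x hx; linarith)
    have h3 : √(1 + x) ≠ 0 := by positivity
    change (√(1 + x))⁻¹ * (1 + x) * (√(1 + x))⁻¹ = 1
    nth_rewrite 2 [← h2]
    field_simp
  have hhk : h - 1 = c * k := by
    have h1 : c * k = cfc (fun x : ℝ => x * -(√(1 + x) * (1 + √(1 + x)))⁻¹) c := by
      rw [cfc_mul (fun x : ℝ => x) _ c (by fun_prop) hck, cfc_id' ℝ c]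
    rw [h1, ← cfc_const_one ℝ c, hh, ← cfc_sub _ _ c hcf (by fun_prop)]
    refine cfc_congr fun x hx => ?_
    have h1 := hs x hx
    have h2 : √(1 + x) * √(1 + x) = 1 + x :=
      Real.mul_self_sqrt (by have := hspec x hx; linarith)
    change (√(1 + x))⁻¹ - 1 = x * -(√(1 + x) * (1 + √(1 + x)))⁻¹
    set s := √(1 + x)
    have hx' : x = s * s - 1 := by linarith
    have h3 : s ≠ 0 := by positivity
    have h4 : 1 + s ≠ 0 := by positivity
    rw [hx']
    field_simp
    ring
  have hk2 : ‖k‖ ≤ 2 := by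
    refine norm_cfc_le zero_le_two fun x hx => ?_
    have h1 := hs x hx
    rw [norm_neg, norm_inv, Real.norm_of_nonneg (by positivity)]
    refine inv_le_of_inv_le₀ two_pos ?_
    nlinarith
  have hSX : X * h - X = X * (c * k) := by rw [← hhk]; noncomm_ring
  refine ⟨X * h, ?_, hX2, ?_, ?_⟩
  · rw [star_mul, hhs, mul_assoc, ← mul_assoc (star X), hXX, ← mul_assoc, hhh]
  · rw [hSX]
    calc ‖X * (c * k)‖ ≤ ‖X‖ * (‖c‖ * ‖k‖) := by
          refine (norm_mul_le _ _).trans ?_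
          gcongr
          exact norm_mul_le _ _
      _ ≤ 2 * (ε * 2) := by gcongr
      _ = 4 * ε := by ring
  · rw [hSX]
    exact (hX.mul_right k).mul_left X

end Polar

section IsometricCompression

variable {G B : Type*} [Group G] [TopologicalSpace G] [NonUnitalCStarAlgebra B]

/-- The compression estimate at i₀ says that X⋆X - 1 is small and in B, so polar decomposition
replaces X by an isometry S with S - X small and in B. The compressions then change only by terms
containing S - X. -/
theorem exists_isometric_compression (hB : IsSigmaUnital B) {β : CStarAction G B}
    (T : IsometrySequence β)
    {I : Type*} {θ : I → (B ≃⋆ₐ[ℂ] B)} {p q : I → 𝓜(ℂ, B)}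
    (hT : ∀ i n, multiplierExt (θ i) (T.t n) = T.t n) {J : ℕ → Set I}
    (hJ : ∀ n, QuasiCompact θ p (J n)) (hJmono : Monotone J)
    (hwc : ∀ n (b : B) (ε : ℝ), 0 < ε → ‖b‖ ≤ 1 → ∃ (N : ℕ) (c : ℕ → B), ∀ i ∈ J n,
      ‖star (emb b) * p i * multiplierExt (θ i) (emb b) - ∑ k ∈ Finset.range N,
        star (emb (c k)) * q i * multiplierExt (θ i) (emb (c k))‖ ≤ ε)
    {i₀ : I} (hi₀ : i₀ ∈ J 0) (hθ₀ : ∀ m, multiplierExt (θ i₀) m = m) (hp₀ : p i₀ = 1)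
    (hq₀ : q i₀ = 1) {C : ℝ} (hq : ∀ i ∈ J 0, ‖q i‖ ≤ C) {ε : ℝ} (hε : 0 < ε) :
    ∃ S : 𝓜(ℂ, B), star S * S = 1 ∧
      (∀ i ∈ J 0, ‖star S * T.infiniteSum (q i) * multiplierExt (θ i) S - p i‖ ≤ ε) ∧
      ∀ n, ∀ i ∈ J n, MemBase (star S * T.infiniteSum (q i) * multiplierExt (θ i) S - p i) := by
  have hC : 0 ≤ C := (norm_nonneg _).trans (hq i₀ hi₀)
  -- Since ‖S - X‖ ≤ 4δ, ‖X‖ ≤ 2 and ‖S‖ ≤ 1, the correction costs 8Cδ + 4Cδ.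
  set δ : ℝ := min (1 / 2) (ε / (1 + 12 * C)) with hδ
  have hδ0 : 0 < δ := by positivity
  have hδ1 : δ ≤ 1 / 2 := min_le_left _ _
  have hδ2 : δ + 12 * C * δ ≤ ε := by
    have h1 : δ ≤ ε / (1 + 12 * C) := min_le_right _ _
    rw [le_div_iff₀ (by positivity)] at h1
    linarith
  obtain ⟨X, hX, hXB⟩ := exists_compression hB T hT hJ hJmono hwc hi₀ hθ₀ hp₀ hq₀ hδ0
    (by linarith)
  have h₀ := hX i₀ hi₀
  have h₀B := hXB 0 i₀ hi₀
  rw [hq₀, T.infiniteSum_one, mul_one, hθ₀, hp₀] at h₀ h₀B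
  obtain ⟨S, hSS, hX2, hSX, hSXB⟩ := exists_isometry_near h₀B h₀ hδ1
  have hS1 : ‖S‖ ≤ 1 := by
    refine le_of_sq_le_sq ?_ zero_le_one
    rw [sq, ← CStarRing.norm_star_mul_self, hSS, one_pow]
    exact norm_unitary_le 1
  have hsplit : ∀ i, star S * T.infiniteSum (q i) * multiplierExt (θ i) S - p i
      = (star X * T.infiniteSum (q i) * multiplierExt (θ i) X - p i)
        + (star (S - X) * T.infiniteSum (q i) * multiplierExt (θ i) X
          + star S * T.infiniteSum (q i) * multiplierExt (θ i) (S - X)) := by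
    intro i
    simp only [star_sub, map_sub]
    noncomm_ring
  refine ⟨S, hSS, fun i hi => ?_, fun n i hi => ?_⟩
  · have hqi : ‖T.infiniteSum (q i)‖ ≤ C :=
      (NonUnitalStarAlgHom.norm_apply_le
        (T.infiniteSumHom : 𝓜(ℂ, B) →⋆ₙₐ[ℂ] 𝓜(ℂ, B)) (q i)).trans (hq i hi)
    have n1 : ‖star (S - X) * T.infiniteSum (q i) * multiplierExt (θ i) X‖ ≤ 4 * δ * C * 2 := by
      refine (norm_mul_le _ _).trans ?_
      gcongr
      · refine (norm_mul_le _ _).trans ?_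
        rw [norm_star]
        gcongr
      · exact (norm_multiplierExt_le _ _).trans hX2
    have n2 : ‖star S * T.infiniteSum (q i) * multiplierExt (θ i) (S - X)‖ ≤ 1 * C * (4 * δ) := by
      refine (norm_mul_le _ _).trans ?_
      gcongr
      · refine (norm_mul_le _ _).trans ?_
        rw [norm_star]
        gcongr
      · exact (norm_multiplierExt_le _ _).trans hSX
    rw [hsplit]
    refine (norm_add_le _ _).trans ((add_le_add (hX i hi) ((norm_add_le _ _).trans
      (add_le_add n1 n2))).trans ?_)
    linarith
  · rw [hsplit]
    exact (hXB n i hi).add (((hSXB.star.mul_right _).mul_right _).add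
      ((hSXB.multiplierExt _).mul_left _))

end IsometricCompression

/-! ### Isometries intertwining cocycle representations -/

section Actions

variable {G A B : Type*} [Group G] [TopologicalSpace G]
  [NonUnitalCStarAlgebra A] [NonUnitalCStarAlgebra B]

theorem CStarAction.norm_aut (β : CStarAction G B) (g : G) (b : B) : ‖β.aut g b‖ = ‖b‖ := by
  simpa using (StarAlgEquiv.isometry (β.aut g)).norm_map_of_map_zero (map_zero (β.aut g)) b

theorem CStarAction.continuous_aut_apply (β : CStarAction G B) {X : Type*} [TopologicalSpace X]
    {f : X → G} {y : X → B} (hf : Continuous f) (hy : Continuous y) :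
    Continuous fun x => β.aut (f x) (y x) := by
  refine continuous_iff_continuousAt.2 fun x₀ => ?_
  have h1 : Tendsto (fun x => β.aut (f x) (y x - y x₀)) (𝓝 x₀) (𝓝 0) := by
    refine squeeze_zero_norm (a := fun x => ‖y x - y x₀‖) (fun x => (β.norm_aut _ _).le) ?_
    simpa using! ((hy.tendsto x₀).sub_const (y x₀)).norm
  have h2 := h1.add (((β.continuous_aut (y x₀)).comp hf).tendsto x₀)
  simpa [ContinuousAt] using! h2

variable {α : CStarAction G A} {β : CStarAction G B}

namespace CocycleRep

/-- Strict continuity becomes joint norm continuity on B because the cocycle takes values in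
contractions. -/
theorem continuous_coc_fst (ρ : CocycleRep α β) {y : G → B} (hy : Continuous y) :
    Continuous fun g => (ρ.coc g : 𝓜(ℂ, B)).fst (y g) := by
  refine continuous_iff_continuousAt.2 fun g₀ => ?_
  have h1 : Tendsto (fun g => (ρ.coc g : 𝓜(ℂ, B)).fst (y g - y g₀)) (𝓝 g₀) (𝓝 0) := by
    refine squeeze_zero_norm (a := fun g => ‖y g - y g₀‖) (fun g => ?_) ?_
    · refine (ContinuousLinearMap.le_opNorm _ _).trans ?_
      rw [DoubleCentralizer.norm_fst]
      exact mul_le_of_le_one_left (norm_nonneg _) (norm_unitary_le _)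
    · simpa using! ((hy.tendsto g₀).sub_const (y g₀)).norm
  have h2 := h1.add (ρ.continuous_coc g₀ (y g₀)).1
  simpa [ContinuousAt] using! h2

theorem continuous_coc_snd (ρ : CocycleRep α β) {y : G → B} (hy : Continuous y) :
    Continuous fun g => (ρ.coc g : 𝓜(ℂ, B)).snd (y g) := by
  refine continuous_iff_continuousAt.2 fun g₀ => ?_
  have h1 : Tendsto (fun g => (ρ.coc g : 𝓜(ℂ, B)).snd (y g - y g₀)) (𝓝 g₀) (𝓝 0) := by
    refine squeeze_zero_norm (a := fun g => ‖y g - y g₀‖) (fun g => ?_) ?_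
    · refine (ContinuousLinearMap.le_opNorm _ _).trans ?_
      rw [DoubleCentralizer.norm_snd]
      exact mul_le_of_le_one_left (norm_nonneg _) (norm_unitary_le _)
    · simpa using! ((hy.tendsto g₀).sub_const (y g₀)).norm
  have h2 := h1.add (ρ.continuous_coc g₀ (y g₀)).2
  simpa [ContinuousAt] using! h2

theorem coc_one (ρ : CocycleRep α β) : (ρ.coc 1 : 𝓜(ℂ, B)) = 1 := by
  have h := ρ.coc_mul 1 1
  have h1 : β.mul 1 (ρ.coc 1 : 𝓜(ℂ, B)) = ρ.coc 1 := by
    unfold CStarAction.mul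
    rw [map_one]
    rfl
  rw [one_mul, h1] at h
  have h2 := congrArg (fun m => star (ρ.coc 1 : 𝓜(ℂ, B)) * m) h
  simpa [← mul_assoc] using h2.symm

/-- The automorphisms of `B` indexed by the elements of `A` (acting trivially) and of `G`. -/
def indexAut (β : CStarAction G B) : A ⊕ G → (B ≃⋆ₐ[ℂ] B) :=
  Sum.elim (fun _ => StarAlgEquiv.refl ℂ B) β.aut

/-- The multipliers `φ(a)` and `u_g` of a cocycle representation as one family. -/
def indexMul (ρ : CocycleRep α β) : A ⊕ G → 𝓜(ℂ, B) :=
  Sum.elim ρ.hom (fun g => (ρ.coc g : 𝓜(ℂ, B)))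

theorem norm_hom_le (ρ : CocycleRep α β) (a : A) : ‖ρ.hom a‖ ≤ ‖a‖ :=
  NonUnitalStarAlgHom.norm_apply_le ρ.hom a

/-- The part from A is finite. On G the multipliers are only ever applied to elements of B, where
strict continuity gives norm continuity, so compact sets K have compact images. -/
theorem quasiCompact_index [IsTopologicalGroup G] (ρ : CocycleRep α β) {F : Set A} (hF : F.Finite)
    {K : Set G} (hK : IsCompact K) :
    QuasiCompact (indexAut β) ρ.indexMul (Sum.inl '' F ∪ Sum.inr '' K) := by
  have key : ∀ f : A ⊕ G → B, Continuous (fun g => f (Sum.inr g)) →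
      TotallyBounded (f '' (Sum.inl '' F ∪ Sum.inr '' K)) := by
    intro f hf
    rw [Set.image_union, Set.image_image, Set.image_image]
    exact (hF.image _).totallyBounded.union (hK.image hf).totallyBounded
  refine ⟨?_, fun e => key _ ?_, fun e => key _ ?_, fun e => key _ ?_⟩
  · obtain ⟨C, hC⟩ := (hF.image fun a => ‖ρ.hom a‖).bddAbove
    refine ⟨max C 1, ?_⟩
    rintro _ (⟨a, ha, rfl⟩ | ⟨g, hg, rfl⟩)
    · exact (hC ⟨a, ha, rfl⟩).trans (le_max_left _ _)
    · exact (norm_unitary_le (ρ.coc g)).trans (le_max_right _ _)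
  · have h := (ρ.continuous_coc_fst (β.continuous_aut (star e))).star
    refine h.congr fun g => ?_
    simp [indexAut, indexMul, map_star]
  -- Unitarity of the cocycle collapses this orbit to the single point e.
  · refine continuous_const (y := e) |>.congr fun g => ?_
    have h : emb (β.aut g e) * star (ρ.coc g : 𝓜(ℂ, B)) * (ρ.coc g : 𝓜(ℂ, B))
        = emb (β.aut g e) := by
      rw [mul_assoc, Unitary.coe_star_mul_self, mul_one]
    rw [emb_mul, emb_mul] at h
    change e = (β.aut g).symm ((ρ.coc g : 𝓜(ℂ, B)).snd ((star (ρ.coc g : 𝓜(ℂ, B))).snd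
      (β.aut g e)))
    rw [emb_injective h, StarAlgEquiv.symm_apply_apply]
  · have h1 := (ρ.continuous_coc_snd (continuous_const (y := star e))).star
    have h2 := β.continuous_aut_apply continuous_inv (ρ.continuous_coc_snd h1)
    refine h2.congr fun g => ?_
    rw [map_inv]
    rfl

/-- The family `ρ` contains the family `σ` in the sense of finite sums of compressions, uniformly on
finite subsets of `A` and compact subsets of `G`. -/
def FinitelyContained (σ ρ : CocycleRep α β) : Prop :=
  ∀ ⦃F : Set A⦄, F.Finite → ∀ ⦃K : Set G⦄, IsCompact K → ∀ (b : B) ⦃ε : ℝ⦄, 0 < ε → ‖b‖ ≤ 1 →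
    ∃ (N : ℕ) (c : ℕ → B), ∀ i ∈ Sum.inl '' F ∪ Sum.inr '' K,
      ‖star (emb b) * σ.indexMul i * multiplierExt (indexAut β i) (emb b)
        - ∑ k ∈ Finset.range N, star (emb (c k)) * ρ.indexMul i
            * multiplierExt (indexAut β i) (emb (c k))‖ ≤ ε

theorem exists_reindex {E : Type*} [AddCommMonoid E] {κ : Type*} [Fintype κ] (c : κ → B) :
    ∃ (N : ℕ) (c' : ℕ → B), ∀ f : B → E, ∑ k ∈ Finset.range N, f (c' k) = ∑ k, f (c k) := by
  classical
  let e := Fintype.equivFin κ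
  let c' : ℕ → B := fun k => if hk : k < Fintype.card κ then c (e.symm ⟨k, hk⟩) else 0
  refine ⟨Fintype.card κ, c', fun f => ?_⟩
  rw [Finset.sum_range, ← e.symm.sum_comp]
  refine Finset.sum_congr rfl fun k _ => ?_
  simp only [c', dif_pos k.2]

theorem WeaklyContained.finitelyContained {σ ρ : CocycleRep α β} (h : WeaklyContained σ ρ) :
    FinitelyContained σ ρ := by
  intro F hF K hK b ε hε hb
  obtain ⟨l, N, ρ', c, hρ', hcK, hcF⟩ := h K F ε b hK hF.isCompact hε hb
  -- All ρ' j coincide with ρ, so the double sum is one finite sum of compressions of ρ.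
  obtain ⟨N', c', hsum⟩ := exists_reindex (E := 𝓜(ℂ, B)) fun k : Fin l × Fin N => c k.1 k.2
  simp only [Fintype.sum_prod_type] at hsum
  have hemb : ∀ (m : 𝓜(ℂ, B)) (θ : B ≃⋆ₐ[ℂ] B) (b : B),
      star (emb b) * m * multiplierExt θ (emb b) = emb (star b * m.fst (θ b)) := by
    intro m θ b
    rw [multiplierExt_emb, mul_assoc, mul_emb, map_mul, map_star]
  refine ⟨N', c', ?_⟩
  rintro _ (⟨a, ha, rfl⟩ | ⟨g, hg, rfl⟩)
  · rw [hsum (fun b => star (emb b) * ρ.indexMul (Sum.inl a)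
      * multiplierExt (indexAut β (Sum.inl a)) (emb b))]
    simp only [hemb, ← map_sum, ← map_sub, norm_emb]
    have h1 := hcF a ha
    simp only [fun j => Set.mem_singleton_iff.1 (hρ' j)] at h1
    exact h1
  · rw [hsum (fun b => star (emb b) * ρ.indexMul (Sum.inr g)
      * multiplierExt (indexAut β (Sum.inr g)) (emb b))]
    simp only [hemb, ← map_sum, ← map_sub, norm_emb]
    have h1 := hcK g hg
    simp only [fun j => Set.mem_singleton_iff.1 (hρ' j)] at h1
    exact h1

/-- An isometry in `𝓜(B)` which intertwines `σ` and `ρ` modulo `B`, and up to `ε` on `F` and `K`. -/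
structure IsIntertwiner (ρ σ : CocycleRep α β) (F : Set A) (K : Set G) (ε : ℝ)
    (S : 𝓜(ℂ, B)) : Prop where
  isometry : star S * S = 1
  hom_mem : ∀ a, MemBase (ρ.hom a * S - S * σ.hom a)
  coc_mem : ∀ g, MemBase ((ρ.coc g : 𝓜(ℂ, B)) * β.mul g S - S * (σ.coc g : 𝓜(ℂ, B)))
  hom_le : ∀ a ∈ F, ‖ρ.hom a * S - S * σ.hom a‖ ≤ ε
  coc_le : ∀ g ∈ K, ‖(ρ.coc g : 𝓜(ℂ, B)) * β.mul g S - S * (σ.coc g : 𝓜(ℂ, B))‖ ≤ ε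

/-- If `σ` is contained in `ρ`, there are isometries intertwining `σ` with the infinite
repeat of `ρ`. -/
theorem FinitelyContained.exists_isIntertwiner [IsTopologicalGroup G] [LocallyCompactSpace G]
    [SecondCountableTopology G] [TopologicalSpace.SeparableSpace A] (hB : IsSigmaUnital B)
    {σ ρ : CocycleRep α β} (h : FinitelyContained σ ρ) (T : IsometrySequence β) {F : Set A}
    (hF : F.Finite) {K : Set G} (hK : IsCompact K) {ε : ℝ} (hε : 0 < ε) :
    ∃ S, IsIntertwiner (ρ.infiniteRepeat T) σ F K ε S := by
  -- The products a⋆a are needed because the square of the defect at a involves the compression at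
  -- a⋆a. The dense sequence, like the exhaustion of G below, gives membership in B for all a and g;
  -- the unit of G supplies the index i₀.
  let F' : ℕ → Set A := fun n =>
    F ∪ (fun a => star a * a) '' F ∪ TopologicalSpace.denseSeq A '' Set.Iio n
  let E : CompactExhaustion G := default
  let K' : ℕ → Set G := fun n => insert 1 K ∪ E n
  have hF' : ∀ n, (F' n).Finite := fun n =>
    (hF.union (hF.image _)).union ((Set.finite_Iio n).image _)
  have hK' : ∀ n, IsCompact (K' n) := fun n => (hK.insert 1).union (E.isCompact n)
  let J : ℕ → Set (A ⊕ G) := fun n => Sum.inl '' F' n ∪ Sum.inr '' K' n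
  have hJmono : Monotone J := by
    intro m n hmn
    refine Set.union_subset_union (Set.image_mono ?_) (Set.image_mono ?_)
    · exact Set.union_subset_union_right _ (Set.image_mono (Set.Iio_subset_Iio hmn))
    · exact Set.union_subset_union_right _ (E.subset hmn)
  have hT : ∀ (i : A ⊕ G) n, multiplierExt (indexAut β i) (T.t n) = T.t n := by
    rintro (a | g) n
    · rfl
    · exact T.fixed n g
  obtain ⟨CF, hCF⟩ := ((hF' 0).image norm).bddAbove
  set C := max CF 1 with hCdef
  have hC1 : 1 ≤ C := le_max_right _ _
  have hCF' : ∀ a ∈ F' 0, ‖a‖ ≤ C := fun a ha => (hCF ⟨a, ha, rfl⟩).trans (le_max_left _ _)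
  have hq : ∀ i ∈ J 0, ‖ρ.indexMul i‖ ≤ C := by
    rintro _ (⟨a, ha, rfl⟩ | ⟨g, hg, rfl⟩)
    · exact (ρ.norm_hom_le a).trans (hCF' a ha)
    · exact (norm_unitary_le (ρ.coc g)).trans hC1
  have h1J : (Sum.inr 1 : A ⊕ G) ∈ J 0 := Or.inr ⟨1, Or.inl (Set.mem_insert 1 K), rfl⟩
  obtain ⟨S, hSS, hS0, hSB⟩ := exists_isometric_compression hB T (θ := indexAut β)
    (p := σ.indexMul) (q := ρ.indexMul) hT
    (fun n => σ.quasiCompact_index (hF' n) (hK' n)) hJmono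
    (fun n b ε hε hb => h (hF' n) (hK' n) b hε hb)
    h1J (fun m => by
      change multiplierExt (β.aut 1) m = m
      rw [map_one]; rfl) σ.coc_one ρ.coc_one hq
    (ε := ε ^ 2 / (1 + 2 * C)) (by positivity)
  set δ := ε ^ 2 / (1 + 2 * C) with hδ
  -- The squared defect on F is at most δ + Cδ + δC. On K it is at most 2δ, which suffices since C ≥
  -- 1.
  have hδC : δ + 2 * C * δ = ε ^ 2 := by rw [hδ]; field_simp
  have hδ0 : 0 < δ := by positivity
  set ra : A → 𝓜(ℂ, B) := fun a => star S * (ρ.infiniteRepeat T).hom a * S - σ.hom a with hra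
  set rg : G → 𝓜(ℂ, B) := fun g => star S * ((ρ.infiniteRepeat T).coc g : 𝓜(ℂ, B)) * β.mul g S
    - σ.coc g with hrg
  have hra0 : ∀ a ∈ F' 0, ‖ra a‖ ≤ δ := fun a ha => hS0 (Sum.inl a) (Or.inl ⟨a, ha, rfl⟩)
  have hrg0 : ∀ g ∈ K' 0, ‖rg g‖ ≤ δ := fun g hg => hS0 (Sum.inr g) (Or.inr ⟨g, hg, rfl⟩)
  have hraB : ∀ a, MemBase (ra a) := by
    have hc : Continuous ra := by
      have h1 : Continuous (ρ.infiniteRepeat T).hom :=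
        AddMonoidHomClass.continuous_of_bound _ 1
          (by simpa using (ρ.infiniteRepeat T).norm_hom_le)
      have h2 : Continuous σ.hom :=
        AddMonoidHomClass.continuous_of_bound _ 1 (by simpa using σ.norm_hom_le)
      fun_prop
    intro a
    refine (isClosed_memBase.preimage hc).closure_subset_iff.2 ?_
      (TopologicalSpace.denseRange_denseSeq A a)
    rintro _ ⟨n, rfl⟩
    exact hSB (n + 1) (Sum.inl _) (Or.inl ⟨_, Or.inr ⟨n, Nat.lt_succ_self n, rfl⟩, rfl⟩)
  have hrgB : ∀ g, MemBase (rg g) := by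
    intro g
    obtain ⟨n, hn⟩ := E.exists_mem g
    exact hSB n (Sum.inr g) (Or.inr ⟨g, Or.inr hn, rfl⟩)
  -- Expanding the square with S⋆S = 1 leaves only compression defects, so no information on S S⋆ is
  -- required.
  have hda : ∀ a, star ((ρ.infiniteRepeat T).hom a * S - S * σ.hom a)
      * ((ρ.infiniteRepeat T).hom a * S - S * σ.hom a)
      = ra (star a * a) - star (σ.hom a) * ra a - star (ra a) * σ.hom a := by
    intro a
    simp only [hra, star_sub, star_mul, star_star, map_mul, map_star]
    set x := (ρ.infiniteRepeat T).hom a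
    set y := σ.hom a
    have h1 : star y * star S * S * y = star y * y := by rw [mul_assoc (star y), hSS, mul_one]
    calc _ = star S * star x * x * S - star S * star x * S * y - star y * star S * x * S
          + star y * star S * S * y := by noncomm_ring
      _ = _ := by rw [h1]; noncomm_ring
  -- Here the two square terms are exactly 1 by unitarity, so only the mixed terms contribute.
  have hdg : ∀ g, star (((ρ.infiniteRepeat T).coc g : 𝓜(ℂ, B)) * β.mul g S - S * σ.coc g)
      * (((ρ.infiniteRepeat T).coc g : 𝓜(ℂ, B)) * β.mul g S - S * σ.coc g)
      = - (star (σ.coc g : 𝓜(ℂ, B)) * rg g) - star (rg g) * σ.coc g := by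
    intro g
    simp only [hrg, star_sub, star_mul, star_star]
    have h2 : star (β.mul g S) * β.mul g S = 1 := by
      rw [← map_star, ← map_mul, hSS, map_one]
    have h3 := Unitary.coe_star_mul_self ((ρ.infiniteRepeat T).coc g)
    have h4 := Unitary.coe_star_mul_self (σ.coc g)
    set x := ((ρ.infiniteRepeat T).coc g : 𝓜(ℂ, B))
    set y := (σ.coc g : 𝓜(ℂ, B))
    set R := β.mul g S
    calc _ = star R * (star x * x) * R - star R * star x * S * y - star y * star S * x * R
          + star y * (star S * S) * y := by noncomm_ring
      _ = star y * y - star R * star x * S * y - star y * star S * x * R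
          + star y * y := by rw [h3, hSS, mul_one, mul_one, h2, h4]
      _ = _ := by noncomm_ring
  refine ⟨S, hSS, fun a => ?_, fun g => ?_, fun a ha => ?_, fun g hg => ?_⟩
  · refine memBase_of_star_mul_self ?_
    rw [hda]
    exact ((hraB _).sub ((hraB a).mul_left _)).sub ((hraB a).star.mul_right _)
  · refine memBase_of_star_mul_self ?_
    rw [hdg]
    exact ((hrgB g).mul_left _).neg.sub ((hrgB g).star.mul_right _)
  · refine le_of_sq_le_sq ?_ hε.le
    rw [sq, ← CStarRing.norm_star_mul_self, hda]
    have hσ : ‖σ.hom a‖ ≤ C := (σ.norm_hom_le a).trans (hCF' a (Or.inl (Or.inl ha)))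
    have n1 := hra0 (star a * a) (Or.inl (Or.inr ⟨a, ha, rfl⟩))
    have n0 := hra0 a (Or.inl (Or.inl ha))
    have n2 : ‖star (σ.hom a) * ra a‖ ≤ C * δ := by
      refine (norm_mul_le _ _).trans ?_
      rw [norm_star]
      gcongr
    have n3 : ‖star (ra a) * σ.hom a‖ ≤ δ * C := by
      refine (norm_mul_le _ _).trans ?_
      rw [norm_star]
      gcongr
    have n4 := norm_sub_le (ra (star a * a) - star (σ.hom a) * ra a) (star (ra a) * σ.hom a)
    have n5 := norm_sub_le (ra (star a * a)) (star (σ.hom a) * ra a)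
    linarith
  · refine le_of_sq_le_sq ?_ hε.le
    rw [sq, ← CStarRing.norm_star_mul_self, hdg]
    have hσ : ‖(σ.coc g : 𝓜(ℂ, B))‖ ≤ 1 := norm_unitary_le _
    have n0 := hrg0 g (Or.inl (Set.mem_insert_of_mem _ hg))
    have n2 : ‖star (σ.coc g : 𝓜(ℂ, B)) * rg g‖ ≤ 1 * δ := by
      refine (norm_mul_le _ _).trans ?_
      rw [norm_star]
      gcongr
    have n3 : ‖star (rg g) * σ.coc g‖ ≤ δ * 1 := by
      refine (norm_mul_le _ _).trans ?_
      rw [norm_star]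
      gcongr
    have n4 := norm_sub_le (-(star (σ.coc g : 𝓜(ℂ, B)) * rg g)) (star (rg g) * σ.coc g)
    rw [norm_neg] at n4
    nlinarith

end CocycleRep

end Actions

end

noncomputable section

/-! ### Shifts between isometry sequences -/

section Shifts

variable {G B : Type*} [Group G] [TopologicalSpace G] [NonUnitalCStarAlgebra B]
  {β : CStarAction G B}

namespace IsometrySequence

variable (T T' : IsometrySequence β)

/-- Since ∑ t n (t n)⋆ = 1 strictly, a multiplier is determined by its columns. The identities for
shifts below are checked on columns or matrix entries. -/
theorem ext_mul_t {x y : 𝓜(ℂ, B)} (h : ∀ n, x * T.t n = y * T.t n) : x = y := by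
  have h1 := T.sum_eq_one.const_mul x
  have h2 := T.sum_eq_one.const_mul y
  rw [mul_one] at h1 h2
  refine h1.unique (h2.congr fun N => ?_)
  simp only [Finset.mul_sum, ← mul_assoc, h]

theorem ext_star_t_mul {x y : 𝓜(ℂ, B)} (h : ∀ n, star (T.t n) * x = star (T.t n) * y) :
    x = y := by
  refine star_injective (T.ext_mul_t fun n => ?_)
  simpa using congrArg star (h n)

theorem norm_sum_le_one {ι : Type*} (s : Finset ι) {f g : ι → ℕ} (hf : Set.InjOn f s)
    (hg : Set.InjOn g s) : ‖∑ k ∈ s, T'.t (f k) * star (T.t (g k))‖ ≤ 1 := by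
  classical
  have h1 : star (∑ k ∈ s, T'.t (f k) * star (T.t (g k))) * ∑ k ∈ s, T'.t (f k) * star (T.t (g k))
      = T.partialSum (s.image g) 1 := by
    rw [star_sum, Finset.sum_mul, T.partialSum_apply, Finset.sum_image hg]
    refine Finset.sum_congr rfl fun k hk => ?_
    rw [Finset.mul_sum, Finset.sum_eq_single k]
    · rw [star_mul, star_star, mul_assoc, ← mul_assoc (star (T'.t _)), T'.isometry, one_mul,
        mul_one]
    · intro l hl hlk
      rw [star_mul, star_star, mul_assoc, ← mul_assoc (star (T'.t _)),
        T'.orth fun h => hlk (hf hl hk h.symm), zero_mul, mul_zero]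
    · exact fun h => absurd hk h
  refine le_of_sq_le_sq ?_ zero_le_one
  rw [sq, ← CStarRing.norm_star_mul_self, h1, one_pow]
  exact (NonUnitalStarAlgHom.norm_apply_le (T.partialSum _) 1).trans (norm_unitary_le 1)

/-- The multiplier is V = ∑ t' (f k) (t k)⋆. Multiplied into B from the left, its blocks are
controlled by the range projections of T; from the right, by those of T'. Monotonicity of f places
the block [M, N) inside [f M, f N), which yields the second control. -/
theorem exists_shift {f : ℕ → ℕ} (hf : StrictMono f) :
    ∃ V : 𝓜(ℂ, B), ∀ n, V * T.t n = T'.t (f n) := by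
  set Y : ℕ → 𝓜(ℂ, B) := fun N => ∑ k ∈ Finset.range N, T'.t (f k) * star (T.t k) with hY
  have hYsub : ∀ M N, M ≤ N → Y N - Y M = ∑ k ∈ Finset.Ico M N, T'.t (f k) * star (T.t k) :=
    fun M N hMN => (Finset.sum_Ico_eq_sub _ hMN).symm
  have hY1 : ∀ M N, M ≤ N → ‖Y N - Y M‖ ≤ 1 := by
    intro M N hMN
    rw [hYsub M N hMN]
    exact T.norm_sum_le_one T' _ hf.injective.injOn Function.injective_id.injOn
  have hP1 : ∀ (T : IsometrySequence β) (s : Finset ℕ), ‖T.partialSum s 1‖ ≤ 1 := fun T s =>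
    (NonUnitalStarAlgHom.norm_apply_le (T.partialSum _) 1).trans (norm_unitary_le 1)
  obtain ⟨V, hV⟩ : ∃ V, StrictTendsto Y atTop V := by
    refine exists_strictTendsto (fun a => ?_) (fun a => ?_)
    · refine cauchySeq_of_sq_norm_sub_le (C := ‖a‖)
        (v := fun N => T.partialSum (Finset.range N) 1 * emb a) (σ := fun _ => 0)
        (fun M N hMN => ?_) ?_ tendsto_const_nhds.cauchySeq
      · rw [← sub_apply, ← DoubleCentralizer.sub_fst, ← norm_emb, ← mul_emb, ← sub_mul,
          T.partialSum_sub hMN, sub_self, add_zero]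
        have h1 : Y N - Y M = (Y N - Y M) * T.partialSum (Finset.Ico M N) 1 := by
          rw [hYsub M N hMN, Finset.sum_mul]
          refine Finset.sum_congr rfl fun k hk => ?_
          rw [T.partialSum_apply, Finset.mul_sum, Finset.sum_eq_single k]
          · rw [mul_one, mul_assoc, ← mul_assoc (star _), T.isometry, one_mul]
          · intro j _ hj
            rw [mul_one, mul_assoc, ← mul_assoc (star _), T.orth hj.symm, zero_mul, mul_zero]
          · exact fun h => absurd hk h
        set Q := T.partialSum (Finset.Ico M N) 1
        have h2 : ‖(Y N - Y M) * emb a‖ ≤ ‖Q * emb a‖ := by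
          rw [h1, mul_assoc]
          exact (norm_mul_le _ _).trans (mul_le_of_le_one_left (norm_nonneg _) (hY1 M N hMN))
        have h3 : ‖(Y N - Y M) * emb a‖ ≤ ‖a‖ := by
          refine (norm_mul_le _ _).trans ?_
          rw [norm_emb]
          exact mul_le_of_le_one_left (norm_nonneg _) (hY1 M N hMN)
        rw [sq]
        gcongr
      · exact ((strictTendsto_iff.1 T.strictTendsto_partialSum_one a).1).cauchySeq
    · refine cauchySeq_of_sq_norm_sub_le (C := ‖a‖)
        (v := fun N => emb a * T'.partialSum (Finset.range (f N)) 1) (σ := fun _ => 0)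
        (fun M N hMN => ?_) ?_ tendsto_const_nhds.cauchySeq
      · rw [← sub_apply, ← DoubleCentralizer.sub_snd, ← norm_emb, ← emb_mul, ← mul_sub,
          T'.partialSum_sub (hf.monotone hMN), sub_self, add_zero]
        have h1 : Y N - Y M = T'.partialSum (Finset.Ico (f M) (f N)) 1 * (Y N - Y M) := by
          rw [hYsub M N hMN, Finset.mul_sum]
          refine Finset.sum_congr rfl fun k hk => ?_
          rw [Finset.mem_Ico] at hk
          have hk' : f k ∈ Finset.Ico (f M) (f N) :=
            Finset.mem_Ico.2 ⟨hf.monotone hk.1, hf hk.2⟩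
          rw [T'.partialSum_apply, Finset.sum_mul, Finset.sum_eq_single (f k)]
          · rw [mul_one, mul_assoc, ← mul_assoc (star _), T'.isometry, one_mul]
          · intro j _ hj
            rw [mul_one, mul_assoc, ← mul_assoc (star _), T'.orth hj, zero_mul, mul_zero]
          · exact fun h => absurd hk' h
        set Q := T'.partialSum (Finset.Ico (f M) (f N)) 1
        have h2 : ‖emb a * (Y N - Y M)‖ ≤ ‖emb a * Q‖ := by
          rw [h1, ← mul_assoc]
          exact (norm_mul_le _ _).trans (mul_le_of_le_one_right (norm_nonneg _) (hY1 M N hMN))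
        have h3 : ‖emb a * (Y N - Y M)‖ ≤ ‖a‖ := by
          refine (norm_mul_le _ _).trans ?_
          rw [norm_emb]
          exact mul_le_of_le_one_right (norm_nonneg _) (hY1 M N hMN)
        rw [sq]
        gcongr
      · have h1 := ((strictTendsto_iff.1 T'.strictTendsto_partialSum_one a).2).cauchySeq
        exact h1.comp_tendsto hf.tendsto_atTop
  refine ⟨V, fun n => (hV.mul_const (T.t n)).unique (StrictTendsto.of_tendsto
    (tendsto_const_nhds.congr' ?_))⟩
  filter_upwards [eventually_gt_atTop n] with N hN
  rw [hY, Finset.sum_mul]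
  simp only [mul_assoc, T.star_mul_eq_ite, mul_ite, mul_one, mul_zero]
  rw [Finset.sum_ite_eq', if_pos (Finset.mem_range.2 hN)]

variable {T T'}

theorem star_mul_self_of_shift {f : ℕ → ℕ} (hf : f.Injective) {V : 𝓜(ℂ, B)}
    (hV : ∀ n, V * T.t n = T'.t (f n)) : star V * V = 1 := by
  refine T.ext_star_t_mul fun m => T.ext_mul_t fun n => ?_
  have h1 : star (T.t m) * (star V * V) * T.t n = star (V * T.t m) * (V * T.t n) := by
    rw [star_mul]; noncomm_ring
  rw [h1, hV, hV, mul_one, T.star_mul_eq_ite, T'.star_mul_eq_ite]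
  simp only [hf.eq_iff]

theorem star_mul_eq_zero_of_shift {f g : ℕ → ℕ} (hfg : ∀ m n, f m ≠ g n) {V W : 𝓜(ℂ, B)}
    (hV : ∀ n, V * T.t n = T'.t (f n)) (hW : ∀ n, W * T.t n = T'.t (g n)) : star V * W = 0 := by
  refine T.ext_star_t_mul fun m => T.ext_mul_t fun n => ?_
  have h1 : star (T.t m) * (star V * W) * T.t n = star (V * T.t m) * (W * T.t n) := by
    rw [star_mul]; noncomm_ring
  rw [h1, hV, hW, T'.orth (hfg m n), mul_zero, zero_mul]

theorem fixed_of_shift {f : ℕ → ℕ} {V : 𝓜(ℂ, B)} (hV : ∀ n, V * T.t n = T'.t (f n)) (g : G) :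
    β.mul g V = V := by
  refine T.ext_mul_t fun n => ?_
  rw [hV, ← T'.fixed (f n) g, ← hV, map_mul, T.fixed]

/-- The infinite sum has the same entry x at every diagonal position, so moving positions by f does
not affect it: both sides send t n to t' (f n) x. -/
theorem shift_mul_infiniteSum {f : ℕ → ℕ} {V : 𝓜(ℂ, B)} (hV : ∀ n, V * T.t n = T'.t (f n))
    (x : 𝓜(ℂ, B)) : V * T.infiniteSum x = T'.infiniteSum x * V := by
  refine T.ext_mul_t fun n => ?_
  rw [mul_assoc, T.infiniteSum_mul_t, ← mul_assoc, hV, mul_assoc, hV, T'.infiniteSum_mul_t]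

variable (T T')

/-- An invariant unitary conjugating the infinite sums over `T` to those over `T'`. -/
theorem exists_unitary_shift : ∃ U : 𝓜(ℂ, B), star U * U = 1 ∧ U * star U = 1 ∧
    (∀ g, β.mul g U = U) ∧ ∀ x, U * T.infiniteSum x = T'.infiniteSum x * U := by
  obtain ⟨U, hU⟩ := T.exists_shift T' strictMono_id
  refine ⟨U, star_mul_self_of_shift Function.injective_id hU, ?_, fixed_of_shift hU,
    shift_mul_infiniteSum hU⟩
  refine T'.ext_mul_t fun n => ?_
  have h1 := star_mul_self_of_shift Function.injective_id hU
  have h2 : T'.t n = U * T.t n := (hU n).symm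
  rw [h2, mul_assoc, ← mul_assoc (star U), h1, one_mul, one_mul]

/-- A pair of invariant isometries commuting with all infinite sums over `T`. -/
theorem exists_cuntz_shift : ∃ s : CuntzIsometries β,
    (∀ x, s.r₁ * T.infiniteSum x = T.infiniteSum x * s.r₁) ∧
    ∀ x, s.r₂ * T.infiniteSum x = T.infiniteSum x * s.r₂ := by
  -- The shifts onto even and odd positions have orthogonal ranges that together exhaust all
  -- positions.
  obtain ⟨V, hV⟩ := T.exists_shift T (f := fun n => 2 * n) fun m n h => by
    change 2 * m < 2 * n; omega
  obtain ⟨W, hW⟩ := T.exists_shift T (f := fun n => 2 * n + 1) fun m n h => by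
    change 2 * m + 1 < 2 * n + 1; omega
  have hVV : star V * V = 1 := star_mul_self_of_shift (fun m n h => by simpa using h) hV
  have hWW : star W * W = 1 := star_mul_self_of_shift (fun m n h => by simpa using h) hW
  have hVW : star V * W = 0 :=
    star_mul_eq_zero_of_shift (fun m n => show 2 * m ≠ 2 * n + 1 by omega) hV hW
  have hWV : star W * V = 0 :=
    star_mul_eq_zero_of_shift (fun m n => show 2 * m + 1 ≠ 2 * n by omega) hW hV
  refine ⟨⟨V, W, hVV, hWW, fixed_of_shift hV, fixed_of_shift hW, T.ext_mul_t fun n => ?_⟩,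
    shift_mul_infiniteSum hV, shift_mul_infiniteSum hW⟩
  obtain ⟨k, rfl | rfl⟩ := n.even_or_odd'
  · rw [← hV k, add_mul]
    have h1 : V * star V * (V * T.t k) = V * (star V * V) * T.t k := by noncomm_ring
    have h2 : W * star W * (V * T.t k) = W * (star W * V) * T.t k := by noncomm_ring
    rw [h1, h2, hVV, hWV]
    simp
  · rw [← hW k, add_mul]
    have h1 : V * star V * (W * T.t k) = V * (star V * W) * T.t k := by noncomm_ring
    have h2 : W * star W * (W * T.t k) = W * (star W * W) * T.t k := by noncomm_ring
    rw [h1, h2, hVW, hWW]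
    simp

/-- Truncation of compressions of infinite sums. -/
theorem norm_compression_sub_le (θ : B ≃⋆ₐ[ℂ] B) (hθ : ∀ n, multiplierExt θ (T.t n) = T.t n)
    (x : 𝓜(ℂ, B)) (b : B) (M : ℕ) :
    ‖star (emb b) * T.infiniteSum x * multiplierExt θ (emb b)
      - ∑ n ∈ Finset.range M, star (emb ((star (T.t n)).fst b)) * x
          * multiplierExt θ (emb ((star (T.t n)).fst b))‖
      ≤ ‖x‖ * ‖star b - (T.partialSum (Finset.range M) 1).snd (star b)‖ * ‖b‖ := by
  have h1 : ∑ n ∈ Finset.range M, star (emb ((star (T.t n)).fst b)) * x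
          * multiplierExt θ (emb ((star (T.t n)).fst b))
      = star (emb b) * T.partialSum (Finset.range M) x * multiplierExt θ (emb b) := by
    rw [T.partialSum_apply, Finset.mul_sum, Finset.sum_mul]
    refine Finset.sum_congr rfl fun n _ => ?_
    rw [← mul_emb, star_mul, star_star, map_mul, map_star, hθ]
    noncomm_ring
  rw [h1, ← sub_mul, ← map_star, emb_mul, emb_mul, ← map_sub]
  refine (norm_mul_le _ _).trans ?_
  rw [norm_emb]
  gcongr
  · exact T.norm_infiniteSum_snd_sub_le M x (star b)
  · exact (norm_multiplierExt_le _ _).trans (norm_emb b).le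

theorem tendsto_truncation (b : B) :
    Tendsto (fun M => ‖star b - (T.partialSum (Finset.range M) 1).snd (star b)‖) atTop (𝓝 0) := by
  have h := (((T.strictTendsto_partialSum_one (star b)).2).const_sub (star b)).norm
  simpa using h

theorem norm_star_t_fst_le (n : ℕ) (b : B) : ‖(star (T.t n)).fst b‖ ≤ ‖b‖ := by
  rw [← norm_emb, ← mul_emb]
  refine (norm_mul_le _ _).trans ?_
  rw [norm_emb]
  refine mul_le_of_le_one_left (norm_nonneg _) (le_of_sq_le_sq ?_ zero_le_one)
  rw [norm_star, sq, ← CStarRing.norm_star_mul_self, T.isometry, one_pow]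
  exact norm_unitary_le 1

end IsometrySequence

end Shifts

/-! ### Weak containment of infinite repeats -/

section Repeat

variable {G A B : Type*} [Group G] [TopologicalSpace G]
  [NonUnitalCStarAlgebra A] [NonUnitalCStarAlgebra B] {α : CStarAction G A} {β : CStarAction G B}

namespace CocycleRep

theorem indexAut_fixes {A : Type*} (T : IsometrySequence β) (i : A ⊕ G) (n : ℕ) :
    multiplierExt (indexAut β i) (T.t n) = T.t n := by
  rcases i with a | g
  · rfl
  · exact T.fixed n g

theorem indexMul_infiniteRepeat (T : IsometrySequence β) (ρ : CocycleRep α β) (i : A ⊕ G) :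
    (ρ.infiniteRepeat T).indexMul i = T.infiniteSum (ρ.indexMul i) := by
  rcases i with a | g <;> rfl

/-- Compressing x^∞ by b is, up to truncation, the sum over n < M of the compressions of x by (t n)⋆
b. Each of these is approximated by hypothesis, so finite sums of compressions suffice for the
repeat. -/
theorem FinitelyContained.infiniteRepeat {σ ρ : CocycleRep α β} (h : FinitelyContained σ ρ)
    (T : IsometrySequence β) : FinitelyContained (σ.infiniteRepeat T) ρ := by
  intro F hF K hK b ε hε hb
  obtain ⟨C', hC'⟩ := (hF.image fun a => ‖σ.hom a‖).bddAbove
  set C := max C' 1 with hCdef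
  have hC0 : 0 < C := zero_lt_one.trans_le (le_max_right _ _)
  have hC : ∀ i ∈ Sum.inl '' F ∪ Sum.inr '' K, ‖σ.indexMul i‖ ≤ C := by
    rintro _ (⟨a, ha, rfl⟩ | ⟨g, hg, rfl⟩)
    · exact (hC' ⟨a, ha, rfl⟩).trans (le_max_left _ _)
    · exact (norm_unitary_le (σ.coc g)).trans (le_max_right _ _)
  obtain ⟨M, hM⟩ := ((T.tendsto_truncation b).eventually_lt_const
    (show 0 < ε / 2 / C by positivity)).exists
  rw [lt_div_iff₀ hC0] at hM
  -- The error ε/2 is shared among M terms; M + 1 avoids division by zero.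
  choose N c hc using fun n => h hF hK ((star (T.t n)).fst b)
    (show 0 < ε / 2 / (M + 1 : ℝ) by positivity) ((T.norm_star_t_fst_le n b).trans hb)
  obtain ⟨N', c', hsum⟩ := exists_reindex (E := 𝓜(ℂ, B))
    fun k : (Σ n : Fin M, Fin (N n)) => c k.1 k.2
  have hsum' : ∀ f : B → 𝓜(ℂ, B), ∑ k ∈ Finset.range N', f (c' k)
      = ∑ n ∈ Finset.range M, ∑ k ∈ Finset.range (N n), f (c n k) := by
    intro f
    rw [hsum, Fintype.sum_sigma, Finset.sum_range]
    simp only [Finset.sum_range]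
  refine ⟨N', c', fun i hi => ?_⟩
  rw [hsum' (fun b => star (emb b) * ρ.indexMul i * multiplierExt (indexAut β i) (emb b)),
    indexMul_infiniteRepeat]
  have h1 := T.norm_compression_sub_le (indexAut β i) (indexAut_fixes T i) (σ.indexMul i) b M
  have h2 : ‖σ.indexMul i‖ * ‖star b - (T.partialSum (Finset.range M) 1).snd (star b)‖ * ‖b‖
      ≤ ε / 2 := by
    calc _ ≤ C * ‖star b - (T.partialSum (Finset.range M) 1).snd (star b)‖ * 1 := by
          gcongr
          exact hC i hi
      _ ≤ ε / 2 := by linarith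
  have h3 : ‖∑ n ∈ Finset.range M, (star (emb ((star (T.t n)).fst b)) * σ.indexMul i
          * multiplierExt (indexAut β i) (emb ((star (T.t n)).fst b))
        - ∑ k ∈ Finset.range (N n), star (emb (c n k)) * ρ.indexMul i
          * multiplierExt (indexAut β i) (emb (c n k)))‖ ≤ ε / 2 := by
    refine (norm_sum_le _ _).trans ((Finset.sum_le_sum fun n _ => hc n i hi).trans ?_)
    rw [Finset.sum_const, Finset.card_range, nsmul_eq_mul, mul_div_assoc', div_le_iff₀ (by positivity)]
    nlinarith
  rw [Finset.sum_sub_distrib] at h3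
  refine (norm_sub_le_norm_sub_add_norm_sub _ _ _).trans ((add_le_add (h1.trans h2) h3).trans ?_)
  linarith

end CocycleRep

end Repeat

end

noncomputable section

/-! ### Unitaries absorbing the range of an isometry -/

section Absorbing

variable {M : Type*} [CStarAlgebra M]

theorem CStarAlgebra.norm_le_one_of_isometry {S : M} (hS : star S * S = 1) : ‖S‖ ≤ 1 := by
  rcases subsingleton_or_nontrivial M with h | h
  · rw [Subsingleton.elim S 0, norm_zero]; exact zero_le_one
  · refine le_of_sq_le_sq ?_ zero_le_one
    rw [sq, ← CStarRing.norm_star_mul_self, hS, one_pow, CStarRing.norm_one]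

/-- The unitary which moves the range of an isometry `S` out of the space, where `r₁, r₂` and
`s₁, s₂` are Cuntz pairs and `U` is a unitary. -/
def absorbingUnitary (r₁ r₂ s₁ s₂ U S : M) : M :=
  r₁ * star s₁ * star S + r₂ * U * (S * star s₂ * star S + (1 - S * star S))

variable {r₁ r₂ s₁ s₂ U S : M}

/-- The range of S splits into those of S s₁ and S s₂. The first is sent to the range of r₁, the
second is spread over the whole range of S, and the complement of that range is fixed; then r₂ U is
applied. Thus P is a coisometry whose initial projection is 1 - S s₁ s₁⋆ S⋆. -/
theorem absorbingUnitary_mul_star (hr : r₁ * star r₁ + r₂ * star r₂ = 1) (hs₁ : star s₁ * s₁ = 1)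
    (hs₂ : star s₂ * s₂ = 1) (hs₁₂ : star s₁ * s₂ = 0) (hU : U * star U = 1)
    (hS : star S * S = 1) :
    absorbingUnitary r₁ r₂ s₁ s₂ U S * star (absorbingUnitary r₁ r₂ s₁ s₂ U S) = 1 := by
  have hs₂₁ : star s₂ * s₁ = 0 := by simpa using congrArg star hs₁₂
  set P := S * star s₂ * star S + (1 - S * star S) with hP
  have hPs : star P = S * s₂ * star S + (1 - S * star S) := by
    simp [hP, mul_assoc]
  have h1 : star S * star P = s₂ * star S := by
    rw [hPs]
    calc _ = (star S * S) * s₂ * star S + star S - (star S * S) * star S := by noncomm_ring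
      _ = _ := by rw [hS]; noncomm_ring
  have h2 : P * S = S * star s₂ := by
    have := congrArg star h1
    simpa using this
  have h3 : P * star P = 1 := by
    conv_lhs => rw [hPs]
    calc _ = (P * S) * s₂ * star S + P - (P * S) * star S := by noncomm_ring
      _ = S * (star s₂ * s₂) * star S + P - S * star s₂ * star S := by rw [h2]; noncomm_ring
      _ = 1 := by rw [hs₂, hP]; noncomm_ring
  unfold absorbingUnitary
  rw [← hP]
  simp only [star_add, star_mul, star_star]
  calc _ = r₁ * star s₁ * (star S * S) * s₁ * star r₁
        + r₁ * star s₁ * (star S * star P) * star U * star r₂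
        + r₂ * U * (P * S) * s₁ * star r₁ + r₂ * U * (P * star P) * star U * star r₂ := by
          noncomm_ring
    _ = r₁ * (star s₁ * s₁) * star r₁ + r₁ * (star s₁ * s₂) * star S * star U * star r₂
        + r₂ * U * S * (star s₂ * s₁) * star r₁ + r₂ * (U * star U) * star r₂ := by
          rw [hS, h1, h2, h3]; noncomm_ring
    _ = 1 := by rw [hs₁, hs₁₂, hs₂₁, hU]; simpa using hr

theorem star_mul_absorbingUnitary (hr₁ : star r₁ * r₁ = 1) (hr₂ : star r₂ * r₂ = 1)
    (hr₁₂ : star r₁ * r₂ = 0) (hs : s₁ * star s₁ + s₂ * star s₂ = 1) (hU : star U * U = 1)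
    (hS : star S * S = 1) :
    star (absorbingUnitary r₁ r₂ s₁ s₂ U S) * absorbingUnitary r₁ r₂ s₁ s₂ U S = 1 := by
  have hr₂₁ : star r₂ * r₁ = 0 := by simpa using congrArg star hr₁₂
  set P := S * star s₂ * star S + (1 - S * star S) with hP
  have hPs : star P = S * s₂ * star S + (1 - S * star S) := by
    simp [hP, mul_assoc]
  have h1 : star S * P = star s₂ * star S := by
    rw [hP]
    calc _ = (star S * S) * star s₂ * star S + star S - (star S * S) * star S := by noncomm_ring
      _ = _ := by rw [hS]; noncomm_ring
  have h3 : star P * P = S * (s₂ * star s₂) * star S + (1 - S * star S) := by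
    rw [hPs]
    calc _ = S * s₂ * (star S * P) + P - S * (star S * P) := by noncomm_ring
      _ = _ := by rw [h1, hP]; noncomm_ring
  unfold absorbingUnitary
  rw [← hP]
  simp only [star_add, star_mul, star_star]
  calc _ = S * s₁ * (star r₁ * r₁) * star s₁ * star S
        + S * s₁ * (star r₁ * r₂) * U * P
        + star P * star U * (star r₂ * r₁) * star s₁ * star S
        + star P * (star U * ((star r₂ * r₂) * U)) * P := by noncomm_ring
    _ = S * (s₁ * star s₁) * star S + star P * P := by
        rw [hr₁, hr₁₂, hr₂₁, hr₂, one_mul, hU]; noncomm_ring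
    _ = S * (s₁ * star s₁ + s₂ * star s₂) * star S + (1 - S * star S) := by
        rw [h3]; noncomm_ring
    _ = 1 := by rw [hs]; noncomm_ring

/-- The defect of the absorbing unitary in terms of the defects `e` and `e'` of the isometry. -/
theorem absorbingUnitary_intertwine {p q q' R : M} (hr₁ : star r₁ * r₁ = 1)
    (hr₂ : star r₂ * r₂ = 1) (hr₁₂ : star r₁ * r₂ = 0)
    (hs₁' : star s₁ * p = p * star s₁)
    (hs₂' : star s₂ * p = p * star s₂) (hU : U * q = q' * U) :
    absorbingUnitary r₁ r₂ s₁ s₂ U S * q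
      - (r₁ * p * star r₁ + r₂ * q' * star r₂) * absorbingUnitary r₁ r₂ s₁ s₂ U R
      = r₁ * star s₁ * (star S * q - p * star R)
        + r₂ * U * (S * star s₂ * (star S * q - p * star R) - (q * R - S * p) * star s₂ * star R
          - S * (star S * q - p * star R) + (q * R - S * p) * star R) := by
  have hr₂₁ : star r₂ * r₁ = 0 := by simpa using congrArg star hr₁₂
  unfold absorbingUnitary
  have h1 : (r₁ * p * star r₁ + r₂ * q' * star r₂)
      * (r₁ * star s₁ * star R + r₂ * U * (R * star s₂ * star R + (1 - R * star R)))
      = r₁ * (star s₁ * p) * star R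
        + r₂ * (U * q) * (R * star s₂ * star R + (1 - R * star R)) := by
    calc _ = r₁ * p * (star r₁ * r₁) * star s₁ * star R
          + r₁ * p * (star r₁ * r₂) * U * (R * star s₂ * star R + (1 - R * star R))
          + r₂ * q' * (star r₂ * r₁) * star s₁ * star R
          + r₂ * q' * (star r₂ * r₂) * U * (R * star s₂ * star R + (1 - R * star R)) := by
            noncomm_ring
      _ = r₁ * (p * star s₁) * star R
          + r₂ * (q' * U) * (R * star s₂ * star R + (1 - R * star R)) := by
            rw [hr₁, hr₂, hr₁₂, hr₂₁]; noncomm_ring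
      _ = _ := by rw [hs₁', hU]
  rw [h1]
  have h2 : S * star s₂ * (star S * q - p * star R)
      = S * star s₂ * star S * q - S * (p * star s₂) * star R := by
    rw [← hs₂']; noncomm_ring
  rw [h2]
  noncomm_ring

/-- The adjoint defect occurs three times and the direct defect twice, with contractions as other
factors. Two isometries S and R are allowed because the cocycle relation compares S with β_g(S). -/
theorem norm_absorbingUnitary_intertwine_le {p q q' R : M} (hr₁ : star r₁ * r₁ = 1)
    (hr₂ : star r₂ * r₂ = 1) (hr₁₂ : star r₁ * r₂ = 0)
    (hs₁' : star s₁ * p = p * star s₁)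
    (hs₂' : star s₂ * p = p * star s₂) (hU : U * q = q' * U) (hs₁i : star s₁ * s₁ = 1)
    (hs₂i : star s₂ * s₂ = 1) (hUi : star U * U = 1) (hS : star S * S = 1) (hR : star R * R = 1) :
    ‖absorbingUnitary r₁ r₂ s₁ s₂ U S * q
      - (r₁ * p * star r₁ + r₂ * q' * star r₂) * absorbingUnitary r₁ r₂ s₁ s₂ U R‖
      ≤ 3 * ‖star S * q - p * star R‖ + 2 * ‖q * R - S * p‖ := by
  rw [absorbingUnitary_intertwine hr₁ hr₂ hr₁₂ hs₁' hs₂' hU]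
  set e' := star S * q - p * star R
  set e := q * R - S * p
  have n1 := CStarAlgebra.norm_le_one_of_isometry hr₁
  have n2 := CStarAlgebra.norm_le_one_of_isometry hr₂
  have n3 : ‖star s₁‖ ≤ 1 := by
    rw [norm_star]; exact CStarAlgebra.norm_le_one_of_isometry hs₁i
  have n4 : ‖star s₂‖ ≤ 1 := by
    rw [norm_star]; exact CStarAlgebra.norm_le_one_of_isometry hs₂i
  have n5 := CStarAlgebra.norm_le_one_of_isometry hUi
  have n6 := CStarAlgebra.norm_le_one_of_isometry hS
  have n7 : ‖star R‖ ≤ 1 := by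
    rw [norm_star]; exact CStarAlgebra.norm_le_one_of_isometry hR
  have hl : ∀ {x : M} (y : M), ‖x‖ ≤ 1 → ‖x * y‖ ≤ ‖y‖ := fun _ hx =>
    (norm_mul_le _ _).trans (mul_le_of_le_one_left (norm_nonneg _) hx)
  have hr : ∀ (x : M) {y : M}, ‖y‖ ≤ 1 → ‖x * y‖ ≤ ‖x‖ := fun x _ hy =>
    (norm_mul_le _ _).trans (mul_le_of_le_one_right (norm_nonneg _) hy)
  have m1 : ‖r₁ * star s₁ * e'‖ ≤ ‖e'‖ := hl _ ((hr _ n3).trans n1)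
  have m2 : ‖S * star s₂ * e'‖ ≤ ‖e'‖ := hl _ ((hr _ n4).trans n6)
  have m3 : ‖e * star s₂ * star R‖ ≤ ‖e‖ := (hr _ n7).trans (hr _ n4)
  have m4 : ‖S * e'‖ ≤ ‖e'‖ := hl _ n6
  have m5 : ‖e * star R‖ ≤ ‖e‖ := hr _ n7
  refine (norm_add_le _ _).trans ((add_le_add m1 ((hl _ ((hr _ n5).trans n2)).trans
    ((norm_add_le _ _).trans (add_le_add ((norm_sub_le _ _).trans (add_le_add
      ((norm_sub_le _ _).trans (add_le_add m2 m3)) m4)) m5)))).trans ?_)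
  linarith

end Absorbing

/-! ### Paths of isometries -/

section Path

/-- The coefficient functions of a piecewise path through a sequence of orthogonal isometries. -/
def tent (x : ℝ) : ℝ := √(max 0 (1 - |x|))

theorem continuous_tent : Continuous tent := by unfold tent; fun_prop

theorem tent_eq_zero {x : ℝ} (hx : 1 ≤ |x|) : tent x = 0 := by
  rw [tent, max_eq_left (by linarith), Real.sqrt_zero]

theorem tent_nonneg (x : ℝ) : 0 ≤ tent x := Real.sqrt_nonneg _

theorem tent_le_one (x : ℝ) : tent x ≤ 1 := by
  exact Real.sqrt_le_one.2 (max_le zero_le_one (by linarith [abs_nonneg x]))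

/-- This normalization makes the interpolation between two isometries with orthogonal ranges an
isometry; it is the reason for the square root in `tent`. -/
theorem tent_sq_add_sq {x : ℝ} (h0 : 0 ≤ x) (h1 : x ≤ 1) : tent x ^ 2 + tent (x - 1) ^ 2 = 1 := by
  rw [tent, tent, Real.sq_sqrt (le_max_left _ _), Real.sq_sqrt (le_max_left _ _), abs_of_nonneg h0,
    abs_of_nonpos (by linarith), max_eq_right (by linarith), max_eq_right (by linarith)]
  ring

variable {M : Type*} [CStarAlgebra M]

/-- The path through a sequence, moving from the `n`-th to the `n+1`-st term on `[n, n+1]`. -/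
def tentPath (R : ℕ → M) (t : ℝ) : M :=
  ∑ k ∈ Finset.range (⌊t⌋₊ + 2), (tent (t - k) : ℂ) • R k

/-- The added weights vanish, so near each point the path is a sum with a fixed number of continuous
terms, although the floor function jumps. -/
theorem tentPath_eq_sum (R : ℕ → M) {t : ℝ} {N : ℕ} (hN : ⌊t⌋₊ + 2 ≤ N) :
    tentPath R t = ∑ k ∈ Finset.range N, (tent (t - k) : ℂ) • R k := by
  refine Finset.sum_subset (Finset.range_mono hN) fun k _ hk => ?_
  rw [Finset.mem_range, not_lt] at hk
  have h1 := Nat.lt_floor_add_one t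
  have h2 : ((⌊t⌋₊ + 2 : ℕ) : ℝ) ≤ k := by exact_mod_cast hk
  push_cast at h2
  rw [tent_eq_zero, Complex.ofReal_zero, zero_smul]
  rw [abs_of_nonpos (by linarith)]
  linarith

theorem continuous_tentPath (R : ℕ → M) : Continuous (tentPath R) := by
  refine continuous_iff_continuousAt.2 fun t₀ => ?_
  have h1 : Continuous fun t : ℝ =>
      ∑ k ∈ Finset.range (⌊t₀ + 1⌋₊ + 2), (tent (t - k) : ℂ) • R k := by
    refine continuous_finsetSum _ fun k _ => ?_
    have := continuous_tent
    fun_prop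
  refine h1.continuousAt.congr ?_
  filter_upwards [Iio_mem_nhds (lt_add_one t₀)] with t ht
  refine (tentPath_eq_sum R ?_).symm
  have := Nat.floor_mono (le_of_lt (Set.mem_Iio.1 ht))
  omega

theorem tentPath_eq (R : ℕ → M) {t : ℝ} (ht : 0 ≤ t) :
    tentPath R t = (tent (t - ⌊t⌋₊) : ℂ) • R ⌊t⌋₊ + (tent (t - ⌊t⌋₊ - 1) : ℂ) • R (⌊t⌋₊ + 1) := by
  rw [tentPath, Finset.sum_range_succ, Finset.sum_range_succ, Finset.sum_eq_zero, zero_add]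
  · push_cast
    rw [sub_sub]
  · intro k hk
    rw [Finset.mem_range] at hk
    have h1 := Nat.floor_le ht
    have h2 : ((k + 1 : ℕ) : ℝ) ≤ ⌊t⌋₊ := by exact_mod_cast hk
    push_cast at h2
    rw [tent_eq_zero, Complex.ofReal_zero, zero_smul]
    rw [abs_of_nonneg (by linarith)]
    linarith

theorem star_tentPath_mul_self {R : ℕ → M} (hR : ∀ n, star (R n) * R n = 1)
    (hR' : ∀ n, star (R n) * R (n + 1) = 0) {t : ℝ} (ht : 0 ≤ t) :
    star (tentPath R t) * tentPath R t = 1 := by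
  have h1 : star (R (⌊t⌋₊ + 1)) * R ⌊t⌋₊ = 0 := by simpa using congrArg star (hR' ⌊t⌋₊)
  have h2 := tent_sq_add_sq (x := t - ⌊t⌋₊) (by linarith [Nat.floor_le ht])
    (by linarith [Nat.lt_floor_add_one t])
  rw [tentPath_eq R ht]
  simp only [star_add, star_smul, add_mul, mul_add, smul_mul_smul_comm, hR, hR', h1, smul_zero,
    add_zero, zero_add, ← add_smul]
  simp only [Complex.star_def, Complex.conj_ofReal]
  have h3 : (tent (t - ⌊t⌋₊) : ℂ) * tent (t - ⌊t⌋₊)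
      + (tent (t - ⌊t⌋₊ - 1) : ℂ) * tent (t - ⌊t⌋₊ - 1) = 1 := by
    rw [← sq, ← sq]
    exact_mod_cast h2
  rw [h3, one_smul]

end Path

end

noncomputable section

/-! ### Weak containment and asymptotic equivalence -/

section Equivalence

variable {G A B : Type*} [Group G] [TopologicalSpace G]
  [NonUnitalCStarAlgebra A] [NonUnitalCStarAlgebra B] {α : CStarAction G A} {β : CStarAction G B}

namespace CocycleRep

/-- An invariant V commuting with the repeat can be pulled out, so the defect of V S is V times that
of S. This moves intertwiners into prescribed ranges. -/
theorem IsIntertwiner.shift {φ σ : CocycleRep α β} {T : IsometrySequence β} {F : Set A} {K : Set G}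
    {ε : ℝ} {S V : 𝓜(ℂ, B)} (hS : IsIntertwiner (φ.infiniteRepeat T) σ F K ε S)
    (hV : star V * V = 1) (hVβ : ∀ g, β.mul g V = V)
    (hVT : ∀ x, V * T.infiniteSum x = T.infiniteSum x * V) :
    IsIntertwiner (φ.infiniteRepeat T) σ F K ε (V * S) := by
  have ha : ∀ a, (φ.infiniteRepeat T).hom a * (V * S) - V * S * σ.hom a
      = V * ((φ.infiniteRepeat T).hom a * S - S * σ.hom a) := by
    intro a
    have h : V * (φ.infiniteRepeat T).hom a = (φ.infiniteRepeat T).hom a * V := hVT _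
    rw [← mul_assoc, ← h]
    noncomm_ring
  have hg : ∀ g, ((φ.infiniteRepeat T).coc g : 𝓜(ℂ, B)) * β.mul g (V * S) - V * S * σ.coc g
      = V * (((φ.infiniteRepeat T).coc g : 𝓜(ℂ, B)) * β.mul g S - S * σ.coc g) := by
    intro g
    have h : V * ((φ.infiniteRepeat T).coc g : 𝓜(ℂ, B)) = (φ.infiniteRepeat T).coc g * V := hVT _
    rw [map_mul, hVβ, ← mul_assoc, ← h]
    noncomm_ring
  have hl : ∀ x, ‖V * x‖ ≤ ‖x‖ := fun x => (_root_.norm_mul_le _ _).trans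
    (mul_le_of_le_one_left (norm_nonneg _) (CStarAlgebra.norm_le_one_of_isometry hV))
  refine ⟨?_, fun a => ?_, fun g => ?_, fun a haF => ?_, fun g hgK => ?_⟩
  · rw [star_mul, mul_assoc, ← mul_assoc (star V), hV, one_mul, hS.isometry]
  · rw [ha]; exact (hS.hom_mem a).mul_left V
  · rw [hg]; exact (hS.coc_mem g).mul_left V
  · rw [ha]; exact (hl _).trans (hS.hom_le a haF)
  · rw [hg]; exact (hl _).trans (hS.coc_le g hgK)

/-- A path of isometries which intertwines two cocycle representations modulo `B` and
asymptotically. -/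
structure IsIntertwiningPath (ρ σ : CocycleRep α β) (R : ℝ → 𝓜(ℂ, B)) : Prop where
  continuous : Continuous R
  isometry : ∀ t, 0 ≤ t → star (R t) * R t = 1
  hom_mem : ∀ a t, 0 ≤ t → MemBase (ρ.hom a * R t - R t * σ.hom a)
  coc_mem : ∀ g t, 0 ≤ t → MemBase ((ρ.coc g : 𝓜(ℂ, B)) * β.mul g (R t) - R t * (σ.coc g : 𝓜(ℂ, B)))
  tendsto_hom : ∀ a, Tendsto (fun t => ‖ρ.hom a * R t - R t * σ.hom a‖) atTop (𝓝 0)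
  eventually_coc : ∀ K : Set G, IsCompact K → ∀ ε : ℝ, 0 < ε → ∀ᶠ t in atTop, ∀ g ∈ K,
    ‖(ρ.coc g : 𝓜(ℂ, B)) * β.mul g (R t) - R t * (σ.coc g : 𝓜(ℂ, B))‖ ≤ ε

/-- Intertwiners for growing finite sets and compact sets with tolerance 1/(n+1) are made orthogonal
to their neighbours and interpolated. The defect is linear in the isometry, so it stays in B and
tends to 0 along the path. -/
theorem FinitelyContained.exists_isIntertwiningPath [IsTopologicalGroup G] [LocallyCompactSpace G]
    [SecondCountableTopology G] [TopologicalSpace.SeparableSpace A] (hB : IsSigmaUnital B)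
    {σ φ : CocycleRep α β} (h : FinitelyContained σ φ) (T : IsometrySequence β) :
    ∃ R, IsIntertwiningPath (φ.infiniteRepeat T) σ R := by
  set ρ := φ.infiniteRepeat T with hρ
  let E : CompactExhaustion G := default
  let F : ℕ → Set A := fun n => TopologicalSpace.denseSeq A '' Set.Iio n
  have hF : ∀ n, (F n).Finite := fun n => (Set.finite_Iio n).image _
  have hFmono : Monotone F := fun m n hmn => Set.image_mono (Set.Iio_subset_Iio hmn)
  choose S hS using fun n : ℕ => h.exists_isIntertwiner hB T (hF n) (E.isCompact n)
    (ε := 1 / (n + 1 : ℝ)) (by positivity)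
  obtain ⟨s, hs₁, hs₂⟩ := T.exists_cuntz_shift
  -- Two ranges suffice, because the path only ever combines consecutive members.
  let V : ℕ → 𝓜(ℂ, B) := fun n => if Even n then s.r₁ else s.r₂
  have hR : ∀ n, IsIntertwiner ρ σ (F n) (E n) (1 / (n + 1 : ℝ)) (V n * S n) := by
    intro n
    by_cases hn : Even n
    · simp only [V, if_pos hn]
      exact (hS n).shift s.isometry₁ s.fixed₁ hs₁
    · simp only [V, if_neg hn]
      exact (hS n).shift s.isometry₂ s.fixed₂ hs₂
  have hR' : ∀ n, star (V n * S n) * (V (n + 1) * S (n + 1)) = 0 := by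
    intro n
    have hV : star (V n) * V (n + 1) = 0 := by
      by_cases hn : Even n
      · have hn' : ¬ Even (n + 1) := by simpa [Nat.even_add_one] using hn
        simp only [V, if_pos hn, if_neg hn', s.orth]
      · have hn' : Even (n + 1) := by simpa [Nat.even_add_one] using hn
        simp only [V, if_neg hn, if_pos hn', s.orth']
    rw [star_mul, mul_assoc, ← mul_assoc (star (V n)), hV, zero_mul, mul_zero]
  let R : ℕ → 𝓜(ℂ, B) := fun n => V n * S n
  have ha : ∀ a t, 0 ≤ t → ρ.hom a * tentPath R t - tentPath R t * σ.hom a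
      = (tent (t - ⌊t⌋₊) : ℂ) • (ρ.hom a * R ⌊t⌋₊ - R ⌊t⌋₊ * σ.hom a)
        + (tent (t - ⌊t⌋₊ - 1) : ℂ) • (ρ.hom a * R (⌊t⌋₊ + 1) - R (⌊t⌋₊ + 1) * σ.hom a) := by
    intro a t ht
    rw [tentPath_eq R ht]
    simp only [mul_add, add_mul, mul_smul_comm, smul_mul_assoc, smul_sub]
    abel
  have hg : ∀ g t, 0 ≤ t → (ρ.coc g : 𝓜(ℂ, B)) * β.mul g (tentPath R t) - tentPath R t * σ.coc g
      = (tent (t - ⌊t⌋₊) : ℂ) • ((ρ.coc g : 𝓜(ℂ, B)) * β.mul g (R ⌊t⌋₊) - R ⌊t⌋₊ * σ.coc g)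
        + (tent (t - ⌊t⌋₊ - 1) : ℂ) • ((ρ.coc g : 𝓜(ℂ, B)) * β.mul g (R (⌊t⌋₊ + 1))
          - R (⌊t⌋₊ + 1) * σ.coc g) := by
    intro g t ht
    rw [tentPath_eq R ht]
    simp only [map_add, map_smul, mul_add, add_mul, mul_smul_comm, smul_mul_assoc, smul_sub]
    abel
  have htent : ∀ (x : ℝ) (m : 𝓜(ℂ, B)), ‖(tent x : ℂ) • m‖ ≤ ‖m‖ := by
    intro x m
    rw [norm_smul, Complex.norm_real, Real.norm_of_nonneg (tent_nonneg x)]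
    exact mul_le_of_le_one_left (norm_nonneg _) (tent_le_one x)
  -- At each time at most two members contribute; the factor 2 accounts for both.
  have hsmall : ∀ ε : ℝ, 0 < ε → ∀ᶠ t : ℝ in atTop, 2 * (1 / (⌊t⌋₊ + 1 : ℝ)) ≤ ε := by
    intro ε hε
    have h1 : Tendsto (fun n : ℕ => 2 * (1 / (n + 1 : ℝ))) atTop (𝓝 0) := by
      simpa using (tendsto_one_div_add_atTop_nhds_zero_nat (𝕜 := ℝ)).const_mul 2
    exact (tendsto_nat_floor_atTop (α := ℝ)).eventually (h1.eventually_le_const hε)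
  have hle : ∀ n : ℕ, 1 / ((n + 1 : ℕ) + 1 : ℝ) ≤ 1 / (n + 1 : ℝ) := by
    intro n
    refine one_div_le_one_div_of_le (by positivity) ?_
    push_cast
    linarith
  refine ⟨tentPath R, continuous_tentPath R,
    fun t ht => star_tentPath_mul_self (fun n => (hR n).isometry) hR' ht,
    fun a t ht => ?_, fun g t ht => ?_, fun a => ?_, fun K hK ε hε => ?_⟩
  · rw [ha a t ht]
    exact ((hR _).hom_mem a).smul _ |>.add (((hR _).hom_mem a).smul _)
  · rw [hg g t ht]
    exact ((hR _).coc_mem g).smul _ |>.add (((hR _).coc_mem g).smul _)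
  · rw [Metric.tendsto_nhds]
    intro ε hε
    obtain ⟨a', ⟨n, rfl⟩, hn⟩ := Metric.mem_closure_iff.1
      (TopologicalSpace.denseRange_denseSeq A a) (ε / 4) (by positivity)
    rw [dist_eq_norm] at hn
    filter_upwards [hsmall (ε / 4) (by positivity), eventually_ge_atTop ((n + 1 : ℕ) : ℝ)]
      with t ht1 ht2
    have ht0 : 0 ≤ t := le_trans (by positivity) ht2
    set a' := TopologicalSpace.denseSeq A n
    have hmem : ∀ k, ⌊t⌋₊ ≤ k → a' ∈ F k := by
      intro k hk
      refine ⟨n, ?_, rfl⟩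
      have := Nat.le_floor ht2
      exact Set.mem_Iio.2 (by omega)
    have h1 : ‖ρ.hom a' * tentPath R t - tentPath R t * σ.hom a'‖ ≤ ε / 4 := by
      rw [ha a' t ht0]
      refine (norm_add_le _ _).trans ((add_le_add ((htent _ _).trans
        ((hR _).hom_le a' (hmem _ le_rfl))) ((htent _ _).trans
        ((hR _).hom_le a' (hmem _ (Nat.le_succ _))))).trans ?_)
      have := hle ⌊t⌋₊
      linarith
    have hP : ‖tentPath R t‖ ≤ 1 := CStarAlgebra.norm_le_one_of_isometry
      (star_tentPath_mul_self (fun n => (hR n).isometry) hR' ht0)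
    have h2 : ρ.hom a * tentPath R t - tentPath R t * σ.hom a
        = (ρ.hom a' * tentPath R t - tentPath R t * σ.hom a')
          + ρ.hom (a - a') * tentPath R t - tentPath R t * σ.hom (a - a') := by
      simp only [map_sub]
      noncomm_ring
    have h3 : ‖ρ.hom (a - a') * tentPath R t‖ ≤ ‖a - a'‖ * 1 := by
      refine (norm_mul_le _ _).trans ?_
      gcongr
      exact norm_hom_le _ _
    have h4 : ‖tentPath R t * σ.hom (a - a')‖ ≤ 1 * ‖a - a'‖ := by
      refine (norm_mul_le _ _).trans ?_
      gcongr
      exact norm_hom_le _ _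
    rw [dist_zero_right, norm_norm, h2]
    refine (norm_sub_le _ _).trans_lt ?_
    have h5 := norm_add_le (ρ.hom a' * tentPath R t - tentPath R t * σ.hom a')
      (ρ.hom (a - a') * tentPath R t)
    linarith
  · obtain ⟨n, hn⟩ := E.exists_superset_of_isCompact hK
    filter_upwards [hsmall ε hε, eventually_ge_atTop (n : ℝ)] with t ht1 ht2 g hgK
    have ht0 : 0 ≤ t := le_trans (by positivity) ht2
    have hmem : ∀ k, ⌊t⌋₊ ≤ k → g ∈ E k := fun k hk =>
      E.subset ((Nat.le_floor ht2).trans hk) (hn hgK)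
    rw [hg g t ht0]
    refine (norm_add_le _ _).trans ((add_le_add ((htent _ _).trans
      ((hR _).coc_le g (hmem _ le_rfl))) ((htent _ _).trans
      ((hR _).coc_le g (hmem _ (Nat.le_succ _))))).trans ?_)
    have := hle ⌊t⌋₊
    linarith

/-- An asymptotic intertwining path from `ψ^∞` to `φ^∞` yields the absorption of `ψ^∞`. -/
theorem IsIntertwiningPath.asympEquiv {φ ψ : CocycleRep α β} {T₁ T₂ : IsometrySequence β}
    {R : ℝ → 𝓜(ℂ, B)}
    (hR : IsIntertwiningPath (φ.infiniteRepeat T₁) (ψ.infiniteRepeat T₂) R)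
    (T₃ : IsometrySequence β) (r : CuntzIsometries β) :
    AsympEquiv (φ.infiniteRepeat T₁)
      (cuntzSum r (ψ.infiniteRepeat T₂) (φ.infiniteRepeat T₃)) := by
  set ρ := φ.infiniteRepeat T₁ with hρ
  set σ := ψ.infiniteRepeat T₂ with hσ
  set τ := cuntzSum r σ (φ.infiniteRepeat T₃) with hτ
  obtain ⟨s, hs₁, hs₂⟩ := T₂.exists_cuntz_shift
  obtain ⟨U, hU₁, hU₂, hUβ, hU⟩ := T₁.exists_unitary_shift T₃
  have hs₁' : ∀ x, star s.r₁ * T₂.infiniteSum x = T₂.infiniteSum x * star s.r₁ := by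
    intro x
    have := congrArg star (hs₁ (star x))
    simpa [T₂.infiniteSum_star] using this.symm
  have hs₂' : ∀ x, star s.r₂ * T₂.infiniteSum x = T₂.infiniteSum x * star s.r₂ := by
    intro x
    have := congrArg star (hs₂ (star x))
    simpa [T₂.infiniteSum_star] using this.symm
  let W : 𝓜(ℂ, B) → 𝓜(ℂ, B) := fun S => absorbingUnitary r.r₁ r.r₂ s.r₁ s.r₂ U S
  have hW₁ : ∀ S, star S * S = 1 → W S * star (W S) = 1 := fun S hS =>
    absorbingUnitary_mul_star r.sum_eq_one s.isometry₁ s.isometry₂ s.orth hU₂ hS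
  have hW₂ : ∀ S, star S * S = 1 → star (W S) * W S = 1 := fun S hS =>
    star_mul_absorbingUnitary r.isometry₁ r.isometry₂ r.orth s.sum_eq_one hU₁ hS
  have hWg : ∀ g S, β.mul g (W S) = W (β.mul g S) := by
    intro g S
    simp only [W, absorbingUnitary, map_add, map_mul, map_sub, map_one, map_star, r.fixed₁,
      r.fixed₂, s.fixed₁, s.fixed₂, hUβ]
  -- The maximum with 0 makes the values unitary on all of ℝ; on [1, ∞) it has no effect.
  have hiso : ∀ t, star (R (max t 0)) * R (max t 0) = 1 := fun t => hR.isometry _ (le_max_right _ _)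
  let w : ℝ → unitary 𝓜(ℂ, B) := fun t => ⟨W (R (max t 0)),
    Unitary.mem_iff.2 ⟨hW₂ _ (hiso t), hW₁ _ (hiso t)⟩⟩
  have hwc : Continuous w := by
    have h1 := hR.continuous
    refine Continuous.subtype_mk ?_ _
    simp only [W, absorbingUnitary]
    fun_prop
  have hwt : ∀ t, 0 ≤ t → (w t : 𝓜(ℂ, B)) = W (R t) := by
    intro t ht
    change W (R (max t 0)) = W (R t)
    rw [max_eq_left ht]
  have hgiso : ∀ g t, 0 ≤ t → star (β.mul g (R t)) * β.mul g (R t) = 1 := by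
    intro g t ht
    rw [← map_star, ← map_mul, hR.isometry t ht, map_one]
  have hb : ∀ (x y : 𝓜(ℂ, B)), star y * y = 1 → ‖x * star y‖ ≤ ‖x‖ := by
    intro x y hy
    refine (norm_mul_le _ _).trans (mul_le_of_le_one_right (norm_nonneg _) ?_)
    rw [norm_star]
    exact CStarAlgebra.norm_le_one_of_isometry hy
  have hDa : ∀ a t, 0 ≤ t → τ.hom a - W (R t) * ρ.hom a * star (W (R t))
      = -((W (R t) * ρ.hom a - τ.hom a * W (R t)) * star (W (R t))) := by
    intro a t ht
    have h1 : τ.hom a = τ.hom a * (W (R t) * star (W (R t))) := by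
      rw [hW₁ _ (hR.isometry t ht), mul_one]
    conv_lhs => rw [h1]
    noncomm_ring
  have hDg : ∀ g t, 0 ≤ t →
      (τ.coc g : 𝓜(ℂ, B)) - W (R t) * (ρ.coc g : 𝓜(ℂ, B)) * star (β.mul g (W (R t)))
      = -((W (R t) * (ρ.coc g : 𝓜(ℂ, B)) - τ.coc g * W (β.mul g (R t)))
          * star (W (β.mul g (R t)))) := by
    intro g t ht
    have h1 : (τ.coc g : 𝓜(ℂ, B))
        = τ.coc g * (W (β.mul g (R t)) * star (W (β.mul g (R t)))) := by
      rw [hW₁ _ (hgiso g t ht), mul_one]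
    conv_lhs => rw [h1, hWg]
    noncomm_ring
  -- The adjoint defect at a is the adjoint of the direct defect at a⋆, which explains why
  -- convergence at both a and a⋆ enters below.
  have ha' : ∀ a t, star (R t) * ρ.hom a - σ.hom a * star (R t)
      = star (ρ.hom (star a) * R t - R t * σ.hom (star a)) := by
    intro a t
    simp only [star_sub, star_mul, map_star, star_star]
  -- Unitarity of both cocycles turns the adjoint defect into the direct one, up to multiplication
  -- by unitaries; hence the bound 5 = 3 + 2 below.
  have hg' : ∀ g t, star (R t) * (ρ.coc g : 𝓜(ℂ, B)) - σ.coc g * star (β.mul g (R t))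
      = -((σ.coc g : 𝓜(ℂ, B))
        * star ((ρ.coc g : 𝓜(ℂ, B)) * β.mul g (R t) - R t * σ.coc g) * ρ.coc g) := by
    intro g t
    have h1 := Unitary.coe_star_mul_self (ρ.coc g)
    have h2 : (σ.coc g : 𝓜(ℂ, B)) * star (σ.coc g : 𝓜(ℂ, B)) = 1 :=
      Unitary.coe_mul_star_self (σ.coc g)
    set x := (ρ.coc g : 𝓜(ℂ, B))
    set y := (σ.coc g : 𝓜(ℂ, B))
    rw [star_sub, star_mul, star_mul]
    calc _ = (y * star y) * star (R t) * x - y * star (β.mul g (R t)) * (star x * x) := by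
          rw [h1, h2, one_mul, mul_one]
      _ = _ := by noncomm_ring
  have hna : ∀ a t, 0 ≤ t → ‖τ.hom a - (w t : 𝓜(ℂ, B)) * ρ.hom a * star (w t : 𝓜(ℂ, B))‖
      ≤ 3 * ‖ρ.hom (star a) * R t - R t * σ.hom (star a)‖
        + 2 * ‖ρ.hom a * R t - R t * σ.hom a‖ := by
    intro a t ht
    rw [hwt t ht, hDa a t ht, norm_neg]
    refine (hb _ _ (hW₂ _ (hR.isometry t ht))).trans ?_
    rw [← norm_star (ρ.hom (star a) * R t - R t * σ.hom (star a)), ← ha']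
    exact norm_absorbingUnitary_intertwine_le r.isometry₁ r.isometry₂ r.orth (hs₁' _) (hs₂' _)
      (hU _) s.isometry₁ s.isometry₂ hU₁ (hR.isometry t ht) (hR.isometry t ht)
  have hng : ∀ g t, 0 ≤ t →
      ‖(τ.coc g : 𝓜(ℂ, B)) - (w t : 𝓜(ℂ, B)) * (ρ.coc g : 𝓜(ℂ, B)) * star (β.mul g (w t))‖
      ≤ 5 * ‖(ρ.coc g : 𝓜(ℂ, B)) * β.mul g (R t) - R t * σ.coc g‖ := by
    intro g t ht
    rw [hwt t ht, hDg g t ht, norm_neg]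
    refine (hb _ _ (hW₂ _ (hgiso g t ht))).trans ?_
    have h1 := norm_absorbingUnitary_intertwine_le r.isometry₁ r.isometry₂ r.orth
      (hs₁' (ψ.coc g : 𝓜(ℂ, B))) (hs₂' (ψ.coc g : 𝓜(ℂ, B))) (hU (φ.coc g : 𝓜(ℂ, B))) s.isometry₁
      s.isometry₂ hU₁ (hR.isometry t ht) (hgiso g t ht)
    have h2 : ‖star (R t) * (ρ.coc g : 𝓜(ℂ, B)) - σ.coc g * star (β.mul g (R t))‖
        ≤ ‖(ρ.coc g : 𝓜(ℂ, B)) * β.mul g (R t) - R t * σ.coc g‖ := by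
      rw [hg', norm_neg]
      refine (norm_mul_le _ _).trans ((mul_le_of_le_one_right (norm_nonneg _)
        (norm_unitary_le _)).trans ((norm_mul_le _ _).trans ?_))
      rw [norm_star]
      exact mul_le_of_le_one_left (norm_nonneg _) (norm_unitary_le _)
    refine (h1.trans (add_le_add_left (mul_le_mul_of_nonneg_left h2 (by norm_num)) _)).trans ?_
    change 3 * ‖(ρ.coc g : 𝓜(ℂ, B)) * β.mul g (R t) - R t * σ.coc g‖
      + 2 * ‖(ρ.coc g : 𝓜(ℂ, B)) * β.mul g (R t) - R t * σ.coc g‖ ≤ _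
    linarith
  have hmem : ∀ {p q q' S S' : 𝓜(ℂ, B)}, star s.r₁ * p = p * star s.r₁ →
      star s.r₂ * p = p * star s.r₂ → U * q = q' * U → MemBase (star S * q - p * star S') →
      MemBase (q * S' - S * p) → MemBase (W S * q - r.sum p q' * W S') := by
    intro p q q' S S' hp₁ hp₂ hUq h1 h2
    simp only [W, CuntzIsometries.sum]
    rw [absorbingUnitary_intertwine r.isometry₁ r.isometry₂ r.orth hp₁ hp₂ hUq]
    exact (h1.mul_left _).add (MemBase.mul_left _ ((((h1.mul_left _).sub
      ((h2.mul_right _).mul_right _)).sub (h1.mul_left _)).add (h2.mul_right _)))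
  refine ⟨w, hwc.continuousOn, fun a => ?_, fun a t ht => ?_, fun K hK ε hε => ?_,
    fun t ht g => ?_⟩
  · rw [tendsto_iff_norm_sub_tendsto_zero]
    have h1 := ((hR.tendsto_hom (star a)).const_mul 3).add ((hR.tendsto_hom a).const_mul 2)
    rw [mul_zero, mul_zero, add_zero] at h1
    refine squeeze_zero' (Eventually.of_forall fun _ => norm_nonneg _) ?_ h1
    filter_upwards [eventually_ge_atTop 0] with t ht
    rw [norm_sub_rev]
    exact hna a t ht
  · have ht0 : 0 ≤ t := zero_le_one.trans ht
    rw [hwt t ht0, hDa a t ht0]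
    refine (MemBase.mul_right _ ?_).neg
    refine hmem (hs₁' _) (hs₂' _) (hU _) ?_ (hR.hom_mem a t ht0)
    have h1 := (hR.hom_mem (star a) t ht0).star
    rwa [← ha'] at h1
  · filter_upwards [hR.eventually_coc K hK (ε / 5) (by positivity), eventually_ge_atTop 0]
      with t ht ht0 g hg
    have := ht g hg
    exact (hng g t ht0).trans (by linarith)
  · have ht0 : 0 ≤ t := zero_le_one.trans ht
    rw [hwt t ht0, hDg g t ht0]
    refine (MemBase.mul_right _ ?_).neg
    refine hmem (hs₁' (ψ.coc g : 𝓜(ℂ, B))) (hs₂' (ψ.coc g : 𝓜(ℂ, B))) (hU (φ.coc g : 𝓜(ℂ, B))) ?_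
      (hR.coc_mem g t ht0)
    have h1 := (((hR.coc_mem g t ht0).star.mul_left (σ.coc g : 𝓜(ℂ, B))).mul_right
      (ρ.coc g : 𝓜(ℂ, B))).neg
    rwa [← hg'] at h1

theorem CuntzIsometries.star_mul_sum_mul (r : CuntzIsometries β) (x y : 𝓜(ℂ, B)) :
    star r.r₁ * r.sum x y * r.r₁ = x := by
  have h : star r.r₁ * r.sum x y * r.r₁ = (star r.r₁ * r.r₁) * x * (star r.r₁ * r.r₁)
      + (star r.r₁ * r.r₂) * y * (star r.r₂ * r.r₁) := by
    simp only [CuntzIsometries.sum]; noncomm_ring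
  rw [h, r.isometry₁, r.orth, one_mul, mul_one, zero_mul, zero_mul, add_zero]

/-- At a late time t, conjugation by w t almost turns φ^∞ into the sum containing ψ. Cutting ψ out
by an invariant isometry d gives ψ ≈ S⋆ φ^∞ β_g(S) with S = (w t)⋆ d, and compressing by b and
truncating φ^∞ yields the required finite sums. -/
theorem AsympEquiv.weaklyContained {φ ψ : CocycleRep α β} {T₁ T₂ T₃ : IsometrySequence β}
    {r : CuntzIsometries β} (h : AsympEquiv (φ.infiniteRepeat T₁)
      (cuntzSum r (ψ.infiniteRepeat T₂) (φ.infiniteRepeat T₃))) : WeaklyContained ψ φ := by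
  set ρ := φ.infiniteRepeat T₁ with hρ
  set τ := cuntzSum r (ψ.infiniteRepeat T₂) (φ.infiniteRepeat T₃) with hτ
  obtain ⟨w, -, hwa, -, hwg, -⟩ := h
  intro K F ε b hK hF hε hb
  -- The conjugated maps are contractive, so pointwise convergence is uniform on the compact set F
  -- by a finite net.
  have hwF : ∀ᶠ t in atTop, ∀ a ∈ F,
      ‖τ.hom a - (w t : 𝓜(ℂ, B)) * ρ.hom a * star (w t : 𝓜(ℂ, B))‖ ≤ ε / 2 := by
    obtain ⟨F₀, hF₀, hFF₀⟩ := Metric.totallyBounded_iff.1 hF.totallyBounded (ε / 8) (by positivity)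
    have h1 : ∀ᶠ t in atTop, ∀ a ∈ F₀,
        ‖(w t : 𝓜(ℂ, B)) * ρ.hom a * star (w t : 𝓜(ℂ, B)) - τ.hom a‖ < ε / 4 := by
      refine hF₀.eventually_all.2 fun a _ => ?_
      exact (tendsto_iff_norm_sub_tendsto_zero.1 (hwa a)).eventually_lt_const (by positivity)
    filter_upwards [h1] with t ht a ha
    obtain ⟨a', ha', haa'⟩ := Set.mem_iUnion₂.1 (hFF₀ ha)
    rw [Metric.mem_ball, dist_eq_norm] at haa'
    have h2 := ht a' ha'
    rw [norm_sub_rev] at h2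
    have h3 : τ.hom a - (w t : 𝓜(ℂ, B)) * ρ.hom a * star (w t : 𝓜(ℂ, B))
        = (τ.hom a' - (w t : 𝓜(ℂ, B)) * ρ.hom a' * star (w t : 𝓜(ℂ, B)))
          + τ.hom (a - a') - (w t : 𝓜(ℂ, B)) * ρ.hom (a - a') * star (w t : 𝓜(ℂ, B)) := by
      simp only [map_sub]
      noncomm_ring
    have h4 : ‖(w t : 𝓜(ℂ, B)) * ρ.hom (a - a') * star (w t : 𝓜(ℂ, B))‖ ≤ ‖a - a'‖ := by
      refine (norm_mul_le _ _).trans ((mul_le_of_le_one_right (norm_nonneg _) ?_).trans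
        ((norm_mul_le _ _).trans ((mul_le_of_le_one_left (norm_nonneg _) (norm_unitary_le _)).trans
        (ρ.norm_hom_le _))))
      rw [norm_star]
      exact norm_unitary_le _
    have h5 := τ.norm_hom_le (a - a')
    rw [h3]
    have h6 := norm_sub_le ((τ.hom a' - (w t : 𝓜(ℂ, B)) * ρ.hom a' * star (w t : 𝓜(ℂ, B)))
          + τ.hom (a - a')) ((w t : 𝓜(ℂ, B)) * ρ.hom (a - a') * star (w t : 𝓜(ℂ, B)))
    have h7 := norm_add_le (τ.hom a' - (w t : 𝓜(ℂ, B)) * ρ.hom a' * star (w t : 𝓜(ℂ, B)))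
      (τ.hom (a - a'))
    linarith
  obtain ⟨t, htF, htK⟩ := (hwF.and (hwg K hK (ε / 2) (by positivity))).exists
  set v := (w t : 𝓜(ℂ, B)) with hv
  -- The first summand, at position 0 of the repeat: compressing by d returns ψ exactly.
  set d := r.r₁ * T₂.t 0 with hd
  set S := star v * d with hS
  have hdd : star d * d = 1 := by
    rw [hd, star_mul, mul_assoc, ← mul_assoc (star r.r₁), r.isometry₁, one_mul, T₂.isometry]
  have hS1 : ‖S‖ ≤ 1 := by
    refine CStarAlgebra.norm_le_one_of_isometry ?_
    have hvv : v * star v = 1 := Unitary.coe_mul_star_self (w t)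
    rw [hS, star_mul, star_star, mul_assoc, ← mul_assoc v, hvv, one_mul, hdd]
  have hd1 : ‖d‖ ≤ 1 := CStarAlgebra.norm_le_one_of_isometry hdd
  have hdτ : ∀ x y, star d * r.sum (T₂.infiniteSum x) y * d = x := by
    intro x y
    have h1 : star d * r.sum (T₂.infiniteSum x) y * d
        = star (T₂.t 0) * (star r.r₁ * r.sum (T₂.infiniteSum x) y * r.r₁) * T₂.t 0 := by
      rw [hd, star_mul]; noncomm_ring
    rw [h1, CuntzIsometries.star_mul_sum_mul, T₂.star_t_mul_infiniteSum_mul_t, if_pos rfl]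
  have hcompr : ∀ z, ‖star d * z * d‖ ≤ ‖z‖ := by
    intro z
    refine (norm_mul_le _ _).trans ((mul_le_of_le_one_right (norm_nonneg _) hd1).trans
      ((norm_mul_le _ _).trans (mul_le_of_le_one_left (norm_nonneg _) ?_)))
    rwa [norm_star]
  have hi : ∀ i ∈ Sum.inl '' F ∪ Sum.inr '' K,
      ‖ψ.indexMul i - star S * ρ.indexMul i * multiplierExt (indexAut β i) S‖ ≤ ε / 2 := by
    rintro _ (⟨a, ha, rfl⟩ | ⟨g, hg, rfl⟩)
    · have h1 : ψ.hom a - star S * ρ.hom a * S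
          = star d * (τ.hom a - v * ρ.hom a * star v) * d := by
        have h2 : star d * τ.hom a * d = ψ.hom a := hdτ _ _
        rw [mul_sub, sub_mul, h2, hS, star_mul, star_star]
        noncomm_ring
      change ‖ψ.hom a - star S * ρ.hom a * S‖ ≤ ε / 2
      rw [h1]
      exact (hcompr _).trans (htF a ha)
    · have hdβ : β.mul g d = d := by rw [hd, map_mul, r.fixed₁, T₂.fixed]
      have h1 : (ψ.coc g : 𝓜(ℂ, B)) - star S * (ρ.coc g : 𝓜(ℂ, B)) * β.mul g S
          = star d * ((τ.coc g : 𝓜(ℂ, B)) - v * (ρ.coc g : 𝓜(ℂ, B)) * star (β.mul g v)) * d := by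
        have h2 : star d * (τ.coc g : 𝓜(ℂ, B)) * d = ψ.coc g := hdτ _ _
        rw [mul_sub, sub_mul, h2, hS, star_mul, star_star, map_mul, hdβ, map_star]
        noncomm_ring
      change ‖(ψ.coc g : 𝓜(ℂ, B)) - star S * (ρ.coc g : 𝓜(ℂ, B)) * β.mul g S‖ ≤ ε / 2
      rw [h1]
      exact (hcompr _).trans (htK g hg)
  obtain ⟨C', hC'⟩ := hF.isBounded.exists_norm_le
  set C := max C' 1 with hCdef
  have hC0 : 0 < C := zero_lt_one.trans_le (le_max_right _ _)
  have hC : ∀ i ∈ Sum.inl '' F ∪ Sum.inr '' K, ‖φ.indexMul i‖ ≤ C := by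
    rintro _ (⟨a, ha, rfl⟩ | ⟨g, hg, rfl⟩)
    · exact (φ.norm_hom_le a).trans ((hC' a ha).trans (le_max_left _ _))
    · exact (norm_unitary_le (φ.coc g)).trans (le_max_right _ _)
  set x := S.fst b with hx
  have hSx : S * emb b = emb x := mul_emb S b
  have hx1 : ‖x‖ ≤ 1 := by
    rw [← norm_emb, ← hSx]
    exact (norm_mul_le _ _).trans (mul_le_one₀ hS1 (norm_nonneg _) (by rwa [norm_emb]))
  -- The witnesses are (t n)⋆ S b for n < M, so M is chosen by the truncation error at x = S b.
  obtain ⟨M, hM⟩ := ((T₁.tendsto_truncation x).eventually_lt_const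
    (show 0 < ε / 2 / C by positivity)).exists
  rw [lt_div_iff₀ hC0] at hM
  have hfin : ∀ i ∈ Sum.inl '' F ∪ Sum.inr '' K,
      ‖star (emb b) * ψ.indexMul i * multiplierExt (indexAut β i) (emb b)
        - ∑ n ∈ Finset.range M, star (emb ((star (T₁.t n)).fst x)) * φ.indexMul i
          * multiplierExt (indexAut β i) (emb ((star (T₁.t n)).fst x))‖ ≤ ε := by
    intro i hi'
    have h1 := T₁.norm_compression_sub_le (indexAut β i) (indexAut_fixes T₁ i) (φ.indexMul i) x M
    have h2 : ‖φ.indexMul i‖ * ‖star x - (T₁.partialSum (Finset.range M) 1).snd (star x)‖ * ‖x‖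
        ≤ ε / 2 := by
      calc _ ≤ C * ‖star x - (T₁.partialSum (Finset.range M) 1).snd (star x)‖ * 1 := by
            gcongr
            exact hC i hi'
        _ ≤ ε / 2 := by linarith
    have h3 : star (emb b) * ψ.indexMul i * multiplierExt (indexAut β i) (emb b)
        - star (emb x) * T₁.infiniteSum (φ.indexMul i) * multiplierExt (indexAut β i) (emb x)
        = star (emb b) * (ψ.indexMul i - star S * ρ.indexMul i * multiplierExt (indexAut β i) S)
          * multiplierExt (indexAut β i) (emb b) := by
      rw [← hSx, ← indexMul_infiniteRepeat, map_mul, star_mul]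
      noncomm_ring
    have h4 : ‖star (emb b) * ψ.indexMul i * multiplierExt (indexAut β i) (emb b)
        - star (emb x) * T₁.infiniteSum (φ.indexMul i) * multiplierExt (indexAut β i) (emb x)‖
        ≤ ε / 2 := by
      rw [h3]
      refine (norm_mul_le _ _).trans ((mul_le_of_le_one_right (norm_nonneg _) ?_).trans
        ((norm_mul_le _ _).trans ((mul_le_of_le_one_left (norm_nonneg _) ?_).trans (hi i hi'))))
      · exact (norm_multiplierExt_le _ _).trans ((norm_emb b).trans_le hb)
      · rw [norm_star, norm_emb]
        exact hb
    refine (norm_sub_le_norm_sub_add_norm_sub _ _ _).trans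
      ((add_le_add h4 (h1.trans h2)).trans ?_)
    linarith
  have hemb : ∀ (m : 𝓜(ℂ, B)) (θ : B ≃⋆ₐ[ℂ] B) (b : B),
      star (emb b) * m * multiplierExt θ (emb b) = emb (star b * m.fst (θ b)) := by
    intro m θ b
    rw [multiplierExt_emb, mul_assoc, mul_emb, map_mul, map_star]
  simp only [hemb, ← map_sum, ← map_sub, norm_emb, Finset.sum_range] at hfin
  refine ⟨1, M, fun _ => φ, fun _ n => (star (T₁.t n)).fst x, fun _ => rfl, fun g hg => ?_,
    fun a ha => ?_⟩
  · rw [Fin.sum_univ_one]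
    exact hfin (Sum.inr g) (Or.inr ⟨g, hg, rfl⟩)
  · rw [Fin.sum_univ_one]
    exact hfin (Sum.inl a) (Or.inl ⟨a, ha, rfl⟩)

end CocycleRep

end Equivalence

end

noncomputable section

/-! ### Isometries on `ℓ²(ℕ)` -/

section EllTwo

/-- The standard Hilbert basis of `ℓ²(ℕ)`. -/
def ellTwoBasis : HilbertBasis ℕ ℂ EllTwo := HilbertBasis.ofRepr (LinearIsometryEquiv.refl ℂ EllTwo)

theorem exists_isometry_of_injective {f : ℕ → ℕ} (hf : f.Injective) :
    ∃ s : EllTwo →L[ℂ] EllTwo, star s * s = 1 ∧ ∀ m, s (ellTwoBasis m) = ellTwoBasis (f m) := by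
  have hv : Orthonormal ℂ fun m => ellTwoBasis (f m) := ellTwoBasis.orthonormal.comp f hf
  let S : EllTwo →ₗᵢ[ℂ] EllTwo := hv.orthogonalFamily.linearIsometry
  refine ⟨S.toContinuousLinearMap, ?_, fun m => ?_⟩
  · rw [ContinuousLinearMap.star_eq_adjoint]
    exact (ContinuousLinearMap.norm_map_iff_adjoint_comp_self _).1 S.norm_map
  · have h1 : ellTwoBasis m = lp.single 2 m (1 : ℂ) := ellTwoBasis.repr_self m
    rw [h1]
    change S _ = _
    rw [OrthogonalFamily.linearIsometry_apply_single]
    simp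

theorem star_mul_eq_zero_of_disjoint {f g : ℕ → ℕ} (hfg : ∀ m n, f m ≠ g n)
    {s t : EllTwo →L[ℂ] EllTwo} (hs : ∀ m, s (ellTwoBasis m) = ellTwoBasis (f m))
    (ht : ∀ m, t (ellTwoBasis m) = ellTwoBasis (g m)) : star s * t = 0 := by
  refine ContinuousLinearMap.ext_on
    (Submodule.dense_iff_topologicalClosure_eq_top.2 ellTwoBasis.dense_span)
    ?_
  rintro _ ⟨n, rfl⟩
  refine ellTwoBasis.repr.injective (lp.ext (funext fun m => ?_))
  rw [HilbertBasis.repr_apply_apply, mul_apply_eq_comp,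
    ContinuousLinearMap.star_eq_adjoint, ContinuousLinearMap.adjoint_inner_right, hs, ht,
    ellTwoBasis.orthonormal.2 (hfg m n)]
  simp

/-- The sum of the range projections of isometries with orthogonal ranges is a contraction. -/
theorem norm_sum_mul_star_le_one {C : Type*} [CStarAlgebra C] {s : ℕ → C}
    (hs : ∀ m n, star (s m) * s n = if m = n then 1 else 0) (N : ℕ) :
    ‖∑ n ∈ Finset.range N, s n * star (s n)‖ ≤ 1 := by
  set P := ∑ n ∈ Finset.range N, s n * star (s n) with hP
  have hPP : star P * P = P := by
    rw [hP, star_sum, Finset.sum_mul]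
    refine Finset.sum_congr rfl fun m hm => ?_
    rw [Finset.mul_sum, Finset.sum_eq_single m]
    · rw [star_mul, star_star, mul_assoc, ← mul_assoc (star (s m)), hs, if_pos rfl, one_mul]
    · intro n _ hn
      rw [star_mul, star_star, mul_assoc, ← mul_assoc (star (s m)), hs, if_neg hn.symm, zero_mul,
        mul_zero]
    · exact fun h => absurd hm h
  have h1 : ‖P‖ * ‖P‖ = ‖P‖ := by rw [← CStarRing.norm_star_mul_self, hPP]
  by_contra h
  nlinarith

/-- There is a sequence of isometries on `ℓ²(ℕ)` whose range projections sum up to `1`. -/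
theorem exists_operator_sequence : ∃ s : ℕ → (EllTwo →L[ℂ] EllTwo),
    (∀ m n, star (s m) * s n = if m = n then 1 else 0) ∧
    ∀ x, Tendsto (fun N => (∑ n ∈ Finset.range N, s n * star (s n)) x) atTop (𝓝 x) := by
  -- The isometry s n sends the basis vector m to the one indexed by the pair (n, m). As pairing is
  -- a bijection, the ranges are orthogonal and exhaust the basis.
  have hinj : ∀ n, Function.Injective (Nat.pair n) := fun n a b h => (Nat.pair_eq_pair.1 h).2
  choose s hs hsb using fun n => exists_isometry_of_injective (hinj n)
  have horth : ∀ m n, m ≠ n → star (s m) * s n = 0 := fun m n hmn =>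
    star_mul_eq_zero_of_disjoint (fun a b h => hmn (Nat.pair_eq_pair.1 h).1) (hsb m) (hsb n)
  have hs' : ∀ m n, star (s m) * s n = if m = n then 1 else 0 := by
    intro m n
    split_ifs with h
    · rw [h, hs]
    · exact horth m n h
  have hnorm := norm_sum_mul_star_le_one hs'
  refine ⟨s, hs', fun x => ?_⟩
  have hfin : ∀ y ∈ Submodule.span ℂ (Set.range ellTwoBasis), ∀ᶠ N in atTop,
      (∑ n ∈ Finset.range N, s n * star (s n)) y = y := by
    intro y hy
    induction hy using Submodule.span_induction with
    | mem y hy =>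
      obtain ⟨k, rfl⟩ := hy
      filter_upwards [eventually_gt_atTop (Nat.unpair k).1] with N hN
      rw [← Nat.pair_unpair k, ← hsb, ← mul_apply_eq_comp, Finset.sum_mul,
        Finset.sum_eq_single (Nat.unpair k).1]
      · rw [mul_assoc, hs, mul_one]
      · intro n _ hn
        rw [mul_assoc, horth _ _ hn, mul_zero]
      · exact fun h => absurd (Finset.mem_range.2 hN) h
    | zero => simp
    | add y z _ _ hy hz =>
      filter_upwards [hy, hz] with N h1 h2
      rw [map_add, h1, h2]
    | smul c y _ hy =>
      filter_upwards [hy] with N h1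
      rw [map_smul, h1]
  rw [Metric.tendsto_nhds]
  intro ε hε
  have hdense : x ∈ closure (Submodule.span ℂ (Set.range ellTwoBasis) : Set EllTwo) :=
    Submodule.dense_iff_topologicalClosure_eq_top.2 ellTwoBasis.dense_span x
  obtain ⟨y, hy, hxy⟩ := Metric.mem_closure_iff.1 hdense (ε / 2) (by positivity)
  filter_upwards [hfin y hy] with N hN
  set P := ∑ n ∈ Finset.range N, s n * star (s n)
  rw [dist_eq_norm] at hxy ⊢
  have h1 : P x - x = P (x - y) - (x - y) := by rw [map_sub, hN]; abel
  have h2 : ‖P (x - y)‖ ≤ 1 * ‖x - y‖ := (P.le_opNorm _).trans (by gcongr; exact hnorm N)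
  rw [h1]
  exact (norm_sub_le _ _).trans_lt (by linarith)

/-- Strong convergence of contractions to the identity is norm convergence on compact operators. -/
theorem tendsto_mul_of_isCompactOperator {P : ℕ → (EllTwo →L[ℂ] EllTwo)} (hP : ∀ N, ‖P N‖ ≤ 1)
    (hPx : ∀ x, Tendsto (fun N => P N x) atTop (𝓝 x)) {k : EllTwo →L[ℂ] EllTwo}
    (hk : IsCompactOperator k) : Tendsto (fun N => P N * k) atTop (𝓝 k) := by
  rw [Metric.tendsto_nhds]
  intro ε hε
  have htb : TotallyBounded (k '' Metric.closedBall (0 : EllTwo) 1) :=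
    (((isCompactOperator_iff_isCompact_closure_image_closedBall
      (k : EllTwo →ₗ[ℂ] EllTwo) one_pos).1 hk).totallyBounded).subset subset_closure
  obtain ⟨t, htf, ht⟩ := Metric.totallyBounded_iff.1 htb (ε / 8) (by positivity)
  have hev : ∀ᶠ N in atTop, ∀ y ∈ t, ‖P N y - y‖ < ε / 4 := by
    refine htf.eventually_all.2 fun y _ => ?_
    exact (tendsto_iff_norm_sub_tendsto_zero.1 (hPx y)).eventually_lt_const (by positivity)
  filter_upwards [hev] with N hN
  rw [dist_eq_norm]
  refine lt_of_le_of_lt ?_ (half_lt_self hε)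
  refine ContinuousLinearMap.opNorm_le_of_unit_norm (by positivity) fun x hx => ?_
  obtain ⟨y, hy, hxy⟩ := Set.mem_iUnion₂.1 (ht ⟨x, mem_closedBall_zero_iff.2 hx.le, rfl⟩)
  rw [Metric.mem_ball, dist_eq_norm] at hxy
  have h1 : (P N * k - k) x = P N (k x - y) + (P N y - y) - (k x - y) := by
    rw [sub_apply, mul_apply_eq_comp, map_sub]; abel
  have h2 : ‖P N (k x - y)‖ ≤ 1 * ‖k x - y‖ :=
    ((P N).le_opNorm _).trans (by gcongr; exact hP N)
  have h3 := hN y hy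
  rw [h1]
  have h4 := norm_sub_le (P N (k x - y) + (P N y - y)) (k x - y)
  have h5 := norm_add_le (P N (k x - y)) (P N y - y)
  linarith

theorem isClosed_compactOps : IsClosed (CompactOps : Set (EllTwo →L[ℂ] EllTwo)) :=
  isClosed_setOfPred_isCompactOperator

end EllTwo

/-! ### Multipliers of a stabilization -/

section Stabilization

variable {B K D : Type*} [NonUnitalCStarAlgebra B] [NonUnitalCStarAlgebra K]
  [NonUnitalCStarAlgebra D]

/-- The map `1 ⊗ L` on the algebraic tensor product. -/
abbrev tensorMap (B : Type*) [NonUnitalCStarAlgebra B] (L : K →L[ℂ] K) :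
    (B ⊗[ℂ] K) →ₗ[ℂ] (B ⊗[ℂ] K) := (L : K →ₗ[ℂ] K).lTensor B

theorem tensorMap_snd_mul (s : 𝓜(ℂ, K)) (x y : B ⊗[ℂ] K) :
    tensorMap B s.snd x * y = x * tensorMap B s.fst y := by
  induction x using TensorProduct.induction_on with
  | zero => simp
  | add x x' hx hx' => rw [map_add, add_mul, add_mul, hx, hx']
  | tmul b k =>
    induction y using TensorProduct.induction_on with
    | zero => simp
    | add y y' hy hy' => rw [map_add, mul_add, mul_add, hy, hy']
    | tmul c l =>
      rw [LinearMap.lTensor_tmul, LinearMap.lTensor_tmul, Algebra.TensorProduct.tmul_mul_tmul,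
        Algebra.TensorProduct.tmul_mul_tmul]
      exact congrArg _ (s.central k l)

theorem star_tensorMap_fst (s : 𝓜(ℂ, K)) (x : B ⊗[ℂ] K) :
    star (tensorMap B s.fst x) = tensorMap B (star s).snd (star x) := by
  induction x using TensorProduct.induction_on with
  | zero => simp
  | add x y hx hy => rw [map_add, star_add, star_add, map_add, hx, hy]
  | tmul b k =>
    rw [LinearMap.lTensor_tmul, TensorProduct.star_tmul, TensorProduct.star_tmul,
      LinearMap.lTensor_tmul]
    simp [DoubleCentralizer.star_snd]

theorem tensorMap_fst_mul (s t : 𝓜(ℂ, K)) (x : B ⊗[ℂ] K) :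
    tensorMap B s.fst (tensorMap B t.fst x) = tensorMap B (s * t).fst x := by
  induction x using TensorProduct.induction_on with
  | zero => simp
  | add x y hx hy => simp only [map_add, hx, hy]
  | tmul b k =>
    simp only [LinearMap.lTensor_tmul]
    rfl

theorem tensorMap_fst_add_of_add_eq_one {s t : 𝓜(ℂ, K)} (h : s + t = 1) (x : B ⊗[ℂ] K) :
    tensorMap B s.fst x + tensorMap B t.fst x = x := by
  induction x using TensorProduct.induction_on with
  | zero => simp
  | add x y hx hy => rw [map_add, map_add, add_add_add_comm, hx, hy]
  | tmul b k =>
    have h1 : s.fst k + t.fst k = k := congrArg (fun m : 𝓜(ℂ, K) => m.fst k) h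
    rw [LinearMap.lTensor_tmul, LinearMap.lTensor_tmul, ← TensorProduct.tmul_add]
    exact congrArg _ h1

/-- In D one has |j(sx)|² + |j(dx)|² = |j(x)|², with both summands positive. Contractivity thus
follows for any ⋆-homomorphism j, without a formula for the norm of D. -/
theorem norm_tensorMap_fst_le (j : (B ⊗[ℂ] K) →⋆ₙₐ[ℂ] D) {s d : 𝓜(ℂ, K)}
    (h : star s * s + star d * d = 1) (x : B ⊗[ℂ] K) :
    ‖j (tensorMap B s.fst x)‖ ≤ ‖j x‖ := by
  let _ : PartialOrder D := CStarAlgebra.spectralOrder D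
  have _ : StarOrderedRing D := CStarAlgebra.spectralOrderedRing D
  have key : ∀ s : 𝓜(ℂ, K), star (j (tensorMap B s.fst x)) * j (tensorMap B s.fst x)
      = j (star x * tensorMap B (star s * s).fst x) := by
    intro s
    rw [← map_star, ← map_mul, star_tensorMap_fst, tensorMap_snd_mul, tensorMap_fst_mul]
  have hsum : star (j (tensorMap B s.fst x)) * j (tensorMap B s.fst x)
      + star (j (tensorMap B d.fst x)) * j (tensorMap B d.fst x) = star (j x) * j x := by
    rw [key, key, ← map_add, ← mul_add, tensorMap_fst_add_of_add_eq_one h, map_mul, map_star]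
  refine le_of_sq_le_sq ?_ (norm_nonneg _)
  rw [sq, sq, ← CStarRing.norm_star_mul_self, ← CStarRing.norm_star_mul_self (x := j x), ← hsum]
  exact CStarAlgebra.norm_le_norm_of_nonneg_of_le (star_mul_self_nonneg _)
    (le_add_of_nonneg_right (star_mul_self_nonneg _))

/-- The multiplier `m` acts as `1 ⊗ s` along `j`. -/
def Represents (j : (B ⊗[ℂ] K) →⋆ₙₐ[ℂ] D) (m : 𝓜(ℂ, D)) (s : 𝓜(ℂ, K)) : Prop :=
  ∀ (b : B) (k : K), m.fst (j (b ⊗ₜ k)) = j (b ⊗ₜ s.fst k) ∧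
    m.snd (j (b ⊗ₜ k)) = j (b ⊗ₜ s.snd k)

variable {j : (B ⊗[ℂ] K) →⋆ₙₐ[ℂ] D}

/-- Left multiplication by 1 ⊗ s is contractive on the dense image of j, hence extends; right
multiplication is reduced by adjoints to the same estimate for s⋆. The two hypotheses supply the
complements needed for s and for s⋆. -/
theorem exists_represents (hj : DenseRange j) {s d d' : 𝓜(ℂ, K)}
    (h : star s * s + star d * d = 1) (h' : s * star s + star d' * d' = 1) :
    ∃ m, Represents j m s := by
  let J : (B ⊗[ℂ] K) →ₗ[ℂ] D := ⟨⟨j, map_add j⟩, map_smul j⟩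
  have hJ : DenseRange J := hj
  have hL : ∃ C, ∀ x, ‖(J ∘ₗ tensorMap B s.fst) x‖ ≤ C * ‖J x‖ :=
    ⟨1, fun x => (norm_tensorMap_fst_le j h x).trans (one_mul _).ge⟩
  have hR : ∃ C, ∀ x, ‖(J ∘ₗ tensorMap B s.snd) x‖ ≤ C * ‖J x‖ := by
    refine ⟨1, fun x => ?_⟩
    have h1 := norm_tensorMap_fst_le j (s := star s) (d := d') (by rwa [star_star]) (star x)
    rw [← norm_star, ← map_star, star_tensorMap_fst, star_star, star_star, map_star,
      norm_star] at h1
    exact h1.trans (one_mul _).ge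
  have hLx := fun x => LinearMap.extendOfNorm_eq hJ hL x
  have hRx := fun x => LinearMap.extendOfNorm_eq hJ hR x
  set L := (J ∘ₗ tensorMap B s.fst).extendOfNorm J
  set R := (J ∘ₗ tensorMap B s.snd).extendOfNorm J
  refine ⟨{ toProd := (L, R), central := fun a b => ?_ }, fun b k => ⟨?_, ?_⟩⟩
  · refine hJ.induction_on₂ (p := fun a b => R a * b = a * L b) ?_ (fun x y => ?_) a b
    · exact isClosed_eq (by fun_prop) (by fun_prop)
    · rw [hLx, hRx]
      have h1 := congrArg j (tensorMap_snd_mul s x y)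
      rwa [map_mul, map_mul] at h1
  · exact hLx (b ⊗ₜ k)
  · exact hRx (b ⊗ₜ k)

theorem ext_of_denseRange (hj : DenseRange j) {f g : D → D} (hf : Continuous f)
    (hg : Continuous g) (hfa : ∀ a b, f (a + b) = f a + f b) (hga : ∀ a b, g (a + b) = g a + g b)
    (h : ∀ (b : B) (k : K), f (j (b ⊗ₜ k)) = g (j (b ⊗ₜ k))) : f = g := by
  refine hj.equalizer hf hg (funext fun x => ?_)
  induction x using TensorProduct.induction_on with
  | zero => simpa using h 0 0
  | add x y hx hy =>
    simp only [Function.comp_apply] at hx hy ⊢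
    rw [map_add, hfa, hga, hx, hy]
  | tmul b k => exact h b k

theorem multiplier_ext_of_denseRange (hj : DenseRange j) {m n : 𝓜(ℂ, D)}
    (h₁ : ∀ (b : B) (k : K), m.fst (j (b ⊗ₜ k)) = n.fst (j (b ⊗ₜ k)))
    (h₂ : ∀ (b : B) (k : K), m.snd (j (b ⊗ₜ k)) = n.snd (j (b ⊗ₜ k))) : m = n :=
  multiplier_ext
    (congrFun (ext_of_denseRange hj m.fst.continuous n.fst.continuous (map_add _) (map_add _) h₁))
    (congrFun (ext_of_denseRange hj m.snd.continuous n.snd.continuous (map_add _) (map_add _) h₂))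

namespace Represents

variable {m n : 𝓜(ℂ, D)} {s t : 𝓜(ℂ, K)}

theorem unique (hj : DenseRange j) (hm : Represents j m s) (hn : Represents j n s) : m = n :=
  multiplier_ext_of_denseRange hj (fun b k => by rw [(hm b k).1, (hn b k).1])
    (fun b k => by rw [(hm b k).2, (hn b k).2])

theorem one : Represents j 1 1 := fun _ _ => ⟨rfl, rfl⟩

theorem zero : Represents j 0 0 := fun b k => by
  have h : j (b ⊗ₜ[ℂ] (0 : K)) = 0 := by rw [TensorProduct.tmul_zero, map_zero]
  exact ⟨h.symm, h.symm⟩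

theorem mul (hm : Represents j m s) (hn : Represents j n t) : Represents j (m * n) (s * t) :=
  fun b k => ⟨by
    change m.fst (n.fst _) = j (b ⊗ₜ s.fst (t.fst k))
    rw [(hn b k).1, (hm b _).1], by
    change n.snd (m.snd _) = j (b ⊗ₜ t.snd (s.snd k))
    rw [(hm b k).2, (hn b _).2]⟩

theorem add (hm : Represents j m s) (hn : Represents j n t) : Represents j (m + n) (s + t) :=
  fun b k => ⟨by
    change m.fst _ + n.fst _ = j (b ⊗ₜ (s.fst k + t.fst k))
    rw [(hn b k).1, (hm b k).1, TensorProduct.tmul_add, map_add], by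
    change m.snd _ + n.snd _ = j (b ⊗ₜ (s.snd k + t.snd k))
    rw [(hn b k).2, (hm b k).2, TensorProduct.tmul_add, map_add]⟩

theorem sum {ι : Type*} (F : Finset ι) {m : ι → 𝓜(ℂ, D)} {s : ι → 𝓜(ℂ, K)}
    (h : ∀ i, Represents j (m i) (s i)) : Represents j (∑ i ∈ F, m i) (∑ i ∈ F, s i) := by
  classical
  induction F using Finset.induction_on with
  | empty => exact zero
  | insert a F ha ih =>
    rw [Finset.sum_insert ha, Finset.sum_insert ha]
    exact (h a).add ih

theorem star (hm : Represents j m s) : Represents j (star m) (star s) := fun b k => by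
  have h0 : Star.star (j (b ⊗ₜ k)) = j (Star.star b ⊗ₜ Star.star k) := by
    rw [← map_star, TensorProduct.star_tmul]
  rw [DoubleCentralizer.star_fst, DoubleCentralizer.star_snd, h0, (hm _ _).1, (hm _ _).2,
    ← map_star, ← map_star, TensorProduct.star_tmul, TensorProduct.star_tmul, star_star]
  exact ⟨rfl, rfl⟩

/-- A multiplier representing `1 ⊗ s` is invariant under automorphisms of the form `σ ⊗ id`. -/
theorem multiplierExt_eq (hj : DenseRange j) (hm : Represents j m s) {θ : D ≃⋆ₐ[ℂ] D}
    {σ : B → B} (hσ : σ.Surjective) (hθ : ∀ b k, θ (j (b ⊗ₜ k)) = j (σ b ⊗ₜ k)) :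
    multiplierExt θ m = m := by
  have hθs : ∀ b k, θ.symm (j (σ b ⊗ₜ k)) = j (b ⊗ₜ k) := fun b k => by
    rw [← hθ, StarAlgEquiv.symm_apply_apply]
  refine multiplier_ext_of_denseRange hj (fun b k => ?_) (fun b k => ?_) <;>
    obtain ⟨c, rfl⟩ := hσ b
  · change θ (m.fst (θ.symm _)) = _
    rw [hθs, (hm _ _).1, (hm _ _).1, hθ]
  · change θ (m.snd (θ.symm _)) = _
    rw [hθs, (hm _ _).2, (hm _ _).2, hθ]

end Represents

/-- On elementary tensors a ⋆-homomorphism is bounded in the second variable. -/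
theorem exists_norm_tmul_le (j : (B ⊗[ℂ] K) →⋆ₙₐ[ℂ] D) (c : B) :
    ∃ C : ℝ, ∀ k : K, ‖j (c ⊗ₜ k)‖ ≤ C * ‖k‖ := by
  let _ : PartialOrder D := CStarAlgebra.spectralOrder D
  have _ : StarOrderedRing D := CStarAlgebra.spectralOrderedRing D
  let _ : PartialOrder K := CStarAlgebra.spectralOrder K
  have _ : StarOrderedRing K := CStarAlgebra.spectralOrderedRing K
  have hmul : ∀ k : K, j ((star c * c) ⊗ₜ (star k * k)) = star (j (c ⊗ₜ k)) * j (c ⊗ₜ k) := by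
    intro k
    rw [← map_star, ← map_mul, TensorProduct.star_tmul, Algebra.TensorProduct.tmul_mul_tmul]
  let J : (B ⊗[ℂ] K) →ₗ[ℂ] D := ⟨⟨j, map_add j⟩, map_smul j⟩
  -- The map k ↦ j(c⋆c ⊗ k) is positive, hence bounded. Applied to k⋆k it gives ‖j(c ⊗ k)‖² ≤ C
  -- ‖k‖².
  let f : K →ₗ[ℂ] D := J ∘ₗ TensorProduct.mk ℂ B K (star c * c)
  have hf : ∀ k : K, 0 ≤ k → 0 ≤ f k := by
    intro k hk
    obtain ⟨l, rfl⟩ := CStarAlgebra.nonneg_iff_eq_star_mul_self.1 hk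
    change 0 ≤ j ((star c * c) ⊗ₜ (star l * l))
    rw [hmul]
    exact star_mul_self_nonneg _
  obtain ⟨C, hC⟩ := PositiveLinearMap.exists_norm_apply_le (PositiveLinearMap.mk₀ f hf)
  refine ⟨√C, fun k => le_of_sq_le_sq ?_ (by positivity)⟩
  have h1 := hC (star k * k)
  rw [CStarRing.norm_star_mul_self] at h1
  rw [sq, ← CStarRing.norm_star_mul_self, ← hmul, mul_pow, Real.sq_sqrt C.coe_nonneg, sq]
  exact h1

/-- If bounded multipliers `s N` of `K` converge strictly to `1`, then so do multipliers acting as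
`1 ⊗ s N`. -/
theorem strictTendsto_one_of_represents (hj : DenseRange j) {s : ℕ → 𝓜(ℂ, K)}
    (hs : StrictTendsto s atTop 1) {m : ℕ → 𝓜(ℂ, D)} (hm : ∀ N, Represents j (m N) (s N))
    (hm1 : ∀ N, ‖m N‖ ≤ 1) : StrictTendsto m atTop 1 := by
  have hcont : ∀ (b : B) (u : ℕ → K) (k : K), Tendsto u atTop (𝓝 k) →
      Tendsto (fun N => j (b ⊗ₜ[ℂ] u N)) atTop (𝓝 (j (b ⊗ₜ k))) := by
    intro b u k hu
    obtain ⟨C, hC⟩ := exists_norm_tmul_le j b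
    rw [tendsto_iff_norm_sub_tendsto_zero] at hu ⊢
    refine squeeze_zero (fun _ => norm_nonneg _) (fun N => ?_) (by simpa using hu.const_mul C)
    rw [← map_sub, ← TensorProduct.tmul_sub]
    exact hC _
  have key : ∀ f : ℕ → (D →L[ℂ] D), (∀ N, ‖f N‖ ≤ 1) →
      (∀ (b : B) (k : K), Tendsto (fun N => f N (j (b ⊗ₜ k))) atTop (𝓝 (j (b ⊗ₜ k)))) →
      ∀ x, Tendsto (fun N => f N x) atTop (𝓝 x) := by
    intro f hf hfb x
    have halg : ∀ y, Tendsto (fun N => f N (j y)) atTop (𝓝 (j y)) := by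
      intro y
      induction y using TensorProduct.induction_on with
      | zero => simp
      | add y z hy hz => simpa only [map_add] using hy.add hz
      | tmul b k => exact hfb b k
    rw [Metric.tendsto_nhds]
    intro ε hε
    obtain ⟨y, hy⟩ := Metric.denseRange_iff.1 hj x (ε / 3) (by positivity)
    have h1 := (tendsto_iff_norm_sub_tendsto_zero.1 (halg y)).eventually_lt_const
      (show 0 < ε / 3 by positivity)
    filter_upwards [h1] with N hN
    rw [dist_eq_norm] at hy ⊢
    have h2 : ‖f N (x - j y)‖ ≤ 1 * ‖x - j y‖ := ((f N).le_opNorm _).trans (by gcongr; exact hf N)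
    have h3 : f N x - x = f N (x - j y) + (f N (j y) - j y) - (x - j y) := by rw [map_sub]; abel
    rw [h3]
    have h4 := norm_sub_le (f N (x - j y) + (f N (j y) - j y)) (x - j y)
    have h5 := norm_add_le (f N (x - j y)) (f N (j y) - j y)
    linarith
  intro x
  refine ⟨key (fun N => (m N).fst) (fun N => ?_) (fun b k => ?_) x,
    key (fun N => (m N).snd) (fun N => ?_) (fun b k => ?_) x⟩
  · simpa only [DoubleCentralizer.norm_fst] using hm1 N
  · simp only [(hm _ _ _).1]
    exact hcont b _ k (hs k).1
  · simpa only [DoubleCentralizer.norm_snd] using hm1 N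
  · simp only [(hm _ _ _).2]
    exact hcont b _ k (hs k).2

/-- A sequence of isometries in the multiplier algebra of a tensor factor gives a sequence of
isometries in the multiplier algebra of the tensor product. -/
theorem exists_represents_sequence (hj : DenseRange j) {s : ℕ → 𝓜(ℂ, K)}
    (hs : ∀ m n, star (s m) * s n = if m = n then 1 else 0)
    (hs1 : StrictTendsto (fun N => ∑ n ∈ Finset.range N, s n * star (s n)) atTop 1) :
    ∃ t : ℕ → 𝓜(ℂ, D), (∀ n, Represents j (t n) (s n)) ∧ (∀ n, star (t n) * t n = 1) ∧
      StrictTendsto (fun N => ∑ n ∈ Finset.range N, t n * star (t n)) atTop 1 := by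
  have hss : ∀ n, star (s n) * s n = 1 := fun n => by rw [hs, if_pos rfl]
  have hex : ∀ n, ∃ m, Represents j m (s n) := by
    intro n
    -- For an isometry the complement of s is 0 and that of s⋆ is the projection 1 - s s⋆.
    refine exists_represents hj (d := 0) (d' := 1 - s n * star (s n)) (by simp [hss]) ?_
    have h1 : s n * star (s n) * (s n * star (s n)) = s n * star (s n) := by
      rw [mul_assoc, ← mul_assoc (star (s n)), hss, one_mul]
    simp only [star_sub, star_one, star_mul, star_star]
    rw [sub_mul, mul_sub, mul_sub, h1]
    simp
  choose t ht using hex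
  have htt : ∀ m n, star (t m) * t n = if m = n then 1 else 0 := by
    intro m n
    have h1 := (ht m).star.mul (ht n)
    rw [hs] at h1
    split_ifs with h
    · rw [if_pos h] at h1
      exact h1.unique hj .one
    · rw [if_neg h] at h1
      exact h1.unique hj .zero
  exact ⟨t, ht, fun n => by rw [htt, if_pos rfl], strictTendsto_one_of_represents hj hs1
    (fun N => Represents.sum _ fun n => (ht n).mul (ht n).star) (norm_sum_mul_star_le_one htt)⟩

end Stabilization

/-! ### Compact operators and the invariant isometries of a strongly stable action -/

section Compact

/-- The C⋆-algebra of compact operators. -/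
abbrev compactOpsCStarAlgebra : NonUnitalCStarAlgebra CompactOps :=
  have := isClosed_compactOps
  inferInstance

attribute [local instance] compactOpsCStarAlgebra

/-- A bounded operator as a multiplier of the compact operators. -/
def operatorMultiplier (s : EllTwo →L[ℂ] EllTwo) : 𝓜(ℂ, CompactOps) where
  toProd :=
    (LinearMap.mkContinuous
      { toFun := fun k => ⟨s * k.1, (show IsCompactOperator k.1 from k.2).clm_comp s⟩
        map_add' := fun _ _ => Subtype.ext (mul_add _ _ _)
        map_smul' := fun _ _ => Subtype.ext (mul_smul_comm _ _ _) } ‖s‖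
      fun k => norm_mul_le s k.1,
     LinearMap.mkContinuous
      { toFun := fun k => ⟨k.1 * s, (show IsCompactOperator k.1 from k.2).comp_clm s⟩
        map_add' := fun _ _ => Subtype.ext (add_mul _ _ _)
        map_smul' := fun _ _ => Subtype.ext (smul_mul_assoc _ _ _) } ‖s‖
      fun k => (norm_mul_le k.1 s).trans (mul_comm _ _).le)
  central := fun k l => Subtype.ext (mul_assoc k.1 s l.1)

theorem operatorMultiplier_one : operatorMultiplier 1 = 1 :=
  multiplier_ext (fun _ => Subtype.ext (one_mul _)) (fun _ => Subtype.ext (mul_one _))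

theorem operatorMultiplier_zero : operatorMultiplier 0 = 0 :=
  multiplier_ext (fun _ => Subtype.ext (zero_mul _)) (fun _ => Subtype.ext (mul_zero _))

theorem operatorMultiplier_add (s t : EllTwo →L[ℂ] EllTwo) :
    operatorMultiplier (s + t) = operatorMultiplier s + operatorMultiplier t :=
  multiplier_ext (fun _ => Subtype.ext (add_mul _ _ _)) (fun _ => Subtype.ext (mul_add _ _ _))

theorem operatorMultiplier_mul (s t : EllTwo →L[ℂ] EllTwo) :
    operatorMultiplier (s * t) = operatorMultiplier s * operatorMultiplier t :=
  multiplier_ext (fun _ => Subtype.ext (mul_assoc _ _ _))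
    (fun _ => Subtype.ext (mul_assoc _ _ _).symm)

theorem operatorMultiplier_star (s : EllTwo →L[ℂ] EllTwo) :
    operatorMultiplier (star s) = star (operatorMultiplier s) := by
  refine multiplier_ext (fun k => Subtype.ext ?_) (fun k => Subtype.ext ?_)
  · change star s * k.1 = star (star k.1 * s)
    rw [star_mul, star_star]
  · change k.1 * star s = star (s * star k.1)
    rw [star_mul, star_star]

theorem operatorMultiplier_sum (s : ℕ → (EllTwo →L[ℂ] EllTwo)) (N : ℕ) :
    operatorMultiplier (∑ n ∈ Finset.range N, s n)
      = ∑ n ∈ Finset.range N, operatorMultiplier (s n) := by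
  induction N with
  | zero => exact operatorMultiplier_zero
  | succ N ih => rw [Finset.sum_range_succ, Finset.sum_range_succ, operatorMultiplier_add, ih]

theorem exists_compact_multiplier_sequence : ∃ s : ℕ → 𝓜(ℂ, CompactOps),
    (∀ m n, star (s m) * s n = if m = n then 1 else 0) ∧
    StrictTendsto (fun N => ∑ n ∈ Finset.range N, s n * star (s n)) atTop 1 := by
  obtain ⟨s, hs, hsx⟩ := exists_operator_sequence
  refine ⟨fun n => operatorMultiplier (s n), fun m n => ?_, ?_⟩
  · rw [← operatorMultiplier_star, ← operatorMultiplier_mul, hs]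
    split_ifs
    exacts [operatorMultiplier_one, operatorMultiplier_zero]
  simp only [← operatorMultiplier_star, ← operatorMultiplier_mul, ← operatorMultiplier_sum]
  have hlim : ∀ k : CompactOps, Tendsto (fun N =>
      (∑ n ∈ Finset.range N, s n * star (s n)) * k.1) atTop (𝓝 k.1) := fun k =>
    tendsto_mul_of_isCompactOperator (norm_sum_mul_star_le_one hs) hsx k.2
  refine fun k => ⟨tendsto_subtype_rng.2 (hlim k), tendsto_subtype_rng.2 ?_⟩
  have h := (hlim (star k)).star
  change Tendsto (fun N => k.1 * ∑ n ∈ Finset.range N, s n * star (s n)) atTop (𝓝 k.1)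
  simpa [star_sum] using h

/-- A strongly stable action admits a sequence of invariant isometries with range projections
summing up to `1`. -/
theorem CStarAction.StronglyStable.nonempty_isometrySequence {G B : Type*} [Group G]
    [TopologicalSpace G] [NonUnitalCStarAlgebra B] {β : CStarAction G B} (hβ : β.StronglyStable) :
    Nonempty (IsometrySequence β) := by
  obtain ⟨j, -, hj, hjβ⟩ := hβ
  obtain ⟨s, hs, hs1⟩ := exists_compact_multiplier_sequence
  obtain ⟨t, ht, htt, ht1⟩ := exists_represents_sequence (j := j) hj hs hs1
  exact ⟨{ t := t
           isometry := htt
           fixed := fun n g => (ht n).multiplierExt_eq hj (β.aut g).surjective (hjβ g)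
           sum_eq_one := ht1 }⟩

end Compact

end

/-! ### The equivalence of weak containment and absorption -/

theorem corollary3p9 {G : Type*} [Group G] [TopologicalSpace G] [IsTopologicalGroup G]
    [LocallyCompactSpace G] [SecondCountableTopology G]
    {A B : Type*} [NonUnitalCStarAlgebra A] [NonUnitalCStarAlgebra B]
    [TopologicalSpace.SeparableSpace A] (hB : IsSigmaUnital B)
    (α : CStarAction G A) (β : CStarAction G B) (hβ : β.StronglyStable) :
    Nonempty (IsometrySequence β) ∧ Nonempty (CuntzIsometries β) ∧
    ∀ (φ ψ : CocycleRep α β) (T₁ T₂ T₃ : IsometrySequence β) (r : CuntzIsometries β),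
      CocycleRep.WeaklyContained ψ φ ↔
        CocycleRep.AsympEquiv (φ.infiniteRepeat T₁)
          (CocycleRep.cuntzSum r (ψ.infiniteRepeat T₂) (φ.infiniteRepeat T₃)) := by
  obtain ⟨T⟩ := hβ.nonempty_isometrySequence
  refine ⟨⟨T⟩, ⟨T.exists_cuntz_shift.choose⟩, fun φ ψ T₁ T₂ T₃ r =>
    ⟨fun h => ?_, fun h => h.weaklyContained⟩⟩
  -- The path is built for ψ^∞ rather than ψ: moving one copy out of the range of an isometry
  -- requires the absorbed representation to commute with a Cuntz pair.
  obtain ⟨R, hR⟩ := (h.finitelyContained.infiniteRepeat T₂).exists_isIntertwiningPath hB T₁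
  exact hR.asympEquiv T₃ r
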